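/- Let $n$ roads $x<0$ (indices $i=1,\dots,n$) merge at $x=0$ into one road $x>0$ (index $j$), with constant initial data $(\rho_{i,0},w_i)$ and $(\rho_{j,0},w_{j,0})$, where $\rho_{i,0}\ge 0$, $w_i>0$, $\rho_{j,0}>0$. The initial outgoing pressure is $p_{j,0}(\rho)=c_{j,0}\rho^\gamma$ with $c_{j,0}>0$, $\gamma\ge 1$. The incoming pressures $p_i$ are continuous on $[0,\infty)$, strictly increasing and unbounded with $p_i(0)=0$, differentiable on $(0,\infty)$, and $\rho\,p_i(\rho)$ is strictly convex. Put $v=w-p(\rho)$ and assume that all initial velocities are nonnegative; write $v_{j,0}=w_{j,0}-p_{j,0}(\rho_{j,0})$. Let $\beta_i\ge 0$, $\sum_i\beta_i=1$ be priorities and $\overline w=\sum_i\beta_iw_i$. The homogenized pressure $p_j^*$ is given by $p_j^*(1/\tau(v))=\overline w-v$, where $\tau(v)=\sum_i\beta_iP^{-1}(w_i-v)$ and $P(\tau)=p_{j,0}(1/\tau)$. An approximated homogenized pressure is a function $p_j^{**}=c\,p_{j,0}$ on $[0,\infty)$, with $c$ a constant, that agrees with $p_j^*$ at $v=0$, i.e.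 $p_j^{**}(1/\tau(0))=p_j^*(1/\tau(0))$. A network solution is a pressure $p_j^{**}$ together with functions $(\rho_k,w_k)(x,t)$ on the $n+1$ roads, bounded, depending only on $x/t$, with $\rho_k\ge0$ and $v_k\ge0$, such that: (a) $p_j^{**}$ is an approximated homogenized pressure; the pressure law is $p_i$ on road $i$, $p_j^{**}$ in the triangle $0<x<t\,v_{j,0}$ of the outgoing road, and $p_{j,0}$ for $x>t\,v_{j,0}$; and $w_j=\overline w$ in the triangle. (b) They form a weak solution of $\partial_t(\rho,\rho w)+\partial_x(\rho v,\rho vw)=0$ at the junction: for all smooth compactly supported $\Phi_k$ with $\Phi_i(0,t)=\Phi_j(0,t)$ for all $i$ and all $t\ge 0$, $$\sum_k\Big(\int_0^\infty\!\!\int_{I_k}\big[(\rho_k,\rho_kw_k)\cdot\partial_t\Phi_k+(\rho_kv_k,\rho_kv_kw_k)\cdot\partial_x\Phi_k\big]\,dx\,dt+\int_{I_k}(\rho_{k,0},\rho_{k,0}w_{k,0})\cdot\Phi_k(x,0)\,dx\Big)=0,$$ where $k$ runs over all roads, $I_k$ is the half-line of road $k$, and $w_{i,0}=w_i$. (c)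 On every ray $x=\xi t$ inside a road, except $x=t\,v_{j,0}$ on the outgoing road, $\rho$ and $w$ have one-sided limits, and $v$ does not increase across the ray from left to right (entropy condition). (d) The fluxes $q_i=(\rho_iv_i)(0-,t)$ and $q_j=(\rho_jv_j)(0+,t)$ exist, $q_j=\sum_iq_i$, and $\sum_iq_i$ is maximal among all $(q_1,\dots,q_n)$ of the form $q_i=z\beta_i$, $z\in\mathbb R$, with $0\le q_i\le d(p_i;\rho_{i,0},w_i)$ for all $i$ and $0\le\sum_iq_i\le s(p_j^{**};\tilde\rho,\overline w)$. Here, with $\sigma$ the maximum point of $f(\rho)=\rho(w-p(\rho))$ on $[0,\infty)$, the demand $d(p;\rho,w)$ is $f(\rho)$ if $\rho\le\sigma$ and $f(\sigma)$ otherwise, the supply $s(p;\rho,w)$ is $f(\sigma)$ if $\rho\le\sigma$ and $f(\rho)$ otherwise; and $\tilde\rho\ge 0$ solves $\overline w-p_j^{**}(\tilde\rho)=v_{j,0}$ if this is solvable, and $\tilde\rho=0$ otherwise. Then the approximated homogenized pressure is unique and is given by $$p_j^{**}(\rho)=c_{j,0}\Big(\sum_{i=1}^n\beta_iw_i\Big(\sum_{l=1}^n\frac{\beta_l}{w_l^{1/\gamma}}\Big)^{\gamma}\Big)\rho^\gamma\qquad(\rho\ge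 0),$$ and with this pressure there is a network solution, which is unique: any two network solutions have, on every road and at every time $t>0$, the same $\rho$ and the same $\rho w$ for almost every $x$. -/

import Mathlib

open Set Filter Topology MeasureTheory

noncomputable section

namespace ARZ

/-! ### Pressure laws, flux, demand and supply -/

/-- A pressure function on densities `ρ ≥ 0`: continuous, vanishing at the vacuum, strictly
increasing and unbounded, differentiable away from the vacuum, and with `ρ p(ρ)` strictly convex
(genuine nonlinearity of the first characteristic field). For every `w > 0` the flux
`ρ (w - p(ρ))` is then strictly concave on `[0, ∞)` and has exactly one maximum point. -/
structure IsPressureLaw (p : ℝ → ℝ) : Prop where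
  map_zero : p 0 = 0
  continuousOn : ContinuousOn p (Ici 0)
  differentiableOn : DifferentiableOn ℝ p (Ioi 0)
  strictMonoOn : StrictMonoOn p (Ici 0)
  strictConvexOn : StrictConvexOn ℝ (Ici 0) (fun ρ => ρ * p ρ)
  tendsto_atTop : Tendsto p atTop atTop

/-- The flux `ρ v = ρ (w - p(ρ))` as a function of the density, for a fixed Lagrangian marker. -/
def flux (p : ℝ → ℝ) (w ρ : ℝ) : ℝ := ρ * (w - p ρ)

/-- The maximum point `σ(w)` of the flux on `[0, ∞)` (the set below is a singleton whenever the
maximum point exists and is unique). -/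
def criticalDensity (p : ℝ → ℝ) (w : ℝ) : ℝ :=
  sSup {σ | 0 ≤ σ ∧ ∀ ρ, 0 ≤ ρ → flux p w ρ ≤ flux p w σ}

/-- The demand `d(p; ρ, w)`. -/
def demand (p : ℝ → ℝ) (ρ w : ℝ) : ℝ :=
  if ρ ≤ criticalDensity p w then flux p w ρ else flux p w (criticalDensity p w)

/-- The supply `s(p; ρ, w)`. -/
def supply (p : ℝ → ℝ) (ρ w : ℝ) : ℝ :=
  if ρ ≤ criticalDensity p w then flux p w (criticalDensity p w) else flux p w ρ

open Classical in
/-- The density `ρ̃` at the intersection of the curves `{v + p(ρ) = w}` and `{v = v₀}` if they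
intersect, and `0` (vacuum) otherwise. -/
def intermediateDensity (p : ℝ → ℝ) (w v₀ : ℝ) : ℝ :=
  if h : ∃ ρ, 0 ≤ ρ ∧ w - p ρ = v₀ then h.choose else 0

/-! ### Homogenized pressure and its approximation -/

/-- The homogenized Lagrangian marker `∑ βᵢ wᵢ` of a mixture with proportions `β`. -/
def meanMarker {n : ℕ} (β w : Fin n → ℝ) : ℝ := ∑ i, β i * w i

/-- `τ = ∑ βᵢ P⁻¹(wᵢ - v)` with `P(τ) = p(1/τ)`: the specific volume of the mixture when all its
components travel with velocity `v`. -/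
def IsMixtureVolume {n : ℕ} (p : ℝ → ℝ) (β w : Fin n → ℝ) (v τ : ℝ) : Prop :=
  ∃ τs : Fin n → ℝ, (∀ i, 0 < τs i ∧ p (1 / τs i) = w i - v) ∧ τ = ∑ i, β i * τs i

/-- `pstar` is the homogenized pressure `p*` of the mixture: with `τ(v) = ∑ βᵢ P⁻¹(wᵢ - v)`,
it satisfies `v + p*(1/τ(v)) = ∑ βᵢ wᵢ` for every `v` for which `τ(v)` is defined. -/
def IsHomogenizedPressure {n : ℕ} (p : ℝ → ℝ) (β w : Fin n → ℝ) (pstar : ℝ → ℝ) : Prop :=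
  ∀ v τ, IsMixtureVolume p β w v τ → pstar (1 / τ) = meanMarker β w - v

/-- `P` is the approximated homogenized pressure `p**` of the mixture: `P = c p` with a
constant `c` (independent of the density), calibrated so that it agrees with the homogenized
pressure `p*` at `v = 0`. -/
def IsApproxHomogenizedPressure {n : ℕ} (p : ℝ → ℝ) (β w : Fin n → ℝ) (P : ℝ → ℝ) : Prop :=
  (∃ c : ℝ, ∀ ρ, 0 ≤ ρ → P ρ = c * p ρ) ∧
    ∃ pstar : ℝ → ℝ, IsHomogenizedPressure p β w pstar ∧
      ∃ τ : ℝ, IsMixtureVolume p β w 0 τ ∧ P (1 / τ) = pstar (1 / τ)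

/-! ### The junction and the states on its roads -/

/-- Data of a junction at `x = 0` with `n` incoming roads `x < 0` and one outgoing road `x > 0`:
initial pressures, constant initial densities and Lagrangian markers, and the priority vector. -/
structure MergeJunction (n : ℕ) where
  pIn : Fin n → ℝ → ℝ
  ρIn : Fin n → ℝ
  wIn : Fin n → ℝ
  pOut : ℝ → ℝ
  ρOut : ℝ
  wOut : ℝ
  β : Fin n → ℝ

/-- The initial velocity on the outgoing road. -/
def MergeJunction.vOut {n : ℕ} (J : MergeJunction n) : ℝ := J.wOut - J.pOut J.ρOut

/-- Density and Lagrangian marker on a road as functions of `x` and `t`. -/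
structure RoadState where
  ρ : ℝ → ℝ → ℝ
  w : ℝ → ℝ → ℝ

/-- The velocity `v = w - p(ρ)`, where the pressure law `p x t` may depend on the point. -/
def RoadState.v (U : RoadState) (p : ℝ → ℝ → ℝ → ℝ) (x t : ℝ) : ℝ := U.w x t - p x t (U.ρ x t)

/-- The pressure law on the incoming road `i`: unchanged. -/
def MergeJunction.pressureIn {n : ℕ} (J : MergeJunction n) (i : Fin n) : ℝ → ℝ → ℝ → ℝ :=
  fun _ _ => J.pIn i

/-- The pressure law on the outgoing road: `P` in the triangle `0 < x < t v₀`, where `v₀` is the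
initial velocity, and the initial pressure ahead of it. -/
def MergeJunction.pressureOut {n : ℕ} (J : MergeJunction n) (P : ℝ → ℝ) : ℝ → ℝ → ℝ → ℝ :=
  fun x t => if x < t * J.vOut then P else J.pOut

/-- States on a road with domain `D` (a half-line) that qualify for a Riemann problem: bounded,
nonnegative density and velocity, functions of `x / t`. -/
structure IsRiemannState (D : Set ℝ) (p : ℝ → ℝ → ℝ → ℝ) (U : RoadState) : Prop where
  density_nonneg : ∀ x ∈ D, ∀ t > 0, 0 ≤ U.ρ x t
  velocity_nonneg : ∀ x ∈ D, ∀ t > 0, 0 ≤ U.v p x t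
  bounded : ∃ M : ℝ, ∀ x ∈ D, ∀ t > 0, |U.ρ x t| ≤ M ∧ |U.w x t| ≤ M
  selfSimilar : ∀ x ∈ D, ∀ t > 0, U.ρ x t = U.ρ (x / t) 1 ∧ U.w x t = U.w (x / t) 1

/-- The state has one-sided limits at the ray `x = ξ t`, and if it jumps there then the jump
satisfies the entropy condition: the velocity does not increase across the ray. -/
def IsAdmissibleAt (p : ℝ → ℝ) (U : RoadState) (ξ : ℝ) : Prop :=
  ∃ ρl ρr wl wr : ℝ,
    Tendsto (fun y => U.ρ y 1) (𝓝[<] ξ) (𝓝 ρl) ∧ Tendsto (fun y => U.ρ y 1) (𝓝[>] ξ) (𝓝 ρr) ∧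
    Tendsto (fun y => U.w y 1) (𝓝[<] ξ) (𝓝 wl) ∧ Tendsto (fun y => U.w y 1) (𝓝[>] ξ) (𝓝 wr) ∧
    wr - p ρr ≤ wl - p ρl

/-! ### Weak solutions at the junction -/

/-- Smooth compactly supported test functions of `x` and `t`. -/
def IsTestFunction (φ : ℝ → ℝ → ℝ) : Prop :=
  ContDiff ℝ (⊤ : ℕ∞) (Function.uncurry φ) ∧ HasCompactSupport (Function.uncurry φ)

/-- The contribution of one road with domain `D` to the weak form of `∂ₜ u + ∂ₓ f = 0` with the
constant initial value `u₀`. -/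
def weakForm (D : Set ℝ) (u f : ℝ → ℝ → ℝ) (u₀ : ℝ) (φ : ℝ → ℝ → ℝ) : ℝ :=
  (∫ t in Ioi (0 : ℝ), ∫ x in D,
      (u x t * deriv (fun s => φ x s) t + f x t * deriv (fun y => φ y t) x))
    + ∫ x in D, u₀ * φ x 0

/-- Weak solutions of the network problem for the conservation of `ρ` and `ρ w`: the sum of the
weak forms over all roads vanishes for all families of test functions that agree at the junction.
(Testing with `ℝ²`-valued functions amounts to testing the two equations separately.) -/
def IsWeakNetworkSolution {n : ℕ} (J : MergeJunction n) (P : ℝ → ℝ)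
    (Uin : Fin n → RoadState) (Uout : RoadState) : Prop :=
  ∀ (φin : Fin n → ℝ → ℝ → ℝ) (φout : ℝ → ℝ → ℝ),
    (∀ i, IsTestFunction (φin i)) → IsTestFunction φout →
    (∀ i, ∀ t, 0 ≤ t → φin i 0 t = φout 0 t) →
    ((∑ i, weakForm (Iio 0) (Uin i).ρ
          (fun x t => (Uin i).ρ x t * (Uin i).v (J.pressureIn i) x t) (J.ρIn i) (φin i))
        + weakForm (Ioi 0) Uout.ρ
          (fun x t => Uout.ρ x t * Uout.v (J.pressureOut P) x t) J.ρOut φout = 0) ∧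
    ((∑ i, weakForm (Iio 0) (fun x t => (Uin i).ρ x t * (Uin i).w x t)
          (fun x t => (Uin i).ρ x t * (Uin i).v (J.pressureIn i) x t * (Uin i).w x t)
          (J.ρIn i * J.wIn i) (φin i))
        + weakForm (Ioi 0) (fun x t => Uout.ρ x t * Uout.w x t)
          (fun x t => Uout.ρ x t * Uout.v (J.pressureOut P) x t * Uout.w x t)
          (J.ρOut * J.wOut) φout = 0)

/-! ### Fluxes through the junction and the network solution -/

/-- Fluxes `q i` leaving the incoming roads that are compatible with the coupling rules when the
outgoing pressure is `P`. Since there is only one outgoing road, all of the flux enters it (every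
distribution coefficient is `1`), so the outgoing flux is `∑ q i`. -/
structure IsFeasibleFlux {n : ℕ} (J : MergeJunction n) (P : ℝ → ℝ) (q : Fin n → ℝ) : Prop where
  demand_bound : ∀ i, 0 ≤ q i ∧ q i ≤ demand (J.pIn i) (J.ρIn i) (J.wIn i)
  supply_bound : 0 ≤ ∑ i, q i ∧
    ∑ i, q i ≤ supply P (intermediateDensity P (meanMarker J.β J.wIn) J.vOut)
      (meanMarker J.β J.wIn)
  mixture : ∃ z : ℝ, ∀ i, q i = z * J.β i

/-- Feasible fluxes of maximal sum. -/
def IsMaximalFlux {n : ℕ} (J : MergeJunction n) (P : ℝ → ℝ) (q : Fin n → ℝ) : Prop :=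
  IsFeasibleFlux J P q ∧ ∀ q', IsFeasibleFlux J P q' → ∑ i, q' i ≤ ∑ i, q i

/-- The states `Uin`, `Uout`, with the pressure `P` behind the initial cars of the outgoing road,
form a network solution: `P` is the approximated homogenized pressure, the states are an
entropy-admissible self-similar weak solution of the network problem with marker `∑ βᵢ wᵢ` in the
triangle `0 < x < t v₀` of the outgoing road, and the fluxes at the junction are the maximal ones
allowed by the coupling rules. The ray `x = t v₀` carries the contact discontinuity, at which the
pressure law changes. -/
structure IsNetworkSolution {n : ℕ} (J : MergeJunction n) (P : ℝ → ℝ)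
    (Uin : Fin n → RoadState) (Uout : RoadState) : Prop where
  pressure : IsApproxHomogenizedPressure J.pOut J.β J.wIn P
  state_in : ∀ i, IsRiemannState (Iio 0) (J.pressureIn i) (Uin i)
  state_out : IsRiemannState (Ioi 0) (J.pressureOut P) Uout
  weak : IsWeakNetworkSolution J P Uin Uout
  admissible_in : ∀ i, ∀ ξ < 0, IsAdmissibleAt (J.pIn i) (Uin i) ξ
  admissible_triangle : ∀ ξ, 0 < ξ → ξ < J.vOut → IsAdmissibleAt P Uout ξ
  admissible_ahead : ∀ ξ, 0 < ξ → J.vOut < ξ → IsAdmissibleAt J.pOut Uout ξ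
  marker : ∀ x t, 0 < t → 0 < x → x < t * J.vOut → Uout.w x t = meanMarker J.β J.wIn
  junction_flux : ∃ q : Fin n → ℝ, IsMaximalFlux J P q ∧
    (∀ i, Tendsto (fun x => (Uin i).ρ x 1 * (Uin i).v (J.pressureIn i) x 1) (𝓝[<] 0) (𝓝 (q i))) ∧
    Tendsto (fun x => Uout.ρ x 1 * Uout.v (J.pressureOut P) x 1) (𝓝[>] 0) (𝓝 (∑ i, q i))

/-- Two states agree on the road with domain `D`: at every time the conserved quantities `ρ` and
`ρ w` coincide almost everywhere. (At vacuum the marker `w` has no meaning.) -/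
def AgreeOn (D : Set ℝ) (U V : RoadState) : Prop :=
  ∀ t > 0, ∀ᵐ x ∂(volume.restrict D),
    U.ρ x t = V.ρ x t ∧ U.ρ x t * U.w x t = V.ρ x t * V.w x t

end ARZ

end

noncomputable section

namespace ARZ

/-! ### Calculus of test functions along rays -/

/-! Write `A ξ = ∫ φ(ξ t, t) dt` for the integral of a test function along a ray. The substitution
`x = ξ t` turns the weak form of a self-similar field with density profile `U` and flux profile `F`
into `∫ (-U A + (F - ξ U) A') dξ` plus the initial term. So everything is carried by the single
function `H = F - ξ U`: being a weak solution inside a road means that `H` is continuous with `H' =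
-U` off a countable set (`IsProfile.exists_isPotential`). Continuity of `H` is the Rankine-Hugoniot
condition, `H ξ / ξ → -u₀` at infinity encodes the initial data
(`IsProfile.tendsto_potential_div_atTop`, `IsProfile.tendsto_potential_div_atBot`), and the value at
`ξ = 0` is the flux through the junction. Conversely, the weak form of such a field is plus or minus
the junction flux times `A 0` (`IsProfile.weakForm_eq_of_incoming`,
`IsProfile.weakForm_eq_of_outgoing`), so coupling the roads only requires balancing two sums of
fluxes.

Pressure: for a power law the volume `τ(0)` is explicit. A multiple of the power law that takes the
value `∑ βᵢ wᵢ` at `1 / τ(0)` has only one possible coefficient (`isApproxHomogenizedPressure_iff`).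

Uniqueness: the mixture rule determines the fluxes from their sum, hence the maximal fluxes are
unique (`IsMaximalFlux.unique`). It remains to see that `H` is determined on each road by its
boundary values. With `N` and `K` the potentials of `ρ` and `ρ w`, the combination `K - w N` is
transported and starts from zero, so it vanishes (`eq_zero_of_transported_incoming`,
`eq_zero_of_transported_outgoing`) and the marker is the initial one away from vacuum. Ahead of the
contact ray this forces the initial state (`IsPressureLaw.potential_ahead`), whence `N = 0` on the
contact ray. In the triangle the marker is prescribed. On the triangle and on nonempty incoming
roads `N` therefore solves `N = f(-N') + ξ N'` with concave `f`, and entropy orders the one-sided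
derivatives. A maximum principle (`IsEntropyPotential.sub_add_le`) then gives uniqueness of `N`, and
the density is `-N'`.

Existence: a rarefaction fan has as its potential the Legendre-type maximum of `f ρ - ξ ρ` over an
interval (`exists_fan`), a shock the minimum of two affine functions (`exists_shock`). One such wave
suffices on each incoming road and in the triangle, because demand and supply bound the fluxes that
waves of the admissible direction can attain. -/

/-- The partial derivative in `t`. -/
def timeDeriv (φ : ℝ → ℝ → ℝ) (x t : ℝ) : ℝ := deriv (fun s => φ x s) t

/-- The partial derivative in `x`. -/
def spaceDeriv (φ : ℝ → ℝ → ℝ) (x t : ℝ) : ℝ := deriv (fun y => φ y t) x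

/-- The integral of a function of `(x, t)` along the ray `x = ξ t`, `t > 0`. -/
def rayIntegral (φ : ℝ → ℝ → ℝ) (ξ : ℝ) : ℝ := ∫ t in Ioi (0 : ℝ), φ (ξ * t) t

/-- The derivative of `rayIntegral φ`. -/
def rayIntegralDeriv (φ : ℝ → ℝ → ℝ) (ξ : ℝ) : ℝ :=
  ∫ t in Ioi (0 : ℝ), t * spaceDeriv φ (ξ * t) t

namespace IsTestFunction

variable {φ : ℝ → ℝ → ℝ}

lemma hasFDerivAt (hφ : IsTestFunction φ) (z : ℝ × ℝ) :
    HasFDerivAt (Function.uncurry φ) (fderiv ℝ (Function.uncurry φ) z) z :=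
  ((hφ.1.differentiable (by simp)) z).hasFDerivAt

lemma hasDerivAt_time' (hφ : IsTestFunction φ) (x t : ℝ) :
    HasDerivAt (fun s => φ x s) (fderiv ℝ (Function.uncurry φ) (x, t) (0, 1)) t := by
  have h := (hφ.hasFDerivAt (x, t)).comp_hasDerivAt t
    ((hasDerivAt_const t x).prodMk (hasDerivAt_id t))
  exact h

lemma hasDerivAt_space' (hφ : IsTestFunction φ) (x t : ℝ) :
    HasDerivAt (fun y => φ y t) (fderiv ℝ (Function.uncurry φ) (x, t) (1, 0)) x := by
  have h := (hφ.hasFDerivAt (x, t)).comp_hasDerivAt x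
    ((hasDerivAt_id x).prodMk (hasDerivAt_const x t))
  exact h

lemma timeDeriv_eq (hφ : IsTestFunction φ) (x t : ℝ) :
    timeDeriv φ x t = fderiv ℝ (Function.uncurry φ) (x, t) (0, 1) :=
  (hφ.hasDerivAt_time' x t).deriv

lemma spaceDeriv_eq (hφ : IsTestFunction φ) (x t : ℝ) :
    spaceDeriv φ x t = fderiv ℝ (Function.uncurry φ) (x, t) (1, 0) :=
  (hφ.hasDerivAt_space' x t).deriv

lemma hasDerivAt_space (hφ : IsTestFunction φ) (x t : ℝ) :
    HasDerivAt (fun y => φ y t) (spaceDeriv φ x t) x := by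
  rw [hφ.spaceDeriv_eq]; exact hφ.hasDerivAt_space' x t

lemma hasDerivAt_ray (hφ : IsTestFunction φ) (ξ t : ℝ) :
    HasDerivAt (fun s => φ (ξ * s) s) (ξ * spaceDeriv φ (ξ * t) t + timeDeriv φ (ξ * t) t) t := by
  have h := HasFDerivAt.comp_hasDerivAt (f := fun s : ℝ => (ξ * s, s)) t
    (hφ.hasFDerivAt (ξ * t, t)) (((hasDerivAt_id t).const_mul ξ).prodMk (hasDerivAt_id t))
  have e : ((ξ * 1, 1) : ℝ × ℝ) = ξ • (1, 0) + (0, 1) := by simp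
  rw [e, map_add, map_smul, smul_eq_mul, ← hφ.spaceDeriv_eq, ← hφ.timeDeriv_eq] at h
  exact h

lemma continuous (hφ : IsTestFunction φ) : Continuous (fun z : ℝ × ℝ => φ z.1 z.2) :=
  hφ.1.continuous

lemma continuous_timeDeriv (hφ : IsTestFunction φ) :
    Continuous (fun z : ℝ × ℝ => timeDeriv φ z.1 z.2) := by
  simp only [hφ.timeDeriv_eq]
  exact (hφ.1.continuous_fderiv (by simp)).clm_apply continuous_const

lemma continuous_spaceDeriv (hφ : IsTestFunction φ) :
    Continuous (fun z : ℝ × ℝ => spaceDeriv φ z.1 z.2) := by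
  simp only [hφ.spaceDeriv_eq]
  exact (hφ.1.continuous_fderiv (by simp)).clm_apply continuous_const

lemma exists_bounds (hφ : IsTestFunction φ) : ∃ R > 0, ∃ B ≥ 0,
    (∀ x t, (R < |x| ∨ R < |t|) → φ x t = 0 ∧ timeDeriv φ x t = 0 ∧ spaceDeriv φ x t = 0) ∧
    ∀ x t, |φ x t| ≤ B ∧ |timeDeriv φ x t| ≤ B ∧ |spaceDeriv φ x t| ≤ B := by
  obtain ⟨R₀, hR₀⟩ := hφ.2.isCompact.isBounded.subset_closedBall (0 : ℝ × ℝ)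
  obtain ⟨B₁, hB₁⟩ := hφ.2.exists_bound_of_continuous hφ.1.continuous
  obtain ⟨B₂, hB₂⟩ := (hφ.2.fderiv (𝕜 := ℝ)).exists_bound_of_continuous
    (hφ.1.continuous_fderiv (by simp))
  refine ⟨max R₀ 1, by positivity, max B₁ (max B₂ 0), by positivity, ?_, ?_⟩
  · intro x t h
    have hz : ((x, t) : ℝ × ℝ) ∉ tsupport (Function.uncurry φ) := by
      intro hmem
      have := hR₀ hmem
      rw [mem_closedBall_zero_iff, Prod.norm_def, max_le_iff] at this
      simp only [Real.norm_eq_abs] at this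
      have := le_max_left R₀ 1
      rcases h with h | h <;> linarith [this]
    have h1 : φ x t = 0 :=
      image_eq_zero_of_notMem_tsupport (f := Function.uncurry φ) hz
    have h2 : fderiv ℝ (Function.uncurry φ) (x, t) = 0 :=
      image_eq_zero_of_notMem_tsupport (fun h => hz (tsupport_fderiv_subset ℝ h))
    exact ⟨h1, by simp [hφ.timeDeriv_eq, h2], by simp [hφ.spaceDeriv_eq, h2]⟩
  · intro x t
    have key : ∀ v : ℝ × ℝ, ‖v‖ ≤ 1 → |fderiv ℝ (Function.uncurry φ) (x, t) v| ≤ B₂ := by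
      intro v hv
      have h1 := (fderiv ℝ (Function.uncurry φ) (x, t)).le_opNorm v
      have h2 := hB₂ (x, t)
      rw [Real.norm_eq_abs] at h1
      nlinarith [norm_nonneg (fderiv ℝ (Function.uncurry φ) (x, t)), norm_nonneg v]
    refine ⟨(hB₁ (x, t)).trans (le_max_left _ _), ?_, ?_⟩
    · rw [hφ.timeDeriv_eq]
      exact (key _ (by simp [Prod.norm_def])).trans ((le_max_left _ _).trans (le_max_right _ _))
    · rw [hφ.spaceDeriv_eq]
      exact (key _ (by simp [Prod.norm_def])).trans ((le_max_left _ _).trans (le_max_right _ _))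

end IsTestFunction

/-- A continuous function on the plane that vanishes for large `t` is integrable along rays. -/
lemma integrableOn_ray {g : ℝ × ℝ → ℝ} (hg : Continuous g) {R : ℝ}
    (hR : ∀ x t, R < |t| → g (x, t) = 0) (ξ : ℝ) :
    IntegrableOn (fun t => g (ξ * t, t)) (Ioi 0) := by
  have hc : Continuous (fun t : ℝ => g (ξ * t, t)) := by fun_prop
  refine (hc.integrable_of_hasCompactSupport ?_).integrableOn
  refine HasCompactSupport.intro (isCompact_Icc (a := -R) (b := R)) fun t ht => hR _ _ ?_
  by_contra h
  exact ht (abs_le.1 (not_lt.1 h))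

namespace IsTestFunction

variable {φ : ℝ → ℝ → ℝ}

lemma hasDerivAt_rayIntegral (hφ : IsTestFunction φ) (ξ : ℝ) :
    HasDerivAt (rayIntegral φ) (rayIntegralDeriv φ ξ) ξ := by
  obtain ⟨R, hR, B, hB, hsupp, hbd⟩ := hφ.exists_bounds
  -- Differentiating in `ξ` produces a factor `t`, at most `R` on the support.
  have hbi : IntegrableOn (fun t : ℝ => (Icc 0 R).indicator (fun _ => R * B) t) (Ioi 0) := by
    refine ((integrable_indicator_iff measurableSet_Icc).2 ?_).integrableOn
    exact integrableOn_const (by simp)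
  refine (hasDerivAt_integral_of_dominated_loc_of_deriv_le (μ := volume.restrict (Ioi (0 : ℝ)))
    (F := fun ξ t => φ (ξ * t) t) (F' := fun ξ t => t * spaceDeriv φ (ξ * t) t)
    (bound := fun t => (Icc 0 R).indicator (fun _ => R * B) t) (s := univ) univ_mem
    ?_ ?_ ?_ ?_ hbi ?_).2
  · refine Eventually.of_forall fun ξ => Continuous.aestronglyMeasurable ?_
    exact hφ.continuous.comp (by fun_prop : Continuous fun t : ℝ => (ξ * t, t))
  · exact integrableOn_ray hφ.continuous (fun x t h => (hsupp x t (Or.inr h)).1) ξ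
  · refine Continuous.aestronglyMeasurable ?_
    exact continuous_id.mul (hφ.continuous_spaceDeriv.comp
      (by fun_prop : Continuous fun t : ℝ => (ξ * t, t)))
  · refine (ae_restrict_iff' measurableSet_Ioi).2 (Eventually.of_forall fun t ht ξ _ => ?_)
    have ht' : (0 : ℝ) < t := ht
    by_cases h : t ≤ R
    · rw [indicator_of_mem (show t ∈ Icc 0 R from ⟨ht'.le, h⟩), Real.norm_eq_abs, abs_mul,
        abs_of_pos ht']
      exact mul_le_mul h (hbd _ _).2.2 (abs_nonneg _) hR.le
    · rw [(hsupp (ξ * t) t (Or.inr (by rw [abs_of_pos ht']; exact not_le.1 h))).2.2]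
      rw [indicator_of_notMem (fun h' => h h'.2)]
      simp
  · refine Eventually.of_forall fun t ξ _ => ?_
    have h := (hφ.hasDerivAt_space (ξ * t) t).comp ξ ((hasDerivAt_id ξ).mul_const t)
    rw [one_mul, mul_comm] at h
    exact h

/-- The function `t φ(ξ t, t)` vanishes at `t = 0` because of the factor `t` and for large `t` by
compact support, so its total derivative integrates to zero. This trades the time derivative for the
ray integral and its `ξ`-derivative. -/
lemma integral_mul_timeDeriv_ray (hφ : IsTestFunction φ) (ξ : ℝ) :
    ∫ t in Ioi (0 : ℝ), t * timeDeriv φ (ξ * t) t =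
      -rayIntegral φ ξ - ξ * rayIntegralDeriv φ ξ := by
  obtain ⟨R, hR, B, hB, hsupp, hbd⟩ := hφ.exists_bounds
  have i1 : IntegrableOn (fun t => t * timeDeriv φ (ξ * t) t) (Ioi 0) :=
    integrableOn_ray (R := R) (g := fun z => z.2 * timeDeriv φ z.1 z.2)
      (continuous_snd.mul hφ.continuous_timeDeriv)
      (fun x t h => by simp [(hsupp x t (Or.inr h)).2.1]) ξ
  have i2 : IntegrableOn (fun t => t * spaceDeriv φ (ξ * t) t) (Ioi 0) :=
    integrableOn_ray (R := R) (g := fun z => z.2 * spaceDeriv φ z.1 z.2)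
      (continuous_snd.mul hφ.continuous_spaceDeriv)
      (fun x t h => by simp [(hsupp x t (Or.inr h)).2.2]) ξ
  have i3 : IntegrableOn (fun t => φ (ξ * t) t) (Ioi 0) :=
    integrableOn_ray hφ.continuous (fun x t h => (hsupp x t (Or.inr h)).1) ξ
  have hd : ∀ t ∈ Ici (0 : ℝ), HasDerivAt (fun t => t * φ (ξ * t) t)
      (φ (ξ * t) t + (ξ * (t * spaceDeriv φ (ξ * t) t) + t * timeDeriv φ (ξ * t) t)) t := by
    intro t _
    have h := (hasDerivAt_id t).mul (hφ.hasDerivAt_ray ξ t)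
    refine h.congr_deriv ?_
    simp only [id]
    ring
  have hlim : Tendsto (fun t => t * φ (ξ * t) t) atTop (𝓝 0) := by
    refine tendsto_const_nhds.congr' ?_
    filter_upwards [eventually_gt_atTop R] with t ht
    rw [(hsupp (ξ * t) t (Or.inr (ht.trans_le (le_abs_self t)))).1, mul_zero]
  have h := integral_Ioi_of_hasDerivAt_of_tendsto' hd (i3.add ((i2.const_mul ξ).add i1)) hlim
  have h1 := integral_add i3 ((i2.const_mul ξ).add i1)
  have h2 := integral_add (i2.const_mul ξ) i1
  simp only [Pi.add_apply] at h1 h2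
  rw [h1, h2, integral_const_mul] at h
  simp only [rayIntegral, rayIntegralDeriv]
  linarith

/-- Substituting `x = ξ t` gives `∫ φ(x, x / ξ) dx`: as `ξ` grows the ray flattens onto the initial
line. The initial data enter through this limit. -/
lemma tendsto_mul_rayIntegral_atTop (hφ : IsTestFunction φ) :
    Tendsto (fun ξ => ξ * rayIntegral φ ξ) atTop (𝓝 (∫ x in Ioi (0 : ℝ), φ x 0)) := by
  obtain ⟨R, hR, B, hB, hsupp, hbd⟩ := hφ.exists_bounds
  have h1 : Tendsto (fun ξ : ℝ => ∫ x in Ioi (0 : ℝ), φ x (x / ξ)) atTop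
      (𝓝 (∫ x in Ioi (0 : ℝ), φ x 0)) := by
    refine tendsto_integral_filter_of_dominated_convergence
      (fun x => (Icc 0 R).indicator (fun _ => B) x) ?_ ?_ ?_ ?_
    · refine Eventually.of_forall fun ξ => Continuous.aestronglyMeasurable ?_
      exact hφ.continuous.comp (by fun_prop : Continuous fun x : ℝ => (x, x / ξ))
    · refine Eventually.of_forall fun ξ =>
        (ae_restrict_iff' measurableSet_Ioi).2 (Eventually.of_forall fun x hx => ?_)
      have hx' : (0 : ℝ) < x := hx
      by_cases h : x ≤ R
      · rw [indicator_of_mem (show x ∈ Icc 0 R from ⟨hx'.le, h⟩)]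
        exact (hbd _ _).1
      · rw [(hsupp x (x / ξ) (Or.inl (by rw [abs_of_pos hx']; exact not_le.1 h))).1,
          indicator_of_notMem (fun h' => h h'.2)]
        simp
    · exact ((integrable_indicator_iff measurableSet_Icc).2
        (integrableOn_const (by simp))).integrableOn
    · refine Eventually.of_forall fun x => ?_
      have : Tendsto (fun ξ : ℝ => (x, x / ξ)) atTop (𝓝 (x, 0)) :=
        tendsto_const_nhds.prodMk_nhds (tendsto_const_nhds.div_atTop tendsto_id)
      exact (hφ.continuous.tendsto (x, 0)).comp this
  refine h1.congr' ?_
  filter_upwards [eventually_gt_atTop 0] with ξ hξ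
  have h := integral_comp_mul_left_Ioi (fun x => φ x (x / ξ)) 0 hξ
  rw [mul_zero, smul_eq_mul] at h
  rw [rayIntegral]
  have e : ∀ t : ℝ, φ (ξ * t) (ξ * t / ξ) = φ (ξ * t) t := by
    intro t; rw [mul_div_cancel_left₀ _ hξ.ne']
  simp only [e] at h
  rw [h]
  field_simp

lemma reflect (hφ : IsTestFunction φ) : IsTestFunction (fun x t => φ (-x) t) := by
  constructor
  · exact hφ.1.comp (by fun_prop : ContDiff ℝ (⊤ : ℕ∞) fun z : ℝ × ℝ => (-z.1, z.2))
  · exact hφ.2.comp_homeomorph ((Homeomorph.neg ℝ).prodCongr (Homeomorph.refl ℝ))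

lemma tendsto_mul_rayIntegral_atBot (hφ : IsTestFunction φ) :
    Tendsto (fun ξ => ξ * rayIntegral φ ξ) atBot (𝓝 (-∫ x in Iio (0 : ℝ), φ x 0)) := by
  have h := (hφ.reflect.tendsto_mul_rayIntegral_atTop.comp tendsto_neg_atBot_atTop).neg
  have e : ∫ x in Ioi (0 : ℝ), φ (-x) 0 = ∫ x in Iio (0 : ℝ), φ x 0 := by
    have := integral_comp_neg_Ioi (0 : ℝ) (fun x => φ x 0)
    rw [neg_zero] at this
    rw [this, integral_Iic_eq_integral_Iio]
  rw [e] at h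
  refine h.congr fun ξ => ?_
  simp [rayIntegral]

end IsTestFunction

/-! ### The weak form in the variable `ξ = x / t` -/

/-- The integrand of the weak form after the substitution `x = ξ t`, before integrating along the
ray. -/
def rayIntegrand (U F : ℝ → ℝ) (φ : ℝ → ℝ → ℝ) (t ξ : ℝ) : ℝ :=
  t * (U ξ * timeDeriv φ (ξ * t) t + F ξ * spaceDeriv φ (ξ * t) t)

/-- The integrand of the weak form after integrating along the ray. -/
def profileIntegrand (U F : ℝ → ℝ) (φ : ℝ → ℝ → ℝ) (ξ : ℝ) : ℝ :=
  -U ξ * rayIntegral φ ξ + (F ξ - ξ * U ξ) * rayIntegralDeriv φ ξ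

/-- The interval is where the ray parameter keeps `|ξ t| ≤ R`. Its length `2 R / t` cancels the
Jacobian `t`, so the bound stays uniform as `t → 0`. -/
lemma integral_Icc_neg_div_const (K R t : ℝ) (ht : 0 < t) (hR : 0 < R) :
    ∫ ξ, (Icc (-(R / t)) (R / t)).indicator (fun _ => K * t) ξ = 2 * K * R := by
  rw [integral_indicator measurableSet_Icc, setIntegral_const, Measure.real, Real.volume_Icc,
    ENNReal.toReal_ofReal (by have := div_pos hR ht; linarith), smul_eq_mul]
  field_simp
  ring

section

variable {U F : ℝ → ℝ} {φ : ℝ → ℝ → ℝ} {M : ℝ}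

/-- Needed for Fubini. At time `t` the integrand is at most `2 M B t` on `|ξ| ≤ R / t` and zero
elsewhere, so its `ξ`-integral is bounded uniformly in `t`, and it vanishes for `t > R`. -/
lemma integrable_rayIntegrand (hU : AEStronglyMeasurable U volume)
    (hF : AEStronglyMeasurable F volume) (hUM : ∀ ξ, |U ξ| ≤ M) (hFM : ∀ ξ, |F ξ| ≤ M)
    (hφ : IsTestFunction φ) :
    Integrable (Function.uncurry (rayIntegrand U F φ))
      ((volume.restrict (Ioi (0 : ℝ))).prod volume) := by
  obtain ⟨R, hR, B, hB, hsupp, hbd⟩ := hφ.exists_bounds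
  have hM : 0 ≤ M := (abs_nonneg _).trans (hUM 0)
  have hmeas : AEStronglyMeasurable (Function.uncurry (rayIntegrand U F φ))
      ((volume.restrict (Ioi (0 : ℝ))).prod volume) := by
    have c : Continuous fun z : ℝ × ℝ => (z.2 * z.1, z.1) := by fun_prop
    have h1 : AEStronglyMeasurable (fun z : ℝ × ℝ => U z.2)
      ((volume.restrict (Ioi (0 : ℝ))).prod volume) := hU.comp_snd
    have h2 : AEStronglyMeasurable (fun z : ℝ × ℝ => F z.2)
      ((volume.restrict (Ioi (0 : ℝ))).prod volume) := hF.comp_snd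
    exact continuous_fst.aestronglyMeasurable.mul
      ((h1.mul (hφ.continuous_timeDeriv.comp c).aestronglyMeasurable).add
        (h2.mul (hφ.continuous_spaceDeriv.comp c).aestronglyMeasurable))
  have hbound : ∀ t > 0, ∀ ξ, ‖rayIntegrand U F φ t ξ‖ ≤
      (Icc (-(R / t)) (R / t)).indicator (fun _ => 2 * M * B * t) ξ := by
    intro t ht ξ
    by_cases h : ξ ∈ Icc (-(R / t)) (R / t)
    · rw [indicator_of_mem h, rayIntegrand, Real.norm_eq_abs, abs_mul, abs_of_pos ht, mul_comm]
      refine mul_le_mul_of_nonneg_right ((abs_add_le _ _).trans ?_) ht.le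
      rw [abs_mul, abs_mul]
      have h1 := mul_le_mul (hUM ξ) (hbd (ξ * t) t).2.1 (abs_nonneg _) hM
      have h2 := mul_le_mul (hFM ξ) (hbd (ξ * t) t).2.2 (abs_nonneg _) hM
      linarith
    · have hx : R < |ξ * t| := by
        rw [abs_mul, abs_of_pos ht, ← div_lt_iff₀ ht]
        by_contra h'
        exact h (abs_le.1 (not_lt.1 h'))
      have := hsupp (ξ * t) t (Or.inl hx)
      rw [indicator_of_notMem h]
      simp [rayIntegrand, this.2.1, this.2.2]
  have hbint : ∀ t, Integrable
      ((Icc (-(R / t)) (R / t)).indicator (fun _ => 2 * M * B * t)) volume := fun t =>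
    (integrable_indicator_iff measurableSet_Icc).2 (integrableOn_const (by simp))
  refine (integrable_prod_iff hmeas).2 ⟨?_, ?_⟩
  · have hm := hmeas.prodMk_left
    filter_upwards [hm, ae_restrict_mem measurableSet_Ioi] with t hm ht
    exact (hbint t).mono' hm (Eventually.of_forall (hbound t ht))
  · refine Integrable.mono' (g := (Icc 0 R).indicator (fun _ => 2 * (2 * M * B) * R))
      ((integrable_indicator_iff measurableSet_Icc).2 (integrableOn_const (by simp))).integrableOn
      hmeas.norm.integral_prod_right' ?_
    filter_upwards [ae_restrict_mem measurableSet_Ioi] with t ht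
    have ht' : (0 : ℝ) < t := ht
    rw [Real.norm_of_nonneg (integral_nonneg fun _ => norm_nonneg _)]
    by_cases h : t ≤ R
    · rw [indicator_of_mem (show t ∈ Icc 0 R from ⟨ht'.le, h⟩),
        ← integral_Icc_neg_div_const (2 * M * B) R t ht' hR]
      exact integral_mono_of_nonneg (Eventually.of_forall fun _ => norm_nonneg _) (hbint t)
        (Eventually.of_forall (hbound t ht))
    · rw [indicator_of_notMem (fun h' => h h'.2)]
      refine le_of_eq (integral_eq_zero_of_ae (Eventually.of_forall fun ξ => ?_))
      have := hsupp (ξ * t) t (Or.inr (by rw [abs_of_pos ht']; exact not_le.1 h))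
      simp [Function.uncurry, rayIntegrand, this.2.1, this.2.2]

lemma integral_rayIntegrand (hφ : IsTestFunction φ) (ξ : ℝ) :
    ∫ t in Ioi (0 : ℝ), rayIntegrand U F φ t ξ = profileIntegrand U F φ ξ := by
  obtain ⟨R, hR, B, hB, hsupp, hbd⟩ := hφ.exists_bounds
  have i1 : IntegrableOn (fun t => t * timeDeriv φ (ξ * t) t) (Ioi 0) :=
    integrableOn_ray (R := R) (g := fun z => z.2 * timeDeriv φ z.1 z.2)
      (continuous_snd.mul hφ.continuous_timeDeriv)
      (fun x t h => by simp [(hsupp x t (Or.inr h)).2.1]) ξ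
  have i2 : IntegrableOn (fun t => t * spaceDeriv φ (ξ * t) t) (Ioi 0) :=
    integrableOn_ray (R := R) (g := fun z => z.2 * spaceDeriv φ z.1 z.2)
      (continuous_snd.mul hφ.continuous_spaceDeriv)
      (fun x t h => by simp [(hsupp x t (Or.inr h)).2.2]) ξ
  have e : ∀ t, rayIntegrand U F φ t ξ =
      U ξ * (t * timeDeriv φ (ξ * t) t) + F ξ * (t * spaceDeriv φ (ξ * t) t) := by
    intro t; rw [rayIntegrand]; ring
  simp only [e]
  rw [integral_add (i1.const_mul _) (i2.const_mul _), integral_const_mul, integral_const_mul,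
    hφ.integral_mul_timeDeriv_ray, profileIntegrand, rayIntegralDeriv]
  ring

lemma integral_selfSimilar_eq (t : ℝ) (ht : 0 < t) :
    ∫ x, (U (x / t) * timeDeriv φ x t + F (x / t) * spaceDeriv φ x t) =
      ∫ ξ, rayIntegrand U F φ t ξ := by
  have h := Measure.integral_comp_div
    (fun ξ => U ξ * timeDeriv φ (ξ * t) t + F ξ * spaceDeriv φ (ξ * t) t) t
  simp only [div_mul_cancel₀ _ ht.ne'] at h
  rw [h, abs_of_pos ht, smul_eq_mul, ← integral_const_mul]
  rfl

lemma integrable_profileIntegrand (hU : AEStronglyMeasurable U volume)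
    (hF : AEStronglyMeasurable F volume) (hUM : ∀ ξ, |U ξ| ≤ M) (hFM : ∀ ξ, |F ξ| ≤ M)
    (hφ : IsTestFunction φ) : Integrable (profileIntegrand U F φ) := by
  have h := (integrable_rayIntegrand hU hF hUM hFM hφ).integral_prod_right
  simpa only [Function.uncurry_apply_pair, integral_rayIntegrand hφ] using h

lemma integral_integral_selfSimilar (hU : AEStronglyMeasurable U volume)
    (hF : AEStronglyMeasurable F volume) (hUM : ∀ ξ, |U ξ| ≤ M) (hFM : ∀ ξ, |F ξ| ≤ M)
    (hφ : IsTestFunction φ) :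
    ∫ t in Ioi (0 : ℝ), ∫ x, (U (x / t) * timeDeriv φ x t + F (x / t) * spaceDeriv φ x t) =
      ∫ ξ, profileIntegrand U F φ ξ := by
  rw [setIntegral_congr_fun measurableSet_Ioi fun t ht => integral_selfSimilar_eq t ht,
    integral_integral_swap (integrable_rayIntegrand hU hF hUM hFM hφ)]
  simp only [integral_rayIntegrand hφ]

end

/-- The space-time part of the weak form on a domain invariant under scaling, for fields that
depend on `x / t` only. -/
lemma integral_integral_profile {D : Set ℝ} (hD : MeasurableSet D)
    (hscale : ∀ x t, 0 < t → (x / t ∈ D ↔ x ∈ D))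
    {u f : ℝ → ℝ → ℝ} {U F : ℝ → ℝ} {φ : ℝ → ℝ → ℝ} {M : ℝ}
    (hu : ∀ x ∈ D, ∀ t > 0, u x t = U (x / t)) (hf : ∀ x ∈ D, ∀ t > 0, f x t = F (x / t))
    (hU : AEStronglyMeasurable U (volume.restrict D))
    (hF : AEStronglyMeasurable F (volume.restrict D))
    (hUM : ∀ ξ ∈ D, |U ξ| ≤ M) (hFM : ∀ ξ ∈ D, |F ξ| ≤ M) (hM : 0 ≤ M)
    (hφ : IsTestFunction φ) :
    IntegrableOn (profileIntegrand U F φ) D ∧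
    ∫ t in Ioi (0 : ℝ), ∫ x in D,
      (u x t * deriv (fun s => φ x s) t + f x t * deriv (fun y => φ y t) x) =
      ∫ ξ in D, profileIntegrand U F φ ξ := by
  have hU' := (aestronglyMeasurable_indicator_iff hD).2 hU
  have hF' := (aestronglyMeasurable_indicator_iff hD).2 hF
  have bd : ∀ G : ℝ → ℝ, (∀ ξ ∈ D, |G ξ| ≤ M) → ∀ ξ, |D.indicator G ξ| ≤ M := by
    intro G hG ξ
    by_cases h : ξ ∈ D
    · rw [indicator_of_mem h]; exact hG ξ h
    · rw [indicator_of_notMem h, abs_zero]; exact hM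
  have e : profileIntegrand (D.indicator U) (D.indicator F) φ =
      D.indicator (profileIntegrand U F φ) := by
    ext ξ
    by_cases h : ξ ∈ D <;> simp [profileIntegrand, h]
  have h1 := integrable_profileIntegrand hU' hF' (bd U hUM) (bd F hFM) hφ
  have h2 := integral_integral_selfSimilar hU' hF' (bd U hUM) (bd F hFM) hφ
  rw [e] at h1 h2
  refine ⟨(integrable_indicator_iff hD).1 h1, ?_⟩
  rw [integral_indicator hD] at h2
  rw [← h2]
  refine setIntegral_congr_fun measurableSet_Ioi fun t ht => ?_
  rw [← integral_indicator hD]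
  refine integral_congr_ae (Eventually.of_forall fun x => ?_)
  by_cases h : x ∈ D
  · have h' := (hscale x t ht).2 h
    simp only [indicator_of_mem h, indicator_of_mem h', hu x h t ht, hf x h t ht]
    rfl
  · have h' := fun h' => h ((hscale x t ht).1 h')
    simp only [indicator_of_notMem h, indicator_of_notMem h', zero_mul, add_zero]

/-! ### Functions with one-sided limits -/

/-- `f` has one-sided limits at every point of `S`. -/
def HasSidedLimits (f : ℝ → ℝ) (S : Set ℝ) : Prop :=
  ∀ ξ ∈ S, (∃ l, Tendsto f (𝓝[<] ξ) (𝓝 l)) ∧ ∃ r, Tendsto f (𝓝[>] ξ) (𝓝 r)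

/-- For each threshold, the points of `S` with a larger jump are isolated from the right among
themselves: just to the right of `ξ` all values of `f`, and hence its one-sided limits, lie within
half the threshold of `r ξ`. Such sets are countable, and every discontinuity exceeds some `1 / (n +
1)`. -/
lemma HasSidedLimits.countable_not_continuousAt {f : ℝ → ℝ} {S : Set ℝ}
    (h : HasSidedLimits f S) : {ξ ∈ S | ¬ContinuousAt f ξ}.Countable := by
  choose! l r hl hr using fun ξ (hξ : ξ ∈ S) =>
    (show ∃ l r, Tendsto f (𝓝[<] ξ) (𝓝 l) ∧ Tendsto f (𝓝[>] ξ) (𝓝 r) from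
      let ⟨⟨l, hl⟩, ⟨r, hr⟩⟩ := h ξ hξ; ⟨l, r, hl, hr⟩)
  let T : ℕ → Set ℝ := fun n =>
    {ξ ∈ S | 1 / ((n : ℝ) + 1) < |f ξ - r ξ| ∨ 1 / ((n : ℝ) + 1) < |l ξ - r ξ|}
  have hT : ∀ n, (T n).Countable := by
    intro n
    have hε : (0 : ℝ) < 1 / ((n : ℝ) + 1) := by positivity
    refine (countable_setOfPred_isolated_right_within (s := T n)).mono ?_
    intro ξ hξ
    refine ⟨hξ, ?_⟩
    have hball : ∀ᶠ y in 𝓝[>] ξ, f y ∈ Metric.closedBall (r ξ) (1 / ((n : ℝ) + 1) / 2) :=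
      (hr ξ hξ.1).eventually (Metric.closedBall_mem_nhds _ (by positivity))
    obtain ⟨u, hu, hsub⟩ := mem_nhdsGT_iff_exists_Ioo_subset.1 hball
    have hempty : ∀ᶠ y in 𝓝[T n ∩ Ioi ξ] ξ, False := by
      have h1 : ∀ᶠ y in 𝓝[T n ∩ Ioi ξ] ξ, y < u :=
        nhdsWithin_le_nhds (Iio_mem_nhds hu)
      filter_upwards [h1, self_mem_nhdsWithin] with y hy hyT
      have hyIoo : y ∈ Ioo ξ u := ⟨hyT.2, hy⟩
      have hf : f y ∈ Metric.closedBall (r ξ) (1 / ((n : ℝ) + 1) / 2) := hsub hyIoo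
      have hyS : y ∈ S := hyT.1.1
      have hly : l y ∈ Metric.closedBall (r ξ) (1 / ((n : ℝ) + 1) / 2) :=
        Metric.isClosed_closedBall.mem_of_tendsto (hl y hyS)
          (mem_of_superset (Ioo_mem_nhdsLT hyIoo.1) fun z hz =>
            hsub ⟨hz.1, hz.2.trans hyIoo.2⟩)
      have hry : r y ∈ Metric.closedBall (r ξ) (1 / ((n : ℝ) + 1) / 2) :=
        Metric.isClosed_closedBall.mem_of_tendsto (hr y hyS)
          (mem_of_superset (Ioo_mem_nhdsGT hyIoo.2) fun z hz =>
            hsub ⟨hyIoo.1.trans hz.1, hz.2⟩)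
      simp only [Metric.mem_closedBall, Real.dist_eq] at hf hly hry
      rw [abs_le] at hf hly hry
      rcases hyT.1.2 with h' | h'
      · exact absurd h' (not_lt.2 (abs_le.2 ⟨by linarith, by linarith⟩))
      · exact absurd h' (not_lt.2 (abs_le.2 ⟨by linarith, by linarith⟩))
    exact empty_mem_iff_bot.1 hempty
  refine (countable_iUnion hT).mono ?_
  rintro ξ ⟨hξ, hc⟩
  by_contra hnot
  apply hc
  have hz : ∀ d : ℝ, (∀ n : ℕ, |d| ≤ 1 / ((n : ℝ) + 1)) → d = 0 := by
    intro d hd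
    have : |d| ≤ 0 := ge_of_tendsto' tendsto_one_div_add_atTop_nhds_zero_nat hd
    exact abs_eq_zero.1 (le_antisymm this (abs_nonneg _))
  have hn : ∀ n, ξ ∉ T n := fun n hn => hnot (mem_iUnion.2 ⟨n, hn⟩)
  have h1 : f ξ - r ξ = 0 := hz _ fun n => by
    by_contra h'; exact hn n ⟨hξ, Or.inl (not_le.1 h')⟩
  have h2 : l ξ - r ξ = 0 := hz _ fun n => by
    by_contra h'; exact hn n ⟨hξ, Or.inr (not_le.1 h')⟩
  refine continuousAt_iff_continuous_left'_right'.2 ⟨?_, ?_⟩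
  · rw [ContinuousWithinAt, show f ξ = l ξ by linarith]; exact hl ξ hξ
  · rw [ContinuousWithinAt, show f ξ = r ξ by linarith]; exact hr ξ hξ

lemma aestronglyMeasurable_of_countable {f : ℝ → ℝ} {D C : Set ℝ} (hD : MeasurableSet D)
    (hC : C.Countable) (hf : ∀ ξ ∈ D \ C, ContinuousAt f ξ) :
    AEStronglyMeasurable f (volume.restrict D) := by
  have h1 : ContinuousOn f (D \ C) := fun ξ hξ => (hf ξ hξ).continuousWithinAt
  have h2 := h1.aestronglyMeasurable (μ := volume) (hD.diff hC.measurableSet)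
  rwa [Measure.restrict_congr_set (sdiff_null_ae_eq_self (hC.measure_zero _))] at h2

/-! ### Test functions concentrated on a bounded time interval -/

/-- Support away from `t = 0` makes `χ(t) g(x / t)` smooth, and total mass one makes its ray
integral exactly `g`. Arbitrary one-dimensional test functions thus become available to the weak
form. -/
lemma exists_time_profile : ∃ χ : ℝ → ℝ, ContDiff ℝ (⊤ : ℕ∞) χ ∧
    (∀ t, t ∉ Ioo (1 : ℝ) 3 → χ t = 0) ∧ ∫ t in Ioi (0 : ℝ), χ t = 1 := by
  let b : ContDiffBump (2 : ℝ) := ⟨1 / 2, 1, by norm_num, by norm_num⟩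
  have hsupp : ∀ t, t ∉ Ioo (1 : ℝ) 3 → b.normed volume t = 0 := by
    intro t ht
    by_contra h
    have : t ∈ Function.support (b.normed volume) := h
    rw [b.support_normed_eq, Real.ball_eq_Ioo] at this
    norm_num [b] at this
    exact ht this
  refine ⟨b.normed volume, b.contDiff_normed, hsupp, ?_⟩
  rw [setIntegral_eq_integral_of_forall_compl_eq_zero, b.integral_normed]
  intro t ht
  exact hsupp t fun h => ht (zero_lt_one.trans h.1)

lemma isTestFunction_selfSimilar {χ g : ℝ → ℝ} (hχ : ContDiff ℝ (⊤ : ℕ∞) χ)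
    (hχs : ∀ t, t ∉ Ioo (1 : ℝ) 3 → χ t = 0) (hg : ContDiff ℝ (⊤ : ℕ∞) g)
    (hgs : HasCompactSupport g) : IsTestFunction (fun x t => χ t * g (x / t)) := by
  constructor
  · rw [contDiff_iff_contDiffAt]
    rintro ⟨x, t⟩
    by_cases ht : t = 0
    · have : Function.uncurry (fun x t => χ t * g (x / t)) =ᶠ[𝓝 (x, t)] fun _ => 0 := by
        have h1 : ∀ᶠ z : ℝ × ℝ in 𝓝 (x, t), z.2 < 1 :=
          continuous_snd.continuousAt.eventually (Iio_mem_nhds (by simp [ht]))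
        filter_upwards [h1] with z hz
        simp [Function.uncurry, hχs z.2 (fun h => absurd h.1 (not_lt.2 hz.le))]
      exact contDiffAt_const.congr_of_eventuallyEq this
    · have h1 : ContDiffAt ℝ (⊤ : ℕ∞) (fun z : ℝ × ℝ => z.1 / z.2) (x, t) :=
        contDiffAt_fst.div contDiffAt_snd ht
      exact (hχ.contDiffAt.comp (x, t) contDiffAt_snd).mul (hg.contDiffAt.comp (x, t) h1)
  · obtain ⟨R, hR⟩ := hgs.isCompact.isBounded.subset_closedBall (0 : ℝ)
    refine HasCompactSupport.intro ((isCompact_Icc (a := -(3 * |R|)) (b := 3 * |R|)).prod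
      (isCompact_Icc (a := (1 : ℝ)) (b := 3))) ?_
    rintro ⟨x, t⟩ hxt
    simp only [Function.uncurry]
    by_cases ht : t ∈ Ioo (1 : ℝ) 3
    · have ht0 : 0 < t := zero_lt_one.trans ht.1
      have hgx : g (x / t) = 0 := by
        refine image_eq_zero_of_notMem_tsupport fun h => hxt ?_
        have h' := hR h
        rw [mem_closedBall_zero_iff, Real.norm_eq_abs, abs_div, abs_of_pos ht0,
          div_le_iff₀ ht0] at h'
        refine ⟨abs_le.1 (h'.trans ?_), ht.1.le, ht.2.le⟩
        nlinarith [le_abs_self R, abs_nonneg R, ht.2]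
      rw [hgx, mul_zero]
    · rw [hχs t ht, zero_mul]

lemma rayIntegral_selfSimilar {χ g : ℝ → ℝ} (hχ : ∫ t in Ioi (0 : ℝ), χ t = 1) :
    rayIntegral (fun x t => χ t * g (x / t)) = g := by
  ext ξ
  rw [rayIntegral, setIntegral_congr_fun (g := fun t => χ t * g ξ) measurableSet_Ioi,
    integral_mul_const, hχ, one_mul]
  intro t ht
  simp only [mul_div_cancel_right₀ ξ (ne_of_gt ht)]

/-! ### The lemma of du Bois-Reymond with a source term -/

/-- This is integration by parts for `V * g`; since `V` is continuous, a countable set without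
differentiability does no harm. -/
lemma integral_mul_deriv_eq_zero_of_compactSupport {V U g : ℝ → ℝ} {D C : Set ℝ}
    (hC : C.Countable) (hV : Continuous V) (hUi : LocallyIntegrable U)
    (hVd : ∀ ξ ∈ D \ C, HasDerivAt V (U ξ) ξ) (hg : ContDiff ℝ (⊤ : ℕ∞) g)
    (hgs : HasCompactSupport g) (hgD : tsupport g ⊆ D) :
    ∫ ξ, (U ξ * g ξ + V ξ * deriv g ξ) = 0 := by
  obtain ⟨R, hR⟩ := hgs.isCompact.isBounded.subset_closedBall (0 : ℝ)
  have hgc : Continuous g := hg.continuous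
  have hg'c : Continuous (deriv g) := hg.continuous_deriv (by simp)
  have hout : ∀ ξ, ξ ∉ Icc (-|R|) |R| → ξ ∉ tsupport g := by
    intro ξ hξ h
    have := hR h
    rw [mem_closedBall_zero_iff, Real.norm_eq_abs] at this
    exact hξ (abs_le.1 (this.trans (le_abs_self R)))
  have hz : ∀ ξ, ξ ∉ tsupport g → g ξ = 0 ∧ deriv g ξ = 0 := fun ξ hξ =>
    ⟨image_eq_zero_of_notMem_tsupport hξ,
      image_eq_zero_of_notMem_tsupport fun h => hξ (tsupport_deriv_subset h)⟩
  have hi : Integrable fun ξ => U ξ * g ξ + V ξ * deriv g ξ := by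
    have i1 := hUi.integrable_smul_left_of_hasCompactSupport hgc hgs
    have i2 : Integrable fun ξ => V ξ * deriv g ξ :=
      (hV.mul hg'c).integrable_of_hasCompactSupport (hgs.deriv.mul_left)
    refine (i1.congr (Eventually.of_forall fun ξ => ?_)).add i2
    simp [mul_comm]
  have hRR : -(|R| + 1) ≤ |R| + 1 := by have := abs_nonneg R; linarith
  have h := integral_eq_of_hasDerivAt_off_countable_of_le (fun ξ => V ξ * g ξ)
    (fun ξ => U ξ * g ξ + V ξ * deriv g ξ) hRR hC (hV.mul hgc).continuousOn ?_
    hi.intervalIntegrable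
  · have e1 : g (|R| + 1) = 0 := (hz _ (hout _ fun h => by linarith [h.2])).1
    have e2 : g (-(|R| + 1)) = 0 := (hz _ (hout _ fun h => by linarith [h.1])).1
    simp only [e1, e2, mul_zero, sub_zero] at h
    rw [← h, intervalIntegral.integral_of_le hRR]
    refine (setIntegral_eq_integral_of_forall_compl_eq_zero fun ξ hξ => ?_).symm
    have := hz ξ (hout ξ fun h' => hξ ⟨by linarith [h'.1], by linarith [h'.2]⟩)
    rw [this.1, this.2]; ring
  · rintro ξ ⟨_, hξC⟩
    -- Off the support of `g` nothing is known about `V'`, but there the product vanishes locally.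
    by_cases hξ : ξ ∈ tsupport g
    · exact (hVd ξ ⟨hgD hξ, hξC⟩).mul ((hg.differentiable (by simp)) ξ).hasDerivAt
    · rw [(hz ξ hξ).1, (hz ξ hξ).2]
      have hev : (fun ξ => V ξ * g ξ) =ᶠ[𝓝 ξ] fun _ => 0 := by
        filter_upwards [(isClosed_tsupport g).isOpen_compl.mem_nhds hξ] with y hy
        rw [(hz y hy).1, mul_zero]
      simpa using (hasDerivAt_const ξ (0 : ℝ)).congr_of_eventuallyEq hev

/-- Subtracting from `g` a multiple of a fixed bump `η` of mass one leaves a function of mean zero,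
whose primitive is again a test function. Order-connectedness of `D` keeps the support of that
primitive inside `D`. -/
lemma ae_const_of_integral_mul_deriv_eq_zero {W : ℝ → ℝ} {D : Set ℝ} (hD : IsOpen D)
    (hconn : D.OrdConnected) (hne : D.Nonempty) (hW : LocallyIntegrable W)
    (h : ∀ g : ℝ → ℝ, ContDiff ℝ (⊤ : ℕ∞) g → HasCompactSupport g → tsupport g ⊆ D →
      ∫ ξ, W ξ * deriv g ξ = 0) :
    ∃ k, ∀ᵐ ξ, ξ ∈ D → W ξ = k := by
  obtain ⟨c, hc⟩ := hne
  obtain ⟨ε, hε, hball⟩ := Metric.isOpen_iff.1 hD c hc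
  let b : ContDiffBump c := ⟨ε / 4, ε / 2, by positivity, by linarith⟩
  set η := b.normed volume with hη
  have hηs : HasCompactSupport η := b.hasCompactSupport_normed
  have hηd : ContDiff ℝ (⊤ : ℕ∞) η := b.contDiff_normed
  have hηD : tsupport η ⊆ D := by
    rw [hη, b.tsupport_normed_eq]
    exact (Metric.closedBall_subset_ball (by simp only [b]; linarith)).trans hball
  have hηi : ∫ ξ, η ξ = 1 := b.integral_normed
  have hint : ∀ g : ℝ → ℝ, ContDiff ℝ (⊤ : ℕ∞) g → HasCompactSupport g →
      Integrable fun ξ => W ξ * g ξ := by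
    intro g hg hgs
    refine (hW.integrable_smul_left_of_hasCompactSupport hg.continuous hgs).congr
      (Eventually.of_forall fun ξ => ?_)
    simp [mul_comm]
  refine ⟨∫ ξ, W ξ * η ξ, ?_⟩
  have key := hD.ae_eq_zero_of_integral_contDiff_smul_eq_zero (μ := volume)
    (f := fun ξ => W ξ - ∫ ξ, W ξ * η ξ)
    ((hW.sub (locallyIntegrable_const _)).locallyIntegrableOn D) ?_
  · filter_upwards [key] with ξ hξ hξD
    exact sub_eq_zero.1 (hξ hξD)
  intro g hg hgs hgD
  set m := ∫ ξ, g ξ with hm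
  set ψ : ℝ → ℝ := fun ξ => g ξ - m * η ξ with hψ
  have hψc : Continuous ψ := hg.continuous.sub (continuous_const.mul hηd.continuous)
  have hψd : ContDiff ℝ (⊤ : ℕ∞) ψ := hg.sub (contDiff_const.mul hηd)
  have hK : IsCompact (tsupport g ∪ tsupport η) := hgs.isCompact.union hηs.isCompact
  have hKne : (tsupport g ∪ tsupport η).Nonempty := by
    refine Set.Nonempty.inr ?_
    by_contra hemp
    have : ∀ ξ, η ξ = 0 := fun ξ => image_eq_zero_of_notMem_tsupport fun h' => hemp ⟨ξ, h'⟩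
    simp [this] at hηi
  obtain ⟨α, hα, hαmin⟩ := hK.exists_isLeast hKne
  obtain ⟨β, hβ, hβmax⟩ := hK.exists_isGreatest hKne
  have hKD : tsupport g ∪ tsupport η ⊆ D := union_subset hgD hηD
  have hIcc : Icc α β ⊆ D := hconn.out (hKD hα) (hKD hβ)
  have hψz : ∀ ξ, ξ ∉ Icc α β → ψ ξ = 0 := by
    intro ξ hξ
    have hn : ξ ∉ tsupport g ∪ tsupport η := fun h' => hξ ⟨hαmin h', hβmax h'⟩
    have h1 : g ξ = 0 := image_eq_zero_of_notMem_tsupport fun h' => hn (Or.inl h')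
    have h2 : η ξ = 0 := image_eq_zero_of_notMem_tsupport fun h' => hn (Or.inr h')
    simp [hψ, h1, h2]
  have hψi : Integrable ψ :=
    (hg.continuous.integrable_of_hasCompactSupport hgs).sub
      ((hηd.continuous.integrable_of_hasCompactSupport hηs).const_mul m)
  have hψ0 : ∫ ξ, ψ ξ = 0 := by
    rw [hψ, integral_sub (hg.continuous.integrable_of_hasCompactSupport hgs)
      ((hηd.continuous.integrable_of_hasCompactSupport hηs).const_mul m),
      integral_const_mul, hηi]
    simp [hm]
  set Ψ : ℝ → ℝ := fun ξ => ∫ s in α..ξ, ψ s with hΨ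
  have hΨ' : ∀ ξ, HasDerivAt Ψ (ψ ξ) ξ := fun ξ =>
    intervalIntegral.integral_hasDerivAt_right (hψc.intervalIntegrable _ _)
      (hψc.stronglyMeasurableAtFilter _ _) hψc.continuousAt
  have hdΨ : deriv Ψ = ψ := funext fun ξ => (hΨ' ξ).deriv
  have hΨz : ∀ ξ, ξ ∉ Icc α β → Ψ ξ = 0 := by
    intro ξ hξ
    rcases lt_or_ge ξ α with hlt | hge
    · rw [hΨ]
      simp only
      rw [intervalIntegral.integral_symm, intervalIntegral.integral_of_le hlt.le,
        integral_Ioc_eq_integral_Ioo, setIntegral_eq_zero_of_forall_eq_zero, neg_zero]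
      exact fun s hs => hψz s fun h' => absurd h'.1 (not_le.2 hs.2)
    · have hgt : β < ξ := by
        by_contra h'; exact hξ ⟨hge, not_lt.1 h'⟩
      rw [hΨ]
      simp only
      rw [intervalIntegral.integral_of_le hge, ← integral_Icc_eq_integral_Ioc,
        setIntegral_eq_integral_of_forall_compl_eq_zero, hψ0]
      exact fun s hs => hψz s fun h' => hs ⟨h'.1, h'.2.trans hgt.le⟩
  have hΨs : tsupport Ψ ⊆ Icc α β :=
    closure_minimal (fun ξ hξ => by by_contra h'; exact hξ (hΨz ξ h')) isClosed_Icc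
  have hΨd : ContDiff ℝ (⊤ : ℕ∞) Ψ := by
    rw [show ((⊤ : ℕ∞) : WithTop ℕ∞) = (⊤ : ℕ∞) from rfl, contDiff_infty_iff_deriv, hdΨ]
    exact ⟨fun ξ => (hΨ' ξ).differentiableAt, hψd⟩
  have h0 := h Ψ hΨd (HasCompactSupport.intro isCompact_Icc hΨz) (hΨs.trans hIcc)
  rw [hdΨ] at h0
  have i1 := hint g hg hgs
  have i2 := hint η hηd hηs
  have e1 : ∫ ξ, W ξ * ψ ξ = (∫ ξ, W ξ * g ξ) - m * ∫ ξ, W ξ * η ξ := by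
    rw [← integral_const_mul, ← integral_sub i1 (i2.const_mul m)]
    refine integral_congr_ae (Eventually.of_forall fun ξ => ?_)
    simp only [hψ]; ring
  have e2 : ∫ ξ, g ξ • (W ξ - ∫ ξ, W ξ * η ξ) =
      (∫ ξ, W ξ * g ξ) - m * ∫ ξ, W ξ * η ξ := by
    rw [hm, ← integral_mul_const,
      ← integral_sub i1 ((hg.continuous.integrable_of_hasCompactSupport hgs).mul_const _)]
    refine integral_congr_ae (Eventually.of_forall fun ξ => ?_)
    simp only [smul_eq_mul]; ring
  rw [e2, ← e1, h0]

/-- A function whose distributional derivative on an interval is `-U` is, up to a constant, the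
negative of a primitive of `U`. -/
lemma exists_ae_eq_const_sub_primitive {U G : ℝ → ℝ} {D C : Set ℝ} (hD : IsOpen D)
    (hconn : D.OrdConnected) {c : ℝ} (hc : c ∈ D) (hC : C.Countable)
    (hU : LocallyIntegrable U) (hG : LocallyIntegrable G)
    (hUc : ∀ ξ ∈ D \ C, ContinuousAt U ξ)
    (h : ∀ g : ℝ → ℝ, ContDiff ℝ (⊤ : ℕ∞) g → HasCompactSupport g → tsupport g ⊆ D →
      ∫ ξ, (-U ξ * g ξ + G ξ * deriv g ξ) = 0) :
    ∃ k, ∀ᵐ ξ, ξ ∈ D → G ξ = k - ∫ s in c..ξ, U s := by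
  have hUii : ∀ a b, IntervalIntegrable U volume a b := fun a b =>
    (hU.integrableOn_isCompact isCompact_uIcc).intervalIntegrable
  set V : ℝ → ℝ := fun ξ => ∫ s in c..ξ, U s with hV
  have hVc : Continuous V := intervalIntegral.continuous_primitive hUii c
  have hVd : ∀ ξ ∈ D \ C, HasDerivAt V (U ξ) ξ := fun ξ hξ =>
    intervalIntegral.integral_hasDerivAt_right (hUii c ξ)
      (hU.aestronglyMeasurable.stronglyMeasurableAtFilter) (hUc ξ hξ)
  -- Adding the primitive `V` cancels the source term, so `G + V` has zero distributional
  -- derivative.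
  obtain ⟨k, hk⟩ := ae_const_of_integral_mul_deriv_eq_zero (W := fun ξ => G ξ + V ξ) hD hconn
    ⟨c, hc⟩ (hG.add hVc.locallyIntegrable) fun g hg hgs hgD => by
      have h1 := h g hg hgs hgD
      have h2 := integral_mul_deriv_eq_zero_of_compactSupport hC hVc hU hVd hg hgs hgD
      have hg'c : Continuous (deriv g) := hg.continuous_deriv (by simp)
      have i1 : Integrable fun ξ => U ξ * g ξ :=
        (hU.integrable_smul_left_of_hasCompactSupport hg.continuous hgs).congr
          (Eventually.of_forall fun ξ => by simp [mul_comm])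
      have i2 : Integrable fun ξ => V ξ * deriv g ξ :=
        (hVc.mul hg'c).integrable_of_hasCompactSupport (hgs.deriv.mul_left)
      have i3 : Integrable fun ξ => G ξ * deriv g ξ :=
        (hG.integrable_smul_left_of_hasCompactSupport hg'c hgs.deriv).congr
          (Eventually.of_forall fun ξ => by simp [mul_comm])
      have i4 : Integrable fun ξ => -U ξ * g ξ := i1.neg.congr
        (Eventually.of_forall fun ξ => by simp)
      have e := integral_add (i4.add i3) (i1.add i2)
      simp only [Pi.add_apply] at e
      rw [h1, h2, add_zero] at e
      rw [← e]
      refine integral_congr_ae (Eventually.of_forall fun ξ => ?_)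
      simp only
      ring
  refine ⟨k, ?_⟩
  filter_upwards [hk] with ξ hξ hξD
  have := hξ hξD
  simp only [hV] at this
  linarith

/-! ### Potentials of self-similar solutions -/

/-- `H = F - ξ U` is a potential of the self-similar solution with density profile `U` and flux
profile `F` on `D`: it is continuous and `H' = -U` outside of a countable set `C`. -/
structure IsPotential (D C : Set ℝ) (U F H : ℝ → ℝ) : Prop where
  countable : C.Countable
  continuousOn : ContinuousOn H D
  hasDerivAt : ∀ ξ ∈ D \ C, HasDerivAt H (-U ξ) ξ
  eq : ∀ ξ ∈ D \ C, F ξ - ξ * U ξ = H ξ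

namespace IsPotential

variable {D C : Set ℝ} {U F H : ℝ → ℝ} {φ : ℝ → ℝ → ℝ}

lemma hasDerivAt_mul_rayIntegral (hP : IsPotential D C U F H) (hφ : IsTestFunction φ) {ξ : ℝ}
    (hξ : ξ ∈ D \ C) :
    HasDerivAt (fun ξ => H ξ * rayIntegral φ ξ) (profileIntegrand U F φ ξ) ξ := by
  have h := (hP.hasDerivAt ξ hξ).mul (hφ.hasDerivAt_rayIntegral ξ)
  rwa [← hP.eq ξ hξ] at h

lemma integral_profileIntegrand (hP : IsPotential D C U F H) (hconn : D.OrdConnected)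
    (hI : IntegrableOn (profileIntegrand U F φ) D) (hφ : IsTestFunction φ) {a b : ℝ}
    (ha : a ∈ D) (hb : b ∈ D) (hab : a ≤ b) :
    ∫ ξ in a..b, profileIntegrand U F φ ξ = H b * rayIntegral φ b - H a * rayIntegral φ a := by
  have hsub : Icc a b ⊆ D := hconn.out ha hb
  refine integral_eq_of_hasDerivAt_off_countable_of_le (fun ξ => H ξ * rayIntegral φ ξ) _ hab
    hP.countable ?_ ?_ ?_
  · refine (hP.continuousOn.mono hsub).mul fun ξ _ => ?_
    exact (hφ.hasDerivAt_rayIntegral ξ).continuousAt.continuousWithinAt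
  · rintro ξ ⟨hξ, hξC⟩
    exact hP.hasDerivAt_mul_rayIntegral hφ ⟨hsub (Ioo_subset_Icc_self hξ), hξC⟩
  · rw [intervalIntegrable_iff_integrableOn_Icc_of_le hab]
    exact hI.mono_set hsub

lemma tendsto_atTop (hP : IsPotential (Ioi 0) C U F H)
    (hI : IntegrableOn (profileIntegrand U F φ) (Ioi 0)) (hφ : IsTestFunction φ) {l : ℝ}
    (h0 : Tendsto (fun ξ => H ξ * rayIntegral φ ξ) (𝓝[>] 0) (𝓝 l)) :
    Tendsto (fun ξ => H ξ * rayIntegral φ ξ) atTop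
      (𝓝 ((∫ ξ in Ioi (0 : ℝ), profileIntegrand U F φ ξ) + l)) := by
  set J := (Ioi (0 : ℝ)).indicator (profileIntegrand U F φ) with hJ
  have hJi : Integrable J := (integrable_indicator_iff measurableSet_Ioi).2 hI
  have hJc : ∀ b, Continuous fun a => ∫ ξ in a..b, J ξ := by
    intro b
    have := (intervalIntegral.continuous_primitive (fun _ _ => hJi.intervalIntegrable) b).neg
    simp only [intervalIntegral.integral_symm b]
    exact this
  -- The endpoint `0` is outside the road, so the fundamental theorem is applied on `[a, b]` and `a`
  -- is sent to `0`.
  have key : ∀ b > 0, H b * rayIntegral φ b = (∫ ξ in (0 : ℝ)..b, J ξ) + l := by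
    intro b hb
    have h1 : Tendsto (fun a => ∫ ξ in a..b, J ξ) (𝓝[>] 0) (𝓝 (∫ ξ in (0 : ℝ)..b, J ξ)) :=
      ((hJc b).tendsto 0).mono_left nhdsWithin_le_nhds
    refine tendsto_nhds_unique (tendsto_const_nhds.congr' ?_) (h1.add h0)
    filter_upwards [Ioo_mem_nhdsGT hb] with a ha
    have h2 := hP.integral_profileIntegrand ordConnected_Ioi hI hφ ha.1 hb ha.2.le
    have h3 : ∫ ξ in a..b, J ξ = ∫ ξ in a..b, profileIntegrand U F φ ξ := by
      refine intervalIntegral.integral_congr fun ξ hξ => ?_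
      rw [uIcc_of_le ha.2.le] at hξ
      exact indicator_of_mem (show ξ ∈ Ioi 0 from ha.1.trans_le hξ.1) _
    rw [h3, h2]
    ring
  have h4 := (intervalIntegral_tendsto_integral_Ioi 0 hJi.integrableOn tendsto_id).add_const l
  rw [hJ, setIntegral_indicator measurableSet_Ioi, inter_self] at h4
  refine h4.congr' ?_
  filter_upwards [eventually_gt_atTop 0] with b hb
  exact (key b hb).symm

lemma tendsto_atBot (hP : IsPotential (Iio 0) C U F H)
    (hI : IntegrableOn (profileIntegrand U F φ) (Iio 0)) (hφ : IsTestFunction φ) {l : ℝ}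
    (h0 : Tendsto (fun ξ => H ξ * rayIntegral φ ξ) (𝓝[<] 0) (𝓝 l)) :
    Tendsto (fun ξ => H ξ * rayIntegral φ ξ) atBot
      (𝓝 (l - ∫ ξ in Iio (0 : ℝ), profileIntegrand U F φ ξ)) := by
  set J := (Iio (0 : ℝ)).indicator (profileIntegrand U F φ) with hJ
  have hJi : Integrable J := (integrable_indicator_iff measurableSet_Iio).2 hI
  have key : ∀ a < 0, H a * rayIntegral φ a = l - ∫ ξ in a..(0 : ℝ), J ξ := by
    intro a ha
    have h1 : Tendsto (fun b => ∫ ξ in a..b, J ξ) (𝓝[<] 0) (𝓝 (∫ ξ in a..(0 : ℝ), J ξ)) :=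
      ((intervalIntegral.continuous_primitive (fun _ _ => hJi.intervalIntegrable) a).tendsto
        0).mono_left nhdsWithin_le_nhds
    refine tendsto_nhds_unique (tendsto_const_nhds.congr' ?_) (h0.sub h1)
    filter_upwards [Ioo_mem_nhdsLT ha] with b hb
    have h2 := hP.integral_profileIntegrand ordConnected_Iio hI hφ ha hb.2 hb.1.le
    have h3 : ∫ ξ in a..b, J ξ = ∫ ξ in a..b, profileIntegrand U F φ ξ := by
      refine intervalIntegral.integral_congr fun ξ hξ => ?_
      rw [uIcc_of_le hb.1.le] at hξ
      exact indicator_of_mem (show ξ ∈ Iio 0 from lt_of_le_of_lt hξ.2 hb.2) _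
    rw [h3, h2]
    ring
  have h4 := (intervalIntegral_tendsto_integral_Iic 0 hJi.integrableOn tendsto_id).const_sub l
  rw [hJ, setIntegral_indicator measurableSet_Iio,
    inter_eq_right.2 (Iio_subset_Iic_self)] at h4
  refine h4.congr' ?_
  filter_upwards [eventually_lt_atBot 0] with a ha
  exact (key a ha).symm

/-! ### One-sided derivatives -/

/-- A countable set has dense complement, so limits taken inside an open set can be compared along
the complement of `C` only. -/
lemma eq_of_tendsto {f g : ℝ → ℝ} {s : Set ℝ} {ξ a b : ℝ} (hs : IsOpen s) (hξ : ξ ∈ closure s)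
    (hf : Tendsto f (𝓝[s] ξ) (𝓝 a)) (hg : Tendsto g (𝓝[s] ξ) (𝓝 b)) {C : Set ℝ}
    (hC : C.Countable) (h : ∀ᶠ y in 𝓝[s] ξ, y ∉ C → f y = g y) : a = b := by
  have hd : ξ ∈ closure (s ∩ Cᶜ) :=
    closure_minimal ((hC.dense_compl ℝ).open_subset_closure_inter hs) isClosed_closure hξ
  have : NeBot (𝓝[s ∩ Cᶜ] ξ) := mem_closure_iff_nhdsWithin_neBot.1 hd
  have hle : 𝓝[s ∩ Cᶜ] ξ ≤ 𝓝[s] ξ := nhdsWithin_mono _ inter_subset_left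
  refine tendsto_nhds_unique ((hf.mono_left hle).congr' ?_) (hg.mono_left hle)
  filter_upwards [hle h, self_mem_nhdsWithin] with y hy hyC
  exact hy hyC.2

/-- By continuity `H ξ` is computed from the right trace; together with `eq_left` this is the
Rankine-Hugoniot condition at `ξ`. -/
lemma eq_right (hP : IsPotential D C U F H) (hD : IsOpen D) {ξ u f : ℝ} (hξ : ξ ∈ D)
    (hu : Tendsto U (𝓝[>] ξ) (𝓝 u)) (hf : Tendsto F (𝓝[>] ξ) (𝓝 f)) : H ξ = f - ξ * u := by
  have hc := ((hP.continuousOn ξ hξ).continuousAt (hD.mem_nhds hξ)).tendsto.mono_left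
    (nhdsWithin_le_nhds (s := Ioi ξ))
  refine eq_of_tendsto isOpen_Ioi (by simp) hc
    (hf.sub ((tendsto_id.mono_left nhdsWithin_le_nhds).mul hu)) hP.countable ?_
  filter_upwards [nhdsWithin_le_nhds (hD.mem_nhds hξ)] with y hy hyC
  exact (hP.eq y ⟨hy, hyC⟩).symm

lemma eq_left (hP : IsPotential D C U F H) (hD : IsOpen D) {ξ u f : ℝ} (hξ : ξ ∈ D)
    (hu : Tendsto U (𝓝[<] ξ) (𝓝 u)) (hf : Tendsto F (𝓝[<] ξ) (𝓝 f)) : H ξ = f - ξ * u := by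
  have hc := ((hP.continuousOn ξ hξ).continuousAt (hD.mem_nhds hξ)).tendsto.mono_left
    (nhdsWithin_le_nhds (s := Iio ξ))
  refine eq_of_tendsto isOpen_Iio (by simp) hc
    (hf.sub ((tendsto_id.mono_left nhdsWithin_le_nhds).mul hu)) hP.countable ?_
  filter_upwards [nhdsWithin_le_nhds (hD.mem_nhds hξ)] with y hy hyC
  exact (hP.eq y ⟨hy, hyC⟩).symm

lemma eventually_eq_primitive (hP : IsPotential D C U F H) (hD : IsOpen D)
    (hU : LocallyIntegrableOn U D) {ξ : ℝ} (hξ : ξ ∈ D) :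
    ∃ a b, a < ξ ∧ ξ < b ∧ IntegrableOn U (Icc a b) ∧
      ∀ y ∈ Ioo a b, H y = H a - ∫ s in a..y, U s := by
  obtain ⟨ε, hε, hball⟩ := Metric.isOpen_iff.1 hD ξ hξ
  have hsub : Icc (ξ - ε / 2) (ξ + ε / 2) ⊆ D := by
    refine Subset.trans ?_ hball
    rw [Real.ball_eq_Ioo]
    exact Icc_subset_Ioo (by linarith) (by linarith)
  have hi : IntegrableOn U (Icc (ξ - ε / 2) (ξ + ε / 2)) :=
    hU.integrableOn_compact_subset hsub isCompact_Icc
  refine ⟨ξ - ε / 2, ξ + ε / 2, by linarith, by linarith, hi, fun y hy => ?_⟩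
  have hsub' : Icc (ξ - ε / 2) y ⊆ Icc (ξ - ε / 2) (ξ + ε / 2) := Icc_subset_Icc_right hy.2.le
  have h := integral_eq_of_hasDerivAt_off_countable_of_le H (fun s => -U s) hy.1.le hP.countable
    (hP.continuousOn.mono (hsub'.trans hsub))
    (fun s hs => hP.hasDerivAt s ⟨hsub (hsub' (Ioo_subset_Icc_self hs.1)), hs.2⟩)
    (by
      rw [intervalIntegrable_iff_integrableOn_Icc_of_le hy.1.le]
      exact (hi.mono_set hsub').neg)
  rw [intervalIntegral.integral_neg] at h
  linarith

/-- Near `ξ` the potential is a primitive of `-U`, and the one-sided fundamental theorem needs only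
a one-sided limit of `U`. At a jump of `U` the two traces thus appear as the two one-sided
derivatives of `H`. -/
lemma hasDerivWithinAt_right (hP : IsPotential D C U F H) (hD : IsOpen D)
    (hU : LocallyIntegrableOn U D) {ξ u : ℝ} (hξ : ξ ∈ D)
    (hu : Tendsto U (𝓝[>] ξ) (𝓝 u)) : HasDerivWithinAt H (-u) (Ici ξ) ξ := by
  obtain ⟨a, b, ha, hb, hi, hH⟩ := hP.eventually_eq_primitive hD hU hξ
  have hint : IntervalIntegrable U volume a ξ := by
    rw [intervalIntegrable_iff_integrableOn_Icc_of_le ha.le]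
    exact hi.mono_set (Icc_subset_Icc_right hb.le)
  have hm : StronglyMeasurableAtFilter U (𝓝[Ioi ξ] ξ) :=
    ⟨Icc a b, nhdsWithin_le_nhds (Icc_mem_nhds ha hb), hi.aestronglyMeasurable⟩
  have h := (intervalIntegral.integral_hasDerivWithinAt_of_tendsto_ae_right (s := Ici ξ)
    (t := Ioi ξ) hint hm (hu.mono_left inf_le_left)).const_sub (H a)
  refine h.congr_of_eventuallyEq ?_ (hH ξ ⟨ha, hb⟩)
  filter_upwards [nhdsWithin_le_nhds (Ioo_mem_nhds ha hb)] with y hy using hH y hy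

lemma hasDerivWithinAt_left (hP : IsPotential D C U F H) (hD : IsOpen D)
    (hU : LocallyIntegrableOn U D) {ξ u : ℝ} (hξ : ξ ∈ D)
    (hu : Tendsto U (𝓝[<] ξ) (𝓝 u)) : HasDerivWithinAt H (-u) (Iic ξ) ξ := by
  obtain ⟨a, b, ha, hb, hi, hH⟩ := hP.eventually_eq_primitive hD hU hξ
  have hint : IntervalIntegrable U volume a ξ := by
    rw [intervalIntegrable_iff_integrableOn_Icc_of_le ha.le]
    exact hi.mono_set (Icc_subset_Icc_right hb.le)
  have hm : StronglyMeasurableAtFilter U (𝓝[Iic ξ] ξ) :=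
    ⟨Icc a b, nhdsWithin_le_nhds (Icc_mem_nhds ha hb), hi.aestronglyMeasurable⟩
  -- The value of `U` at `ξ` itself is not controlled, but a single point is null.
  have hle : 𝓝[≤] ξ ⊓ ae volume ≤ 𝓝[<] ξ := by
    have h1 : ({ξ}ᶜ : Set ℝ) ∈ ae (volume : Measure ℝ) := compl_mem_ae_iff.2 (by simp)
    have h2 : 𝓝[≤] ξ ⊓ ae volume ≤ 𝓝[≤] ξ ⊓ 𝓟 {ξ}ᶜ :=
      inf_le_inf_left _ (le_principal_iff.2 h1)
    refine h2.trans ?_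
    rw [nhdsWithin, inf_assoc, inf_principal, nhdsWithin]
    refine inf_le_inf_left _ (principal_mono.2 ?_)
    exact fun y hy => lt_of_le_of_ne hy.1 hy.2
  have h := (intervalIntegral.integral_hasDerivWithinAt_of_tendsto_ae_right (s := Iic ξ)
    (t := Iic ξ) hint hm (hu.mono_left hle)).const_sub (H a)
  refine h.congr_of_eventuallyEq ?_ (hH ξ ⟨ha, hb⟩)
  filter_upwards [nhdsWithin_le_nhds (Ioo_mem_nhds ha hb)] with y hy using hH y hy

end IsPotential

/-! ### Weak solutions on one road -/

/-- The fields `u`, `f` on a road with domain `D` are the self-similar fields with bounded profiles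
`U`, `F`, which are continuous outside of a countable set. -/
structure IsProfile (D C : Set ℝ) (M : ℝ) (u f : ℝ → ℝ → ℝ) (U F : ℝ → ℝ) : Prop where
  countable : C.Countable
  density : ∀ x ∈ D, ∀ t > 0, u x t = U (x / t)
  flux : ∀ x ∈ D, ∀ t > 0, f x t = F (x / t)
  continuousAt_density : ∀ ξ ∈ D \ C, ContinuousAt U ξ
  continuousAt_flux : ∀ ξ ∈ D \ C, ContinuousAt F ξ
  bound_density : ∀ ξ ∈ D, |U ξ| ≤ M
  bound_flux : ∀ ξ ∈ D, |F ξ| ≤ M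
  bound_nonneg : 0 ≤ M

/-- The domain of a road: one of the two half-lines. -/
def IsRoadDomain (D : Set ℝ) : Prop := D = Ioi 0 ∨ D = Iio 0

namespace IsRoadDomain

variable {D : Set ℝ}

lemma isOpen (hD : IsRoadDomain D) : IsOpen D := by
  rcases hD with rfl | rfl
  · exact isOpen_Ioi
  · exact isOpen_Iio

lemma ordConnected (hD : IsRoadDomain D) : D.OrdConnected := by
  rcases hD with rfl | rfl
  · exact ordConnected_Ioi
  · exact ordConnected_Iio

lemma nonempty (hD : IsRoadDomain D) : D.Nonempty := by
  rcases hD with rfl | rfl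
  · exact nonempty_Ioi
  · exact nonempty_Iio

lemma zero_notMem (hD : IsRoadDomain D) : (0 : ℝ) ∉ D := by
  rcases hD with rfl | rfl <;> simp

lemma div_mem_iff (hD : IsRoadDomain D) (x t : ℝ) (ht : 0 < t) : x / t ∈ D ↔ x ∈ D := by
  rcases hD with rfl | rfl
  · simp [div_pos_iff_of_pos_right ht]
  · simp [div_neg_iff, ht, not_lt.2 ht.le]

end IsRoadDomain

namespace IsProfile

variable {D C : Set ℝ} {M u₀ : ℝ} {u f : ℝ → ℝ → ℝ} {U F H : ℝ → ℝ} {φ : ℝ → ℝ → ℝ}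

lemma integral_eq (hp : IsProfile D C M u f U F) (hD : IsRoadDomain D) (hφ : IsTestFunction φ) :
    IntegrableOn (profileIntegrand U F φ) D ∧
    weakForm D u f u₀ φ = (∫ ξ in D, profileIntegrand U F φ ξ) + u₀ * ∫ x in D, φ x 0 := by
  have h := integral_integral_profile hD.isOpen.measurableSet hD.div_mem_iff hp.density hp.flux
    (aestronglyMeasurable_of_countable hD.isOpen.measurableSet hp.countable
      hp.continuousAt_density)
    (aestronglyMeasurable_of_countable hD.isOpen.measurableSet hp.countable hp.continuousAt_flux)
    hp.bound_density hp.bound_flux hp.bound_nonneg hφ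
  refine ⟨h.1, ?_⟩
  rw [weakForm, h.2, integral_const_mul]

lemma locallyIntegrable_indicator {G : ℝ → ℝ} (hD : IsOpen D) (hC : C.Countable)
    (hG : ∀ ξ ∈ D \ C, ContinuousAt G ξ) (hGM : ∀ ξ ∈ D, |G ξ| ≤ M) (hM : 0 ≤ M) :
    LocallyIntegrable (D.indicator G) := by
  have hm := (aestronglyMeasurable_indicator_iff hD.measurableSet).2
    (aestronglyMeasurable_of_countable hD.measurableSet hC hG)
  refine LocallyIntegrable.mono (locallyIntegrable_const M) hm (Eventually.of_forall fun ξ => ?_)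
  by_cases h : ξ ∈ D
  · rw [indicator_of_mem h, Real.norm_of_nonneg hM]; exact hGM ξ h
  · rw [indicator_of_notMem h]; simp

lemma locallyIntegrableOn (hp : IsProfile D C M u f U F) (hD : IsOpen D) :
    LocallyIntegrableOn U D := by
  have h := (locallyIntegrable_indicator hD hp.countable hp.continuousAt_density
    hp.bound_density hp.bound_nonneg).locallyIntegrableOn D
  intro x hx
  obtain ⟨s, hs, hsi⟩ := h x hx
  refine ⟨s ∩ D, inter_mem hs self_mem_nhdsWithin, ?_⟩
  refine (hsi.mono_set inter_subset_left).congr ?_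
  have : ∀ᵐ ξ ∂(volume.restrict (s ∩ D)), ξ ∈ D :=
    ae_restrict_of_ae_restrict_of_subset inter_subset_right
      (ae_restrict_mem hD.measurableSet)
  filter_upwards [this] with ξ hξ
  exact indicator_of_mem hξ _

/-- A self-similar weak solution in the interior of a road has a potential. -/
lemma exists_isPotential (hp : IsProfile D C M u f U F) (hD : IsRoadDomain D)
    (hw : ∀ φ, IsTestFunction φ → (∀ t, 0 ≤ t → φ 0 t = 0) → weakForm D u f u₀ φ = 0) :
    ∃ H, Continuous H ∧ IsPotential D C U F H := by
  obtain ⟨c, hc⟩ := hD.nonempty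
  obtain ⟨χ, hχ, hχs, hχi⟩ := exists_time_profile
  have hUl := locallyIntegrable_indicator hD.isOpen hp.countable hp.continuousAt_density
    hp.bound_density hp.bound_nonneg
  have hFl := locallyIntegrable_indicator hD.isOpen hp.countable hp.continuousAt_flux
    hp.bound_flux hp.bound_nonneg
  have hGl : LocallyIntegrable (fun ξ => D.indicator F ξ - ξ * D.indicator U ξ) := by
    refine hFl.sub ?_
    exact locallyIntegrableOn_univ.1 ((hUl.locallyIntegrableOn univ).continuousOn_mul
      continuousOn_id isOpen_univ.isLocallyClosed)
  have hUc : ∀ ξ ∈ D \ C, ContinuousAt (D.indicator U) ξ := by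
    intro ξ hξ
    refine (hp.continuousAt_density ξ hξ).congr ?_
    filter_upwards [hD.isOpen.mem_nhds hξ.1] with y hy
    exact (indicator_of_mem hy _).symm
  obtain ⟨k, hk⟩ := exists_ae_eq_const_sub_primitive hD.isOpen hD.ordConnected hc hp.countable
    hUl hGl hUc fun g hg hgs hgD => by
      -- Tested with `χ(t) g(x / t)`, the weak form becomes `∫ (-U g + (F - ξ U) g')`; the initial
      -- term drops out since `χ 0 = 0`.
      have hφ := isTestFunction_selfSimilar hχ hχs hg hgs
      have hA := rayIntegral_selfSimilar (g := g) hχi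
      have hA' : ∀ ξ, rayIntegralDeriv (fun x t => χ t * g (x / t)) ξ = deriv g ξ := by
        intro ξ
        have := hφ.hasDerivAt_rayIntegral ξ
        rw [hA] at this
        exact this.deriv.symm
      have h := hw _ hφ fun t _ => by
        rw [zero_div, image_eq_zero_of_notMem_tsupport fun h => hD.zero_notMem (hgD h), mul_zero]
      rw [(hp.integral_eq hD hφ).2] at h
      have h0 : χ 0 = 0 := hχs 0 (by simp)
      simp only [h0, zero_mul, integral_zero, mul_zero, add_zero] at h
      rw [← h, ← integral_indicator hD.isOpen.measurableSet]
      refine integral_congr_ae (Eventually.of_forall fun ξ => ?_)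
      by_cases hξ : ξ ∈ D
      · simp only [indicator_of_mem hξ, profileIntegrand, hA, hA']
      · simp only [indicator_of_notMem hξ]; simp
  have hii : ∀ a b, IntervalIntegrable (D.indicator U) volume a b := fun a b =>
    (hUl.integrableOn_isCompact isCompact_uIcc).intervalIntegrable
  set H : ℝ → ℝ := fun ξ => k - ∫ s in c..ξ, D.indicator U s with hH
  have hHc : Continuous H := continuous_const.sub (intervalIntegral.continuous_primitive hii c)
  refine ⟨H, hHc, hp.countable, hHc.continuousOn, ?_, ?_⟩
  · intro ξ hξ
    have := (intervalIntegral.integral_hasDerivAt_right (hii c ξ)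
      hUl.aestronglyMeasurable.stronglyMeasurableAtFilter (hUc ξ hξ)).const_sub k
    rwa [indicator_of_mem hξ.1] at this
  · intro ξ hξ
    -- The identity holds almost everywhere so far. A set of full measure is dense, so it extends to
    -- every point where `U` and `F` are continuous.
    set E := {ξ | ξ ∈ D → D.indicator F ξ - ξ * D.indicator U ξ = H ξ} with hE
    have hdense : Dense E := Measure.dense_of_ae hk
    have : NeBot (𝓝[E] ξ) :=
      mem_closure_iff_nhdsWithin_neBot.1 (hdense ξ)
    have h1 : Tendsto (fun ξ => F ξ - ξ * U ξ) (𝓝 ξ) (𝓝 (F ξ - ξ * U ξ)) :=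
      ((hp.continuousAt_flux ξ hξ).sub (continuousAt_id.mul (hp.continuousAt_density ξ hξ)))
    refine tendsto_nhds_unique (l := 𝓝[E] ξ) (h1.mono_left nhdsWithin_le_nhds)
      (((hHc.tendsto ξ).mono_left nhdsWithin_le_nhds).congr' ?_)
    filter_upwards [nhdsWithin_le_nhds (hD.isOpen.mem_nhds hξ.1), self_mem_nhdsWithin] with y hy h
    have := h hy
    rw [indicator_of_mem hy, indicator_of_mem hy] at this
    exact this.symm

end IsProfile

/-- The factor in `x` vanishes at the junction, so one road is tested alone, while the factor in `t`
equals `g 2 ≠ 0` at `t = 0` and sees the initial data. The sign `s` selects the half-line. -/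
lemma exists_isTestFunction_away_from_zero (s : ℝ) (hs : s = 1 ∨ s = -1) :
    ∃ g : ℝ → ℝ, IsTestFunction (fun x t => g (s * x) * g (t + 2)) ∧ g 0 = 0 ∧ g 2 ≠ 0 ∧
      ∫ x in Ioi (0 : ℝ), g x = 1 := by
  let b : ContDiffBump (2 : ℝ) := ⟨1 / 2, 1, by norm_num, by norm_num⟩
  have hg := b.contDiff_normed (μ := volume) (n := (⊤ : ℕ∞))
  have hsupp : ∀ t, t ∉ Ioo (1 : ℝ) 3 → b.normed volume t = 0 := by
    intro t ht
    by_contra h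
    have : t ∈ Function.support (b.normed volume) := h
    rw [b.support_normed_eq, Real.ball_eq_Ioo] at this
    norm_num [b] at this
    exact ht this
  refine ⟨b.normed volume, ⟨?_, ?_⟩, hsupp 0 (by simp), ?_, ?_⟩
  · exact (hg.comp (by fun_prop : ContDiff ℝ (⊤ : ℕ∞) fun z : ℝ × ℝ => s * z.1)).mul
      (hg.comp (by fun_prop : ContDiff ℝ (⊤ : ℕ∞) fun z : ℝ × ℝ => z.2 + 2))
  · refine HasCompactSupport.intro ((isCompact_Icc (a := (-3 : ℝ)) (b := 3)).prod
      (isCompact_Icc (a := (-3 : ℝ)) (b := 3))) ?_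
    rintro ⟨x, t⟩ hxt
    simp only [Function.uncurry]
    by_contra h
    rw [mul_eq_zero, not_or] at h
    have h1 : s * x ∈ Ioo (1 : ℝ) 3 := by by_contra h'; exact h.1 (hsupp _ h')
    have h2 : t + 2 ∈ Ioo (1 : ℝ) 3 := by by_contra h'; exact h.2 (hsupp _ h')
    refine hxt ⟨?_, ⟨by linarith [h2.1], by linarith [h2.2]⟩⟩
    rcases hs with rfl | rfl
    · exact ⟨by linarith [h1.1], by linarith [h1.2]⟩
    · exact ⟨by linarith [h1.2], by linarith [h1.1]⟩
  · have : (2 : ℝ) ∈ Function.support (b.normed volume) := by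
      rw [b.support_normed_eq]
      exact Metric.mem_ball_self one_pos
    exact this
  · rw [setIntegral_eq_integral_of_forall_compl_eq_zero, b.integral_normed]
    intro t ht
    exact hsupp t fun h => ht (zero_lt_one.trans h.1)

/-! ### Initial data and junction flux read off from the potential -/

namespace IsProfile

variable {C : Set ℝ} {M u₀ : ℝ} {u f : ℝ → ℝ → ℝ} {U F H : ℝ → ℝ} {φ : ℝ → ℝ → ℝ}

/-- For a test function vanishing at the junction, the weak form says that `H ξ * A ξ` tends to `-u₀
∫ φ(x, 0) dx`, where `A` is the ray integral, while `ξ * A ξ` tends to `∫ φ(x, 0) dx`. The quotient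
gives the claim once the last integral is nonzero. -/
lemma tendsto_potential_div_atTop (hp : IsProfile (Ioi 0) C M u f U F)
    (hP : IsPotential (Ioi 0) C U F H) (hH : Continuous H)
    (hw : ∀ φ, IsTestFunction φ → (∀ t, 0 ≤ t → φ 0 t = 0) →
      weakForm (Ioi 0) u f u₀ φ = 0) :
    Tendsto (fun ξ => H ξ / ξ) atTop (𝓝 (-u₀)) := by
  obtain ⟨g, hφ, hg0, hg2, hgi⟩ := exists_isTestFunction_away_from_zero 1 (Or.inl rfl)
  have hz : ∀ t, g (1 * 0) * g (t + 2) = 0 := fun t => by rw [mul_zero, hg0, zero_mul]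
  have h1 := hp.integral_eq (u₀ := u₀) (Or.inl rfl) hφ
  rw [hw _ hφ fun t _ => hz t] at h1
  have h2 := hP.tendsto_atTop h1.1 hφ (l := 0) (by
    have hA0 : rayIntegral (fun x t => g (1 * x) * g (t + 2)) 0 = 0 := by
      simp [rayIntegral, hg0]
    have := (hH.continuousAt (x := 0)).tendsto.mul (hφ.hasDerivAt_rayIntegral 0).continuousAt
    rw [hA0, mul_zero] at this
    exact this.mono_left nhdsWithin_le_nhds)
  have hi : ∫ x in Ioi (0 : ℝ), g (1 * x) * g (0 + 2) = g 2 := by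
    rw [integral_mul_const]; simp [hgi]
  have h3 := hφ.tendsto_mul_rayIntegral_atTop
  simp only [hi] at h1 h3
  rw [show (∫ ξ in Ioi (0 : ℝ), profileIntegrand U F (fun x t => g (1 * x) * g (t + 2)) ξ) + 0 =
    -u₀ * g 2 by linarith [h1.2]] at h2
  have h4 := h2.div h3 hg2
  rw [mul_div_cancel_right₀ _ hg2] at h4
  refine h4.congr' ?_
  filter_upwards [h3.eventually_ne hg2] with ξ hξ
  rw [mul_ne_zero_iff] at hξ
  rw [Pi.div_apply, mul_div_mul_right _ _ hξ.2]

lemma tendsto_potential_div_atBot (hp : IsProfile (Iio 0) C M u f U F)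
    (hP : IsPotential (Iio 0) C U F H) (hH : Continuous H)
    (hw : ∀ φ, IsTestFunction φ → (∀ t, 0 ≤ t → φ 0 t = 0) →
      weakForm (Iio 0) u f u₀ φ = 0) :
    Tendsto (fun ξ => H ξ / ξ) atBot (𝓝 (-u₀)) := by
  obtain ⟨g, hφ, hg0, hg2, hgi⟩ := exists_isTestFunction_away_from_zero (-1) (Or.inr rfl)
  have hz : ∀ t, g (-1 * 0) * g (t + 2) = 0 := fun t => by rw [mul_zero, hg0, zero_mul]
  have h1 := hp.integral_eq (u₀ := u₀) (Or.inr rfl) hφ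
  rw [hw _ hφ fun t _ => hz t] at h1
  have h2 := hP.tendsto_atBot h1.1 hφ (l := 0) (by
    have hA0 : rayIntegral (fun x t => g (-1 * x) * g (t + 2)) 0 = 0 := by
      simp [rayIntegral, hg0]
    have := (hH.continuousAt (x := 0)).tendsto.mul (hφ.hasDerivAt_rayIntegral 0).continuousAt
    rw [hA0, mul_zero] at this
    exact this.mono_left nhdsWithin_le_nhds)
  have hi : ∫ x in Iio (0 : ℝ), g (-1 * x) * g (0 + 2) = g 2 := by
    rw [integral_mul_const]
    have := integral_comp_neg_Iic (0 : ℝ) g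
    rw [neg_zero, hgi, integral_Iic_eq_integral_Iio] at this
    simp [this]
  have h3 := hφ.tendsto_mul_rayIntegral_atBot
  simp only [hi] at h1 h3
  rw [show 0 - (∫ ξ in Iio (0 : ℝ), profileIntegrand U F (fun x t => g (-1 * x) * g (t + 2)) ξ) =
    -u₀ * -g 2 by linarith [h1.2]] at h2
  have hg2' : -g 2 ≠ 0 := neg_ne_zero.2 hg2
  have h4 := h2.div h3 hg2'
  rw [mul_div_cancel_right₀ _ hg2'] at h4
  refine h4.congr' ?_
  filter_upwards [h3.eventually_ne hg2'] with ξ hξ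
  rw [mul_ne_zero_iff] at hξ
  rw [Pi.div_apply, mul_div_mul_right _ _ hξ.2]

/-- The weak form on an outgoing road reduces to the flux through the junction. -/
lemma weakForm_eq_of_outgoing (hp : IsProfile (Ioi 0) C M u f U F)
    (hP : IsPotential (Ioi 0) C U F H) (hlim : Tendsto (fun ξ => H ξ / ξ) atTop (𝓝 (-u₀)))
    {q : ℝ} (hq : Tendsto H (𝓝[>] 0) (𝓝 q)) (hφ : IsTestFunction φ) :
    weakForm (Ioi 0) u f u₀ φ = -(q * rayIntegral φ 0) := by
  have h1 := hp.integral_eq (u₀ := u₀) (Or.inl rfl) hφ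
  have h2 := hP.tendsto_atTop h1.1 hφ (hq.mul
    ((hφ.hasDerivAt_rayIntegral 0).continuousAt.tendsto.mono_left nhdsWithin_le_nhds))
  have h3 := hlim.mul hφ.tendsto_mul_rayIntegral_atTop
  have h4 := tendsto_nhds_unique h2 (h3.congr' (by
    filter_upwards [eventually_gt_atTop 0] with ξ hξ
    field_simp))
  rw [h1.2]
  linarith

/-- The weak form on an incoming road reduces to the flux through the junction. -/
lemma weakForm_eq_of_incoming (hp : IsProfile (Iio 0) C M u f U F)
    (hP : IsPotential (Iio 0) C U F H) (hlim : Tendsto (fun ξ => H ξ / ξ) atBot (𝓝 (-u₀)))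
    {q : ℝ} (hq : Tendsto H (𝓝[<] 0) (𝓝 q)) (hφ : IsTestFunction φ) :
    weakForm (Iio 0) u f u₀ φ = q * rayIntegral φ 0 := by
  have h1 := hp.integral_eq (u₀ := u₀) (Or.inr rfl) hφ
  have h2 := hP.tendsto_atBot h1.1 hφ (hq.mul
    ((hφ.hasDerivAt_rayIntegral 0).continuousAt.tendsto.mono_left nhdsWithin_le_nhds))
  have h3 := hlim.mul hφ.tendsto_mul_rayIntegral_atBot
  have h4 := tendsto_nhds_unique h2 (h3.congr' (by
    filter_upwards [eventually_lt_atBot 0] with ξ hξ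
    have := hξ.ne
    field_simp))
  rw [h1.2]
  linarith

end IsProfile

/-! ### Monotonicity from one-sided derivatives -/

lemma le_of_rightDeriv_nonpos {f f' : ℝ → ℝ} {a b : ℝ} (hab : a ≤ b)
    (hf : ∀ x ∈ Icc a b, HasDerivWithinAt f (f' x) (Ici x) x) (hc : ContinuousOn f (Icc a b))
    (h : ∀ x ∈ Icc a b, f' x ≤ 0) : f b ≤ f a :=
  image_le_of_deriv_right_le_deriv_boundary hc (fun x hx => hf x (Ico_subset_Icc_self hx))
    (B := fun _ => f a) (B' := fun _ => 0) le_rfl continuousOn_const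
    (fun _ _ => hasDerivWithinAt_const _ _ _) (fun x hx => h x (Ico_subset_Icc_self hx))
    (right_mem_Icc.2 hab)

lemma le_of_rightDeriv_nonneg {f f' : ℝ → ℝ} {a b : ℝ} (hab : a ≤ b)
    (hf : ∀ x ∈ Icc a b, HasDerivWithinAt f (f' x) (Ici x) x) (hc : ContinuousOn f (Icc a b))
    (h : ∀ x ∈ Icc a b, 0 ≤ f' x) : f a ≤ f b := by
  have := le_of_rightDeriv_nonpos (f := fun x => -f x) (f' := fun x => -f' x) hab
    (fun x hx => (hf x hx).neg) hc.neg (fun x hx => neg_nonpos.2 (h x hx))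
  linarith

lemma hasDerivWithinAt_div_sub {K : ℝ → ℝ} {k c ξ : ℝ} {s : Set ℝ}
    (hK : HasDerivWithinAt K k s ξ) (hc : ξ - c ≠ 0) :
    HasDerivWithinAt (fun ξ => K ξ / (ξ - c)) ((k * (ξ - c) - K ξ) / (ξ - c) ^ 2) s ξ := by
  exact (hK.fun_div ((hasDerivWithinAt_id ξ s).sub_const c) hc).congr_deriv (by simp)

lemma tendsto_div_sub {K : ℝ → ℝ} {l : Filter ℝ} (hl : Tendsto (fun ξ : ℝ => ξ⁻¹) l (𝓝 0))
    (hne : ∀ᶠ ξ in l, ξ ≠ 0) {k : ℝ} (h : Tendsto (fun ξ => K ξ / ξ) l (𝓝 k)) (c : ℝ) :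
    Tendsto (fun ξ => K ξ / (ξ - c)) l (𝓝 k) := by
  have h1 : Tendsto (fun ξ : ℝ => 1 - c * ξ⁻¹) l (𝓝 1) := by
    simpa using (hl.const_mul c).const_sub 1
  have h2 := h.div h1 one_ne_zero
  rw [div_one] at h2
  refine h2.congr' ?_
  filter_upwards [hne] with ξ hξ
  have : 1 - c * ξ⁻¹ = (ξ - c) / ξ := by field_simp
  rw [Pi.div_apply, this, div_div_div_cancel_right₀ hξ]

/-! ### Transported quantities -/

/-- A quantity transported with nonnegative velocity into an incoming road vanishes if it vanishes
initially. -/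
lemma eq_zero_of_transported_incoming {K κ v : ℝ → ℝ} {M : ℝ} (hM : 0 ≤ M)
    (hc : ContinuousOn K (Iio 0))
    (hd : ∀ ξ < 0, HasDerivWithinAt K (-κ ξ) (Ici ξ) ξ) (hK : ∀ ξ < 0, K ξ = κ ξ * (v ξ - ξ))
    (hv : ∀ ξ < 0, 0 ≤ v ξ ∧ v ξ ≤ M) (hlim : Tendsto (fun ξ => K ξ / ξ) atBot (𝓝 0)) :
    ∀ ξ < 0, K ξ = 0 := by
  intro ξ hξ
  have hne : ∀ y < (0 : ℝ), y - M < 0 := fun y hy => by linarith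
  -- The derivative of this square has the sign of `(v - x)(M - v) / (x - M)`, which is nonpositive
  -- because `x < 0 ≤ v ≤ M`. A nonnegative, nonincreasing function with limit `0` at `-∞` is zero.
  have hlim' : Tendsto (fun y => (K y / (y - M)) ^ 2) atBot (𝓝 0) := by
    have := (tendsto_div_sub tendsto_inv_atBot_zero
      ((eventually_lt_atBot 0).mono fun y hy => hy.ne) hlim M).pow 2
    simpa using this
  have hle : ∀ y < ξ, (K ξ / (ξ - M)) ^ 2 ≤ (K y / (y - M)) ^ 2 := by
    intro y hy
    have hsub : ∀ x ∈ Icc y ξ, x < 0 := fun x hx => hx.2.trans_lt hξ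
    refine le_of_rightDeriv_nonpos (f := fun x => (K x / (x - M)) ^ 2)
      (f' := fun x => 2 * (K x / (x - M)) * ((-κ x * (x - M) - K x) / (x - M) ^ 2)) hy.le
      (fun x hx => ?_) ?_ (fun x hx => ?_)
    · exact ((hasDerivWithinAt_div_sub (hd x (hsub x hx)) (hne x (hsub x hx)).ne).fun_pow
        2).congr_deriv (by simp)
    · exact ((hc.mono hsub).div (by fun_prop) fun x hx => (hne x (hsub x hx)).ne).pow 2
    · have hx0 := hsub x hx
      have h0 := hne x hx0
      obtain ⟨h1, h2⟩ := hv x hx0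
      have e : 2 * (K x / (x - M)) * ((-κ x * (x - M) - K x) / (x - M) ^ 2) =
          (2 * κ x ^ 2 * (v x - x) * (M - v x)) / ((x - M) ^ 2 * (x - M)) := by
        rw [hK x hx0]; field_simp; ring
      rw [e]
      refine div_nonpos_of_nonneg_of_nonpos ?_ (mul_nonpos_of_nonneg_of_nonpos (sq_nonneg _) h0.le)
      have := sq_nonneg (κ x)
      have h3 : 0 ≤ v x - x := by linarith
      have h4 : 0 ≤ M - v x := by linarith
      positivity
  have h := ge_of_tendsto hlim' ((eventually_lt_atBot ξ).mono hle)
  have h2 : K ξ / (ξ - M) = 0 := pow_eq_zero_iff (two_ne_zero) |>.1 (le_antisymm h (sq_nonneg _))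
  rcases div_eq_zero_iff.1 h2 with h3 | h3
  · exact h3
  · exact absurd h3 (hne ξ hξ).ne

/-- A quantity transported with a velocity in `[0, ξ)` along the rays `x = ξ t` vanishes if it
vanishes initially. -/
lemma eq_zero_of_transported_outgoing {K κ v : ℝ → ℝ} {a : ℝ} (ha : 0 ≤ a)
    (hc : ContinuousOn K (Ioi a))
    (hd : ∀ ξ > a, HasDerivWithinAt K (-κ ξ) (Ici ξ) ξ) (hK : ∀ ξ > a, K ξ = κ ξ * (v ξ - ξ))
    (hv : ∀ ξ > a, 0 ≤ v ξ ∧ v ξ ≤ ξ) (hlim : Tendsto (fun ξ => K ξ / ξ) atTop (𝓝 0)) :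
    ∀ ξ > a, K ξ = 0 := by
  intro ξ hξ
  -- Here the derivative of the square is `2 κ² (x - v) v / x³ ≥ 0`, and the limit `0` at `+∞`
  -- forces it to vanish.
  have hlim' : Tendsto (fun y => (K y / (y - 0)) ^ 2) atTop (𝓝 0) := by
    simpa using hlim.pow 2
  have hle : ∀ y > ξ, (K ξ / (ξ - 0)) ^ 2 ≤ (K y / (y - 0)) ^ 2 := by
    intro y hy
    have hsub : ∀ x ∈ Icc ξ y, a < x := fun x hx => lt_of_lt_of_le hξ hx.1
    have hne : ∀ x ∈ Icc ξ y, x - 0 ≠ 0 := fun x hx => by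
      have := hsub x hx
      rw [sub_zero]
      exact (ha.trans_lt this).ne'
    refine le_of_rightDeriv_nonneg (f := fun x => (K x / (x - 0)) ^ 2)
      (f' := fun x => 2 * (K x / (x - 0)) * ((-κ x * (x - 0) - K x) / (x - 0) ^ 2)) hy.le
      (fun x hx => ?_) ?_ (fun x hx => ?_)
    · exact ((hasDerivWithinAt_div_sub (hd x (hsub x hx)) (hne x hx)).fun_pow 2).congr_deriv
        (by simp)
    · exact ((hc.mono hsub).div (by fun_prop) hne).pow 2
    · have hx0 := hsub x hx
      have hx1 : 0 < x := ha.trans_lt hx0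
      obtain ⟨h1, h2⟩ := hv x hx0
      have e : 2 * (K x / (x - 0)) * ((-κ x * (x - 0) - K x) / (x - 0) ^ 2) =
          (2 * κ x ^ 2 * (x - v x) * v x) / (x ^ 2 * x) := by
        rw [hK x hx0, sub_zero]; field_simp; ring
      rw [e]
      have h3 : 0 ≤ x - v x := by linarith
      positivity
  have h := ge_of_tendsto hlim' ((eventually_gt_atTop ξ).mono hle)
  have h2 : K ξ / (ξ - 0) = 0 := pow_eq_zero_iff (two_ne_zero) |>.1 (le_antisymm h (sq_nonneg _))
  rw [sub_zero, div_eq_zero_iff] at h2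
  exact h2.resolve_right (ha.trans_lt hξ).ne'

/-- A density transported with nonnegative velocity stays positive on an incoming road. -/
lemma le_potential_incoming {N ρ v : ℝ → ℝ} {ρ₀ : ℝ} (hc : ContinuousOn N (Iio 0))
    (hd : ∀ ξ < 0, HasDerivWithinAt N (-ρ ξ) (Ici ξ) ξ) (hN : ∀ ξ < 0, N ξ = ρ ξ * (v ξ - ξ))
    (hv : ∀ ξ < 0, 0 ≤ v ξ) (hρ : ∀ ξ < 0, 0 ≤ ρ ξ)
    (hlim : Tendsto (fun ξ => N ξ / ξ) atBot (𝓝 (-ρ₀))) :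
    ∀ ξ < 0, ρ₀ * (-ξ) ≤ N ξ := by
  intro ξ hξ
  -- The derivative of `N / x` is `-ρ v / x² ≤ 0`.
  have hle : ∀ y < ξ, N ξ / (ξ - 0) ≤ N y / (y - 0) := by
    intro y hy
    have hsub : ∀ x ∈ Icc y ξ, x < 0 := fun x hx => hx.2.trans_lt hξ
    have hne : ∀ x ∈ Icc y ξ, x - 0 ≠ 0 := fun x hx => by
      rw [sub_zero]; exact (hsub x hx).ne
    refine le_of_rightDeriv_nonpos (f := fun x => N x / (x - 0)) hy.le
      (fun x hx => hasDerivWithinAt_div_sub (hd x (hsub x hx)) (hne x hx)) ?_ (fun x hx => ?_)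
    · exact (hc.mono hsub).div (by fun_prop) hne
    · have hx0 := hsub x hx
      refine div_nonpos_of_nonpos_of_nonneg ?_ (sq_nonneg _)
      rw [hN x hx0]
      nlinarith [mul_nonneg (hρ x hx0) (hv x hx0)]
  simp only [sub_zero] at hle
  have h := ge_of_tendsto hlim ((eventually_lt_atBot ξ).mono hle)
  rw [div_le_iff_of_neg hξ] at h
  linarith

/-- Ahead of the initial cars the potential is the one of the constant initial state. -/
lemma potential_eq_of_ahead {N ρ f : ℝ → ℝ} {a r₀ M c c' : ℝ}
    (hca : c ≤ a) (hcc' : c' ≤ c) (hc : ContinuousOn N (Ioi a))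
    (hd : ∀ ξ > a, HasDerivWithinAt N (-ρ ξ) (Ici ξ) ξ)
    (hN : ∀ ξ > a, N ξ = f (ρ ξ) - ξ * ρ ξ) (hρ : ∀ ξ > a, 0 ≤ ρ ξ ∧ ρ ξ ≤ M)
    (hf : ∀ r, 0 ≤ r → r ≤ r₀ → a * (r - r₀) ≤ f r - f r₀)
    (hsuper : ∀ r, 0 ≤ r → f r ≤ f r₀ + c * (r - r₀))
    (hchord : ∀ r, r₀ ≤ r → r ≤ M → f r₀ + c' * (r - r₀) ≤ f r)
    (hlim : Tendsto (fun ξ => N ξ / ξ) atTop (𝓝 (-r₀))) :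
    ∀ ξ > a, N ξ = f r₀ - ξ * r₀ := by
  set D : ℝ → ℝ := fun ξ => N ξ - (f r₀ - ξ * r₀) with hD
  have hDc : ContinuousOn D (Ioi a) := hc.sub (by fun_prop)
  have hDd : ∀ ξ > a, HasDerivWithinAt D (r₀ - ρ ξ) (Ici ξ) ξ := by
    intro ξ hξ
    have := (hd ξ hξ).sub (((hasDerivWithinAt_id ξ (Ici ξ)).mul_const r₀).const_sub (f r₀))
    refine this.congr_deriv ?_
    ring
  have hDlim : Tendsto (fun ξ => D ξ / ξ) atTop (𝓝 0) := by
    have h1 : Tendsto (fun ξ : ℝ => f r₀ * ξ⁻¹ - r₀) atTop (𝓝 (-r₀)) := by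
      simpa using (tendsto_inv_atTop_zero.const_mul (f r₀)).sub_const r₀
    have h2 := hlim.sub h1
    rw [sub_self] at h2
    refine h2.congr' ?_
    filter_upwards [eventually_gt_atTop 0] with ξ hξ
    simp only [hD]
    field_simp
  have hlims : ∀ k, Tendsto (fun ξ => D ξ / (ξ - k)) atTop (𝓝 0) := fun k =>
    tendsto_div_sub tendsto_inv_atTop_zero ((eventually_gt_atTop 0).mono fun y hy => hy.ne')
      hDlim k
  have hDle : ∀ ξ > a, D ξ ≤ 0 := by
    intro ξ hξ
    -- The numerator of the derivative is `f r₀ + c (ρ - r₀) - f ρ`, nonnegative because the line of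
    -- slope `c` through `r₀` lies above `f`.
    have hle : ∀ y > ξ, D ξ / (ξ - c) ≤ D y / (y - c) := by
      intro y hy
      have hsub : ∀ x ∈ Icc ξ y, a < x := fun x hx => lt_of_lt_of_le hξ hx.1
      have hne : ∀ x ∈ Icc ξ y, x - c ≠ 0 := fun x hx => by
        have := hsub x hx
        exact (by linarith : 0 < x - c).ne'
      refine le_of_rightDeriv_nonneg (f := fun x => D x / (x - c)) hy.le
        (fun x hx => hasDerivWithinAt_div_sub (hDd x (hsub x hx)) (hne x hx)) ?_ (fun x hx => ?_)
      · exact (hDc.mono hsub).div (by fun_prop) hne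
      · have hx0 := hsub x hx
        refine div_nonneg ?_ (sq_nonneg _)
        simp only [hD]
        rw [hN x hx0]
        have := hsuper _ (hρ x hx0).1
        linarith
    have h := ge_of_tendsto (hlims c) ((eventually_gt_atTop ξ).mono hle)
    by_contra h'
    exact absurd h (not_le.2 (div_pos (not_le.1 h') (by linarith)))
  -- If `ρ < r₀`, then `hf` gives `D ≥ (ξ - a)(r₀ - ρ) > 0`.
  have hρr : ∀ ξ > a, r₀ ≤ ρ ξ := by
    intro ξ hξ
    by_contra h
    have h1 := hDle ξ hξ
    simp only [hD] at h1
    rw [hN ξ hξ] at h1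
    have h2 := hf _ (hρ ξ hξ).1 (not_le.1 h).le
    nlinarith [not_le.1 h]
  intro ξ hξ
  -- The reverse monotonicity uses a line of slope `c'` below `f`; that bound is available only for
  -- densities at least `r₀`, hence the previous step.
  have hle : ∀ y > ξ, D y / (y - c') ≤ D ξ / (ξ - c') := by
    intro y hy
    have hsub : ∀ x ∈ Icc ξ y, a < x := fun x hx => lt_of_lt_of_le hξ hx.1
    have hne : ∀ x ∈ Icc ξ y, x - c' ≠ 0 := fun x hx => by
      have := hsub x hx
      exact (by linarith : 0 < x - c').ne'
    refine le_of_rightDeriv_nonpos (f := fun x => D x / (x - c')) hy.le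
      (fun x hx => hasDerivWithinAt_div_sub (hDd x (hsub x hx)) (hne x hx)) ?_ (fun x hx => ?_)
    · exact (hDc.mono hsub).div (by fun_prop) hne
    · have hx0 := hsub x hx
      refine div_nonpos_of_nonpos_of_nonneg ?_ (sq_nonneg _)
      simp only [hD]
      rw [hN x hx0]
      have := hchord _ (hρr x hx0) (hρ x hx0).2
      linarith
  have h := le_of_tendsto (hlims c') ((eventually_gt_atTop ξ).mono hle)
  have h2 : 0 ≤ D ξ := by
    by_contra h'
    exact absurd h (not_le.2 (div_neg_of_neg_of_pos (not_le.1 h') (by linarith)))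
  have := le_antisymm (hDle ξ hξ) h2
  simp only [hD] at this
  linarith

/-! ### Comparison of entropy potentials -/

/-- `H` is the potential of an entropy solution of the scalar conservation law with flux `f`:
at every ray the one-sided densities `ρl ≤ ρr` are the negatives of the one-sided derivatives. -/
def IsEntropyPotential (f : ℝ → ℝ) (M : ℝ) (S : Set ℝ) (H : ℝ → ℝ) : Prop :=
  ∀ ξ ∈ S, ∃ ρl ρr, 0 ≤ ρl ∧ ρl ≤ ρr ∧ ρr ≤ M ∧
    HasDerivWithinAt H (-ρl) (Iic ξ) ξ ∧ HasDerivWithinAt H (-ρr) (Ici ξ) ξ ∧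
    H ξ = f ρl - ξ * ρl ∧ H ξ = f ρr - ξ * ρr

lemma leftDeriv_nonneg_of_isMax {g : ℝ → ℝ} {d a ξ : ℝ} (ha : a < ξ)
    (hg : HasDerivWithinAt g d (Iic ξ) ξ) (h : ∀ y ∈ Ioo a ξ, g y ≤ g ξ) : 0 ≤ d := by
  have h1 := (hasDerivWithinAt_iff_tendsto_slope' (by simp)).1 (hg.mono Iio_subset_Iic_self)
  refine ge_of_tendsto h1 ?_
  filter_upwards [Ioo_mem_nhdsLT ha] with y hy
  rw [slope_def_field]
  exact div_nonneg_of_nonpos (by linarith [h y hy]) (by linarith [hy.2])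

lemma rightDeriv_nonpos_of_isMax {g : ℝ → ℝ} {d b ξ : ℝ} (hb : ξ < b)
    (hg : HasDerivWithinAt g d (Ici ξ) ξ) (h : ∀ y ∈ Ioo ξ b, g y ≤ g ξ) : d ≤ 0 := by
  have h1 := (hasDerivWithinAt_iff_tendsto_slope' (by simp)).1 (hg.mono Ioi_subset_Ici_self)
  refine le_of_tendsto h1 ?_
  filter_upwards [Ioo_mem_nhdsGT hb] with y hy
  rw [slope_def_field]
  exact div_nonpos_of_nonpos_of_nonneg (by linarith [h y hy]) (by linarith [hy.1])

namespace IsEntropyPotential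

variable {f H₁ H₂ : ℝ → ℝ} {M a b : ℝ}

/-- At an interior maximum of `H₁ - H₂ + e ξ` the one-sided derivatives give `l₁ ≤ l₂ + e` and `r₂ +
e ≤ r₁`, so with `l₂ ≤ r₂` the point `l₂ + e` lies in `[l₁, r₁]`. The concave function `f ρ - ξ ρ`
equals `H₁ ξ` at both ends of this interval, hence is at least `H₁ ξ` at `l₂ + e`. Subtracting `H₂ ξ
= f l₂ - ξ l₂` leaves `f (l₂ + e) - f l₂`. -/
lemma sub_add_le (hf : ConcaveOn ℝ (Ici 0) f) (hc₁ : ContinuousOn H₁ (Icc a b))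
    (hc₂ : ContinuousOn H₂ (Icc a b)) (h₁ : IsEntropyPotential f M (Ioo a b) H₁)
    (h₂ : IsEntropyPotential f M (Ioo a b) H₂) {e B : ℝ}
    (ha : H₁ a - H₂ a + e * a ≤ B) (hb : H₁ b - H₂ b + e * b ≤ B)
    (hB : ∀ x, 0 ≤ x → x ≤ M → f (x + e) - f x ≤ B) :
    ∀ ξ ∈ Icc a b, H₁ ξ - H₂ ξ + e * ξ ≤ B := by
  intro ξ₀ hξ₀
  obtain ⟨ξ, hξ, hmax⟩ := isCompact_Icc.exists_isMaxOn ⟨ξ₀, hξ₀⟩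
    (f := fun ξ => H₁ ξ - H₂ ξ + e * ξ) ((hc₁.sub hc₂).add (by fun_prop))
  have hmax' : ∀ y ∈ Icc a b, H₁ y - H₂ y + e * y ≤ H₁ ξ - H₂ ξ + e * ξ := fun y hy => hmax hy
  refine (hmax' ξ₀ hξ₀).trans ?_
  rcases eq_or_lt_of_le hξ.1 with rfl | haξ
  · exact ha
  rcases eq_or_lt_of_le hξ.2 with rfl | hξb
  · exact hb
  obtain ⟨l₁, r₁, hl₁, hlr₁, hr₁, dl₁, dr₁, el₁, er₁⟩ := h₁ ξ ⟨haξ, hξb⟩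
  obtain ⟨l₂, r₂, hl₂, hlr₂, hr₂, dl₂, dr₂, el₂, er₂⟩ := h₂ ξ ⟨haξ, hξb⟩
  have d1 := leftDeriv_nonneg_of_isMax haξ
    ((dl₁.sub dl₂).add ((hasDerivWithinAt_id ξ (Iic ξ)).const_mul e))
    (fun y hy => hmax' y ⟨hy.1.le, (hy.2.trans hξb).le⟩)
  have d2 := rightDeriv_nonpos_of_isMax hξb
    ((dr₁.sub dr₂).add ((hasDerivWithinAt_id ξ (Ici ξ)).const_mul e))
    (fun y hy => hmax' y ⟨(haξ.trans hy.1).le, hy.2.le⟩)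
  have g1 : ConcaveOn ℝ (Ici 0) fun ρ => f ρ - ξ * ρ := by
    refine hf.sub ?_
    exact ((LinearMap.mul ℝ ℝ ξ).convexOn (convex_Ici 0))
  have hmem : l₂ + e ∈ Icc l₁ r₁ := ⟨by linarith, by linarith⟩
  have h3 := g1.min_le_of_mem_Icc (show l₁ ∈ Ici 0 from hl₁)
    (show r₁ ∈ Ici 0 from hl₁.trans hlr₁) hmem
  simp only [← el₁, ← er₁, min_self] at h3
  have h4 := hB l₂ hl₂ (hlr₂.trans hr₂)
  linarith

lemma eqOn_Icc (hf : ConcaveOn ℝ (Ici 0) f) (hc₁ : ContinuousOn H₁ (Icc a b))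
    (hc₂ : ContinuousOn H₂ (Icc a b)) (h₁ : IsEntropyPotential f M (Ioo a b) H₁)
    (h₂ : IsEntropyPotential f M (Ioo a b) H₂) (ha : H₁ a = H₂ a) (hb : H₁ b = H₂ b) :
    EqOn H₁ H₂ (Icc a b) := by
  intro ξ hξ
  have k1 := sub_add_le hf hc₁ hc₂ h₁ h₂ (e := 0) (B := 0) (by simp [ha]) (by simp [hb])
    (by simp) ξ hξ
  have k2 := sub_add_le hf hc₂ hc₁ h₂ h₁ (e := 0) (B := 0) (by simp [ha]) (by simp [hb])
    (by simp) ξ hξ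
  linarith

/-- On a half-line only `(H₁ - H₂) / ξ → 0` is known at infinity. A small tilt `e ξ` makes the
comparison work at a far endpoint; its cost is controlled by uniform continuity of `f` and vanishes
with `δ`. -/
lemma le_on_Iio (hf : ConcaveOn ℝ (Ici 0) f) (hfc : ContinuousOn f (Ici 0))
    (hc₁ : ContinuousOn H₁ (Iic 0)) (hc₂ : ContinuousOn H₂ (Iic 0))
    (h₁ : IsEntropyPotential f M (Iio 0) H₁) (h₂ : IsEntropyPotential f M (Iio 0) H₂)
    (h0 : H₁ 0 = H₂ 0) {ρ₀ : ℝ} (hl₁ : Tendsto (fun ξ => H₁ ξ / ξ) atBot (𝓝 (-ρ₀)))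
    (hl₂ : Tendsto (fun ξ => H₂ ξ / ξ) atBot (𝓝 (-ρ₀))) :
    ∀ ξ < 0, H₁ ξ ≤ H₂ ξ := by
  intro ξ₀ hξ₀
  have key : ∀ δ > 0, H₁ ξ₀ - H₂ ξ₀ ≤ δ * (1 - ξ₀) := by
    intro δ hδ
    have huc : UniformContinuousOn f (Icc 0 (M + 1)) :=
      isCompact_Icc.uniformContinuousOn_of_continuous (hfc.mono Icc_subset_Ici_self)
    obtain ⟨e₀, he₀, huc'⟩ := Metric.uniformContinuousOn_iff.1 huc δ hδ
    -- The three bounds give closeness of `f (x + e)` to `f x`, keep `x + e` in `[0, M + 1]`, and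
    -- make the tilt cost at most `δ |ξ₀|`.
    set e := min (min (e₀ / 2) 1) δ with he
    have hepos : 0 < e := by positivity
    have he1 : e ≤ 1 := (min_le_left _ _).trans (min_le_right _ _)
    have hee₀ : e < e₀ := lt_of_le_of_lt ((min_le_left _ _).trans (min_le_left _ _)) (by linarith)
    have heδ : e ≤ δ := min_le_right _ _
    have hlim := hl₁.sub hl₂
    rw [sub_self] at hlim
    have hev : ∀ᶠ L in atBot, -e < H₁ L / L - H₂ L / L :=
      hlim.eventually (lt_mem_nhds (by linarith))
    obtain ⟨L, hL1, hL2⟩ := (hev.and (eventually_lt_atBot ξ₀)).exists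
    have hL0 : L < 0 := hL2.trans hξ₀
    have hLv : H₁ L - H₂ L + e * L ≤ δ := by
      rw [← sub_div, lt_div_iff_of_neg hL0] at hL1
      linarith
    have hsub : Icc L 0 ⊆ Iic 0 := Icc_subset_Iic_self
    have hsub' : Ioo L 0 ⊆ Iio 0 := Ioo_subset_Iio_self
    have := sub_add_le hf (hc₁.mono hsub) (hc₂.mono hsub) (fun ξ hξ => h₁ ξ (hsub' hξ))
      (fun ξ hξ => h₂ ξ (hsub' hξ)) hLv (by rw [h0]; simp [hδ.le]) (fun x hx hxM => by
        have := huc' (x + e) ⟨by linarith, by linarith⟩ x ⟨hx, by linarith⟩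
          (by rw [Real.dist_eq, add_sub_cancel_left, abs_of_pos hepos]; exact hee₀)
        rw [Real.dist_eq] at this
        exact (le_abs_self _).trans this.le) ξ₀ ⟨hL2.le, hξ₀.le⟩
    nlinarith
  by_contra h
  have hpos : 0 < H₁ ξ₀ - H₂ ξ₀ := by linarith [not_le.1 h]
  have h1 : 0 < 1 - ξ₀ := by linarith
  have := key ((H₁ ξ₀ - H₂ ξ₀) / (2 * (1 - ξ₀))) (by positivity)
  rw [show (H₁ ξ₀ - H₂ ξ₀) / (2 * (1 - ξ₀)) * (1 - ξ₀) = (H₁ ξ₀ - H₂ ξ₀) / 2 by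
    field_simp] at this
  linarith

end IsEntropyPotential

/-! ### Pressure laws and fluxes -/

namespace IsPressureLaw

variable {p : ℝ → ℝ}

lemma continuousOn_flux (hp : IsPressureLaw p) (w : ℝ) : ContinuousOn (flux p w) (Ici 0) :=
  continuousOn_id.mul (continuousOn_const.sub hp.continuousOn)

lemma strictConcaveOn_flux (hp : IsPressureLaw p) (w : ℝ) :
    StrictConcaveOn ℝ (Ici 0) (flux p w) := by
  have h1 : ConcaveOn ℝ (Ici 0) fun ρ : ℝ => w * ρ :=
    (LinearMap.mul ℝ ℝ w).concaveOn (convex_Ici 0)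
  have h2 := h1.add_strictConcaveOn hp.strictConvexOn.neg
  refine h2.congr fun ρ _ => ?_
  simp only [Pi.add_apply, Pi.neg_apply, flux]
  ring

lemma concaveOn_flux (hp : IsPressureLaw p) (w : ℝ) : ConcaveOn ℝ (Ici 0) (flux p w) :=
  (hp.strictConcaveOn_flux w).concaveOn

lemma pressure_nonneg (hp : IsPressureLaw p) {ρ : ℝ} (hρ : 0 ≤ ρ) : 0 ≤ p ρ := by
  rw [← hp.map_zero]
  exact hp.strictMonoOn.monotoneOn (self_mem_Ici) hρ hρ

lemma exists_pressure_eq (hp : IsPressureLaw p) {y : ℝ} (hy : 0 ≤ y) :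
    ∃ ρ, 0 ≤ ρ ∧ p ρ = y := by
  obtain ⟨R, hR, hRy⟩ := ((eventually_ge_atTop (0 : ℝ)).and
    (hp.tendsto_atTop.eventually_ge_atTop y)).exists
  obtain ⟨ρ, hρ, h⟩ := intermediate_value_Icc hR (hp.continuousOn.mono Icc_subset_Ici_self)
    (show y ∈ Icc (p 0) (p R) from ⟨by rw [hp.map_zero]; exact hy, hRy⟩)
  exact ⟨ρ, hρ.1, h⟩

lemma flux_zero (p : ℝ → ℝ) (w : ℝ) : flux p w 0 = 0 := by simp [flux]

lemma flux_nonneg_iff {w ρ : ℝ} (hρ : 0 < ρ) : 0 ≤ flux p w ρ ↔ 0 ≤ w - p ρ := by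
  rw [flux, mul_nonneg_iff_of_pos_left hρ]

lemma exists_maximizer (hp : IsPressureLaw p) {w : ℝ} (hw : 0 ≤ w) :
    ∃ σ, 0 ≤ σ ∧ ∀ ρ, 0 ≤ ρ → flux p w ρ ≤ flux p w σ := by
  obtain ⟨R, hR, hpR⟩ := hp.exists_pressure_eq hw
  obtain ⟨σ, hσ, hmax⟩ := isCompact_Icc.exists_isMaxOn (nonempty_Icc.2 hR)
    ((hp.continuousOn_flux w).mono Icc_subset_Ici_self)
  refine ⟨σ, hσ.1, fun ρ hρ => ?_⟩
  rcases le_total ρ R with h | h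
  · exact hmax ⟨hρ, h⟩
  · have h0 : flux p w 0 ≤ flux p w σ := hmax ⟨le_rfl, hR⟩
    rw [flux_zero] at h0
    refine le_trans ?_ h0
    have := hp.strictMonoOn.monotoneOn hR hρ h
    exact mul_nonpos_of_nonneg_of_nonpos hρ (by linarith)

lemma criticalDensity_spec (hp : IsPressureLaw p) {w : ℝ} (hw : 0 ≤ w) :
    0 ≤ criticalDensity p w ∧ ∀ ρ, 0 ≤ ρ → flux p w ρ ≤ flux p w (criticalDensity p w) := by
  obtain ⟨σ, hσ, hmax⟩ := hp.exists_maximizer hw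
  have : {σ | 0 ≤ σ ∧ ∀ ρ, 0 ≤ ρ → flux p w ρ ≤ flux p w σ} = {σ} := by
    ext σ'
    constructor
    · rintro ⟨h0, hm⟩
      exact (hp.strictConcaveOn_flux w).eq_of_isMaxOn (fun ρ hρ => hm ρ hρ) (fun ρ hρ => hmax ρ hρ)
        h0 hσ
    · rintro rfl
      exact ⟨hσ, hmax⟩
  rw [criticalDensity, this, csSup_singleton]
  exact ⟨hσ, hmax⟩

lemma flux_monotoneOn (hp : IsPressureLaw p) {w x y : ℝ} (hw : 0 ≤ w) (hx : 0 ≤ x) (hxy : x ≤ y)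
    (hy : y ≤ criticalDensity p w) : flux p w x ≤ flux p w y := by
  obtain ⟨h0, hm⟩ := hp.criticalDensity_spec hw
  have := (hp.concaveOn_flux w).min_le_of_mem_Icc (show x ∈ Ici 0 from hx)
    (show criticalDensity p w ∈ Ici 0 from h0) ⟨hxy, hy⟩
  rwa [min_eq_left (hm x hx)] at this

lemma flux_antitoneOn (hp : IsPressureLaw p) {w x y : ℝ} (hw : 0 ≤ w)
    (hx : criticalDensity p w ≤ x) (hxy : x ≤ y) : flux p w y ≤ flux p w x := by
  obtain ⟨h0, hm⟩ := hp.criticalDensity_spec hw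
  have hy : 0 ≤ y := h0.trans (hx.trans hxy)
  have := (hp.concaveOn_flux w).min_le_of_mem_Icc (show criticalDensity p w ∈ Ici 0 from h0)
    (show y ∈ Ici 0 from hy) ⟨hx, hxy⟩
  rwa [min_eq_right (hm y hy)] at this

lemma demand_nonneg (hp : IsPressureLaw p) {w ρ : ℝ} (hw : 0 ≤ w) (hρ : 0 ≤ ρ)
    (hv : 0 ≤ w - p ρ) : 0 ≤ demand p ρ w := by
  rw [demand]
  split_ifs
  · exact mul_nonneg hρ hv
  · rw [← flux_zero p w]
    exact (hp.criticalDensity_spec hw).2 0 le_rfl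

lemma supply_nonneg (hp : IsPressureLaw p) {w ρ : ℝ} (hw : 0 ≤ w) (hf : 0 ≤ flux p w ρ) :
    0 ≤ supply p ρ w := by
  rw [supply]
  split_ifs
  · rw [← flux_zero p w]
    exact (hp.criticalDensity_spec hw).2 0 le_rfl
  · exact hf

/-- These properties hold in the vacuum case as well: if `w - p ρ = v₀` has no solution, then `w <
v₀`, since `p` attains every nonnegative value. -/
lemma intermediateDensity_spec (hp : IsPressureLaw p) (w v₀ : ℝ) :
    0 ≤ intermediateDensity p w v₀ ∧
    flux p w (intermediateDensity p w v₀) = intermediateDensity p w v₀ * v₀ ∧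
    (∀ ρ, intermediateDensity p w v₀ ≤ ρ → w - p ρ ≤ v₀) ∧
    (0 < intermediateDensity p w v₀ → w - p (intermediateDensity p w v₀) = v₀) := by
  by_cases h : ∃ ρ, 0 ≤ ρ ∧ w - p ρ = v₀
  · have e : intermediateDensity p w v₀ = h.choose := by rw [intermediateDensity, dif_pos h]
    have hs := h.choose_spec
    rw [← e] at hs
    refine ⟨hs.1, by rw [flux, hs.2], fun ρ hρ => ?_, fun _ => hs.2⟩
    have := hp.strictMonoOn.monotoneOn hs.1 (hs.1.trans hρ) hρ
    linarith [hs.2]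
  · have e : intermediateDensity p w v₀ = 0 := by rw [intermediateDensity, dif_neg h]
    rw [e]
    refine ⟨le_rfl, by simp [flux], fun ρ hρ => ?_, fun h => absurd h (lt_irrefl _)⟩
    by_contra hlt
    rw [not_le] at hlt
    have hpn := hp.pressure_nonneg hρ
    obtain ⟨ρ', hρ', hpρ'⟩ := hp.exists_pressure_eq (y := w - v₀) (by linarith)
    exact h ⟨ρ', hρ', by linarith⟩

/-- A velocity that is nonnegative at the largest density is nonnegative. -/
lemma velocity_nonneg_of_le (hp : IsPressureLaw p) {w a b : ℝ} (ha : 0 ≤ a) (hab : a ≤ b)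
    (hb : 0 ≤ w - p b) : 0 ≤ w - p a := by
  have := hp.strictMonoOn.monotoneOn (show a ∈ Ici 0 from ha) (show b ∈ Ici 0 from ha.trans hab) hab
  linarith

lemma velocity_nonneg_of_flux_nonneg (hp : IsPressureLaw p) {w ρ : ℝ} (hw : 0 ≤ w) (hρ : 0 ≤ ρ)
    (hf : 0 ≤ flux p w ρ) : 0 ≤ w - p ρ := by
  rcases hρ.eq_or_lt with rfl | h
  · rw [hp.map_zero, sub_zero]; exact hw
  · exact (flux_nonneg_iff h).1 hf

end IsPressureLaw

lemma isPressureLaw_of_eq_rpow {p : ℝ → ℝ} {c γ : ℝ} (hc : 0 < c) (hγ : 1 ≤ γ)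
    (hp : ∀ ρ, 0 ≤ ρ → p ρ = c * ρ ^ γ) : IsPressureLaw p where
  map_zero := by rw [hp 0 le_rfl, Real.zero_rpow (by linarith), mul_zero]
  continuousOn := by
    refine ContinuousOn.congr (f := fun ρ => c * ρ ^ γ) ?_ hp
    exact continuousOn_const.mul
      (Real.continuous_rpow_const (by linarith)).continuousOn
  differentiableOn := by
    refine DifferentiableOn.congr (f := fun ρ => c * ρ ^ γ) ?_ fun ρ hρ => hp ρ (le_of_lt hρ)
    exact (differentiableOn_const c).mul
      ((Real.differentiable_rpow_const hγ).differentiableOn)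
  strictMonoOn := by
    intro x hx y hy hxy
    rw [hp x hx, hp y hy]
    exact mul_lt_mul_of_pos_left (Real.rpow_lt_rpow hx hxy (by linarith)) hc
  strictConvexOn := by
    -- The product `ρ p(ρ)` has exponent `γ + 1 > 1`, so strict convexity persists for `γ = 1`.
    have hs := strictConvexOn_rpow (p := γ + 1) (by linarith)
    have h : StrictConvexOn ℝ (Ici 0) fun ρ : ℝ => c * ρ ^ (γ + 1) := by
      refine ⟨hs.1, fun x hx y hy hxy a b ha hb hab => ?_⟩
      have := mul_lt_mul_of_pos_left (hs.2 hx hy hxy ha hb hab) hc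
      simp only [smul_eq_mul] at this ⊢
      linarith
    refine h.congr fun ρ hρ => ?_
    have hρ' : (0 : ℝ) ≤ ρ := hρ
    change c * ρ ^ (γ + 1) = ρ * p ρ
    rw [hp ρ hρ, Real.rpow_add_of_nonneg hρ' (by linarith) zero_le_one, Real.rpow_one]
    ring
  tendsto_atTop := by
    refine ((tendsto_rpow_atTop (by linarith : 0 < γ)).const_mul_atTop hc).congr' ?_
    filter_upwards [eventually_ge_atTop 0] with ρ hρ
    exact (hp ρ hρ).symm

/-! ### The approximated homogenized pressure -/

section Homogenized

variable {n : ℕ} {p : ℝ → ℝ} {β w : Fin n → ℝ} {c γ : ℝ}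

lemma exists_weight_pos (hβ : ∀ i, 0 ≤ β i) (hβsum : ∑ i, β i = 1) : ∃ i, 0 < β i := by
  by_contra h
  have : ∑ i, β i = 0 := Finset.sum_eq_zero fun i _ =>
    le_antisymm (not_lt.1 fun h' => h ⟨i, h'⟩) (hβ i)
  linarith

lemma weighted_sum_lt {x y : Fin n → ℝ} (hβ : ∀ i, 0 ≤ β i) (hβsum : ∑ i, β i = 1)
    (h : ∀ i, x i < y i) : ∑ i, β i * x i < ∑ i, β i * y i := by
  obtain ⟨j, hj⟩ := exists_weight_pos hβ hβsum
  exact Finset.sum_lt_sum (fun i _ => mul_le_mul_of_nonneg_left (h i).le (hβ i))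
    ⟨j, Finset.mem_univ j, mul_lt_mul_of_pos_left (h j) hj⟩

lemma weighted_sum_pos {x : Fin n → ℝ} (hβ : ∀ i, 0 ≤ β i) (hβsum : ∑ i, β i = 1)
    (h : ∀ i, 0 < x i) : 0 < ∑ i, β i * x i := by
  simpa using weighted_sum_lt hβ hβsum (x := fun _ => 0) h

/-- A larger velocity means lower pressure, hence lower density and larger volume of every
component. Strict monotonicity lets the volume determine the velocity, which makes the homogenized
pressure well defined. -/
lemma IsMixtureVolume.lt (hp : IsPressureLaw p) (hβ : ∀ i, 0 ≤ β i) (hβsum : ∑ i, β i = 1)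
    {v₁ v₂ τ₁ τ₂ : ℝ} (h₁ : IsMixtureVolume p β w v₁ τ₁) (h₂ : IsMixtureVolume p β w v₂ τ₂)
    (hv : v₁ < v₂) : τ₁ < τ₂ := by
  obtain ⟨t₁, ht₁, rfl⟩ := h₁
  obtain ⟨t₂, ht₂, rfl⟩ := h₂
  refine weighted_sum_lt hβ hβsum fun i => ?_
  have h1 : p (1 / t₂ i) < p (1 / t₁ i) := by rw [(ht₁ i).2, (ht₂ i).2]; linarith
  have h2 := (hp.strictMonoOn.lt_iff_lt (one_div_pos.2 (ht₂ i).1).le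
    (one_div_pos.2 (ht₁ i).1).le).1 h1
  exact (one_div_lt_one_div (ht₂ i).1 (ht₁ i).1).1 h2

lemma IsMixtureVolume.velocity_unique (hp : IsPressureLaw p) (hβ : ∀ i, 0 ≤ β i)
    (hβsum : ∑ i, β i = 1) {v₁ v₂ τ : ℝ} (h₁ : IsMixtureVolume p β w v₁ τ)
    (h₂ : IsMixtureVolume p β w v₂ τ) : v₁ = v₂ := by
  rcases lt_trichotomy v₁ v₂ with h | h | h
  · exact absurd (h₁.lt hp hβ hβsum h₂ h) (lt_irrefl _)
  · exact h
  · exact absurd (h₂.lt hp hβ hβsum h₁ h) (lt_irrefl _)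

lemma exists_isHomogenizedPressure (hp : IsPressureLaw p) (hβ : ∀ i, 0 ≤ β i)
    (hβsum : ∑ i, β i = 1) : ∃ pstar, IsHomogenizedPressure p β w pstar := by
  classical
  -- Only the densities `1 / τ(v)` are prescribed; the default `0` elsewhere plays no role.
  refine ⟨fun r => if h : ∃ v, IsMixtureVolume p β w v (1 / r) then meanMarker β w - h.choose
    else 0, fun v τ hτ => ?_⟩
  have h : ∃ v, IsMixtureVolume p β w v (1 / (1 / τ)) := ⟨v, by rwa [one_div_one_div]⟩
  have hs := h.choose_spec
  simp only [dif_pos h]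
  rw [IsMixtureVolume.velocity_unique hp hβ hβsum hs (by rwa [one_div_one_div])]

/-- For a power law the specific volume at velocity zero is explicit. -/
lemma isMixtureVolume_zero_iff (hc : 0 < c) (hγ : 1 ≤ γ) (hp : ∀ ρ, 0 ≤ ρ → p ρ = c * ρ ^ γ)
    (hw : ∀ i, 0 < w i) (τ : ℝ) :
    IsMixtureVolume p β w 0 τ ↔ τ = c ^ (1 / γ) * ∑ i, β i / w i ^ (1 / γ) := by
  have hγ0 : γ ≠ 0 := by linarith
  have key : ∀ (t y : ℝ), 0 < y → 0 < t →
      (p (1 / t) = y ↔ t = c ^ (1 / γ) / y ^ (1 / γ)) := by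
    intro t y hy ht
    rw [hp _ (one_div_pos.2 ht).le, Real.div_rpow zero_le_one ht.le, Real.one_rpow,
      ← Real.div_rpow hc.le hy.le]
    have htγ : 0 < t ^ γ := Real.rpow_pos_of_pos ht γ
    constructor
    · intro h
      have : c / y = t ^ γ := by
        rw [← h]; field_simp
      rw [this, ← Real.rpow_mul ht.le, mul_one_div_cancel hγ0, Real.rpow_one]
    · intro h
      have : t ^ γ = c / y := by
        rw [h, ← Real.rpow_mul (div_pos hc hy).le, one_div_mul_cancel hγ0, Real.rpow_one]
      rw [this]; field_simp
  have hsum : c ^ (1 / γ) * ∑ i, β i / w i ^ (1 / γ) =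
      ∑ i, β i * (c ^ (1 / γ) / w i ^ (1 / γ)) := by
    rw [Finset.mul_sum]
    exact Finset.sum_congr rfl fun i _ => by ring
  rw [hsum]
  constructor
  · rintro ⟨ts, hts, rfl⟩
    refine Finset.sum_congr rfl fun i _ => ?_
    have h := (hts i).2
    rw [sub_zero] at h
    rw [(key _ _ (hw i) (hts i).1).1 h]
  · rintro rfl
    have hpos : ∀ i, 0 < c ^ (1 / γ) / w i ^ (1 / γ) := fun i =>
      div_pos (Real.rpow_pos_of_pos hc _) (Real.rpow_pos_of_pos (hw i) _)
    exact ⟨_, fun i => ⟨hpos i, by rw [sub_zero]; exact (key _ _ (hw i) (hpos i)).2 rfl⟩, rfl⟩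

/-- The coefficient of the approximated homogenized pressure of a power law. -/
def approxCoeff (β w : Fin n → ℝ) (c γ : ℝ) : ℝ :=
  c * (∑ i, β i * w i * (∑ l, β l / (w l) ^ (1 / γ)) ^ γ)

lemma approxCoeff_eq : approxCoeff β w c γ =
    c * (meanMarker β w * (∑ l, β l / (w l) ^ (1 / γ)) ^ γ) := by
  rw [approxCoeff, meanMarker, Finset.sum_mul]

lemma meanMarker_pos (hβ : ∀ i, 0 ≤ β i) (hβsum : ∑ i, β i = 1) (hw : ∀ i, 0 < w i) :
    0 < meanMarker β w := weighted_sum_pos hβ hβsum hw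

lemma volume_factor_pos (hβ : ∀ i, 0 ≤ β i) (hβsum : ∑ i, β i = 1) (hw : ∀ i, 0 < w i) :
    0 < ∑ l, β l / (w l) ^ (1 / γ) := by
  simp only [div_eq_mul_inv]
  exact weighted_sum_pos hβ hβsum fun i => inv_pos.2 (Real.rpow_pos_of_pos (hw i) _)

lemma approxCoeff_pos (hc : 0 < c) (hβ : ∀ i, 0 ≤ β i) (hβsum : ∑ i, β i = 1)
    (hw : ∀ i, 0 < w i) : 0 < approxCoeff β w c γ := by
  rw [approxCoeff_eq]
  exact mul_pos hc (mul_pos (meanMarker_pos hβ hβsum hw)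
    (Real.rpow_pos_of_pos (volume_factor_pos hβ hβsum hw) _))

/-- At `v = 0` the homogenized pressure equals the mean marker, so a multiple of `ρ ^ γ` agreeing
with it at `1 / τ` must have coefficient `meanMarker β w * τ ^ γ`, where `τ ^ γ = c * S ^ γ`. -/
lemma isApproxHomogenizedPressure_iff (hc : 0 < c) (hγ : 1 ≤ γ)
    (hp : ∀ ρ, 0 ≤ ρ → p ρ = c * ρ ^ γ) (hβ : ∀ i, 0 ≤ β i) (hβsum : ∑ i, β i = 1)
    (hw : ∀ i, 0 < w i) (P : ℝ → ℝ) :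
    IsApproxHomogenizedPressure p β w P ↔ ∀ ρ, 0 ≤ ρ → P ρ = approxCoeff β w c γ * ρ ^ γ := by
  have hpl := isPressureLaw_of_eq_rpow hc hγ hp
  have hγ0 : γ ≠ 0 := by linarith
  set S := ∑ l, β l / (w l) ^ (1 / γ) with hS
  have hSpos : 0 < S := volume_factor_pos hβ hβsum hw
  set τ := c ^ (1 / γ) * S with hτ
  have hτpos : 0 < τ := mul_pos (Real.rpow_pos_of_pos hc _) hSpos
  have hτv : IsMixtureVolume p β w 0 τ := (isMixtureVolume_zero_iff hc hγ hp hw τ).2 rfl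
  have hτγ : τ ^ γ = c * S ^ γ := by
    rw [hτ, Real.mul_rpow (Real.rpow_pos_of_pos hc _).le hSpos.le, ← Real.rpow_mul hc.le,
      one_div_mul_cancel hγ0, Real.rpow_one]
  have hcoef : approxCoeff β w c γ = meanMarker β w * τ ^ γ := by
    rw [approxCoeff_eq, hτγ]; ring
  have hτγpos : 0 < τ ^ γ := Real.rpow_pos_of_pos hτpos _
  have hinv : (1 / τ) ^ γ = 1 / τ ^ γ := by
    rw [Real.div_rpow zero_le_one hτpos.le, Real.one_rpow]
  constructor
  · rintro ⟨⟨k, hk⟩, pstar, hstar, τ', hτ', hP⟩ ρ hρ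
    have e : τ' = τ := (isMixtureVolume_zero_iff hc hγ hp hw τ').1 hτ'
    subst e
    rw [hstar 0 _ hτ', sub_zero, hk _ (one_div_pos.2 hτpos).le, hp _ (one_div_pos.2 hτpos).le,
      hinv] at hP
    rw [hk ρ hρ, hp ρ hρ, hcoef, ← hP]
    field_simp
  · intro hP
    obtain ⟨pstar, hstar⟩ := exists_isHomogenizedPressure (w := w) hpl hβ hβsum
    refine ⟨⟨approxCoeff β w c γ / c, fun ρ hρ => ?_⟩, pstar, hstar, τ, hτv, ?_⟩
    · rw [hP ρ hρ, hp ρ hρ]; field_simp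
    · rw [hstar 0 τ hτv, sub_zero, hP _ (one_div_pos.2 hτpos).le, hinv, hcoef]
      field_simp

end Homogenized

/-! ### The maximal flux through the junction -/

section Congruence

variable {p p' : ℝ → ℝ} {w ρ v₀ : ℝ}

/-- The approximated pressure is pinned down only for `ρ ≥ 0`. These congruences show that fluxes,
supply and the coupling rules do not see its values at negative arguments. -/
lemma flux_congr (h : ∀ ρ, 0 ≤ ρ → p ρ = p' ρ) (hρ : 0 ≤ ρ) : flux p w ρ = flux p' w ρ := by
  rw [flux, flux, h ρ hρ]

lemma criticalDensity_congr (h : ∀ ρ, 0 ≤ ρ → p ρ = p' ρ) :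
    criticalDensity p w = criticalDensity p' w := by
  have : {σ | 0 ≤ σ ∧ ∀ ρ, 0 ≤ ρ → flux p w ρ ≤ flux p w σ} =
      {σ | 0 ≤ σ ∧ ∀ ρ, 0 ≤ ρ → flux p' w ρ ≤ flux p' w σ} := by
    ext σ
    refine and_congr_right fun hσ => forall₂_congr fun ρ hρ => ?_
    rw [flux_congr h hσ, flux_congr h hρ]
  rw [criticalDensity, criticalDensity, this]

lemma intermediateDensity_congr (h : ∀ ρ, 0 ≤ ρ → p ρ = p' ρ) :
    intermediateDensity p w v₀ = intermediateDensity p' w v₀ := by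
  classical
  have key : ∀ Q Q' : ℝ → Prop, Q = Q' →
      (if h : ∃ ρ, Q ρ then h.choose else (0 : ℝ)) =
        (if h : ∃ ρ, Q' ρ then h.choose else (0 : ℝ)) := by
    rintro Q _ rfl; rfl
  have := key (fun ρ => 0 ≤ ρ ∧ w - p ρ = v₀) (fun ρ => 0 ≤ ρ ∧ w - p' ρ = v₀) (by
    ext ρ
    exact and_congr_right fun hρ => by rw [h ρ hρ])
  unfold intermediateDensity
  convert this

lemma supply_congr (h : ∀ ρ, 0 ≤ ρ → p ρ = p' ρ) (hp : IsPressureLaw p) (hw : 0 ≤ w)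
    (hρ : 0 ≤ ρ) : supply p ρ w = supply p' ρ w := by
  rw [supply, supply, ← criticalDensity_congr h, ← flux_congr h hρ,
    ← flux_congr h (hp.criticalDensity_spec hw).1]

end Congruence

section MaximalFlux

variable {n : ℕ} {J : MergeJunction n} {P : ℝ → ℝ}

/-- Since the priorities sum to one, `z` is the total flux: feasibility is a one-parameter problem,
and a maximizer is determined by its sum. -/
lemma IsFeasibleFlux.eq_sum_mul {q : Fin n → ℝ} (h : IsFeasibleFlux J P q)
    (hβsum : ∑ i, J.β i = 1) (i : Fin n) : q i = (∑ k, q k) * J.β i := by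
  obtain ⟨z, hz⟩ := h.mixture
  have : ∑ k, q k = z := by
    rw [Finset.sum_congr rfl fun k _ => hz k, ← Finset.mul_sum, hβsum, mul_one]
  rw [this, hz i]

lemma exists_isMaximalFlux (hβsum : ∑ i, J.β i = 1) (hβ : ∀ i, 0 ≤ J.β i)
    (hd : ∀ i, 0 ≤ demand (J.pIn i) (J.ρIn i) (J.wIn i))
    (hs : 0 ≤ supply P (intermediateDensity P (meanMarker J.β J.wIn) J.vOut)
      (meanMarker J.β J.wIn)) : ∃ q, IsMaximalFlux J P q := by
  set s := supply P (intermediateDensity P (meanMarker J.β J.wIn) J.vOut) (meanMarker J.β J.wIn)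
  set Z : Set ℝ := Icc 0 s ∩ ⋂ i, {z | z * J.β i ≤ demand (J.pIn i) (J.ρIn i) (J.wIn i)} with hZ
  have hZc : IsCompact Z := by
    refine isCompact_Icc.inter_right (isClosed_iInter fun i => ?_)
    exact isClosed_le (by fun_prop) continuous_const
  have hZn : Z.Nonempty := ⟨0, ⟨le_rfl, hs⟩, mem_iInter.2 fun i => by simpa using hd i⟩
  obtain ⟨z, hz, hmax⟩ := hZc.exists_isGreatest hZn
  have hsum : ∑ i, z * J.β i = z := by rw [← Finset.mul_sum, hβsum, mul_one]
  refine ⟨fun i => z * J.β i, ⟨fun i => ⟨mul_nonneg hz.1.1 (hβ i), mem_iInter.1 hz.2 i⟩, ?_,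
    ⟨z, fun i => rfl⟩⟩, fun q' hq' => ?_⟩
  · rw [hsum]; exact hz.1
  · rw [hsum]
    refine hmax ⟨hq'.supply_bound, mem_iInter.2 fun i => ?_⟩
    have := (hq'.demand_bound i).2
    rwa [hq'.eq_sum_mul hβsum i] at this

lemma IsMaximalFlux.unique (hβsum : ∑ i, J.β i = 1) {q q' : Fin n → ℝ}
    (h : IsMaximalFlux J P q) (h' : IsMaximalFlux J P q') : q = q' := by
  have e : ∑ i, q i = ∑ i, q' i := le_antisymm (h'.2 q h.1) (h.2 q' h'.1)
  ext i
  rw [h.1.eq_sum_mul hβsum i, h'.1.eq_sum_mul hβsum i, e]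

lemma IsMaximalFlux.congr {P' : ℝ → ℝ} (hP : IsPressureLaw P) (h : ∀ ρ, 0 ≤ ρ → P ρ = P' ρ)
    (hw : 0 ≤ meanMarker J.β J.wIn) {q : Fin n → ℝ}
    (hq : IsMaximalFlux J P' q) : IsMaximalFlux J P q := by
  have e : supply P (intermediateDensity P (meanMarker J.β J.wIn) J.vOut)
      (meanMarker J.β J.wIn) = supply P' (intermediateDensity P' (meanMarker J.β J.wIn) J.vOut)
      (meanMarker J.β J.wIn) := by
    rw [← intermediateDensity_congr h]
    exact supply_congr h hP hw (hP.intermediateDensity_spec _ _).1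
  refine ⟨⟨hq.1.demand_bound, ?_, hq.1.mixture⟩, fun q' hq' => hq.2 q' ⟨hq'.demand_bound, ?_,
    hq'.mixture⟩⟩
  · rw [e]; exact hq.1.supply_bound
  · rw [← e]; exact hq'.supply_bound

end MaximalFlux

/-! ### Elementary waves of a scalar conservation law -/

/-- `r` is the profile, with values in `[a, b]`, of a self-similar entropy solution of the scalar
conservation law with flux `f`, and `H` is its potential. -/
structure IsScalarProfile (f : ℝ → ℝ) (a b : ℝ) (C : Set ℝ) (r H : ℝ → ℝ) : Prop where
  countable : C.Countable
  mem_Icc : ∀ ξ, r ξ ∈ Icc a b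
  continuous : Continuous H
  hasDerivAt : ∀ ξ ∉ C, HasDerivAt H (-r ξ) ξ
  eq : ∀ ξ, H ξ = f (r ξ) - ξ * r ξ
  continuousAt : ∀ ξ ∉ C, ContinuousAt r ξ
  sided : ∀ ξ, ∃ rl rr, rl ∈ Icc a b ∧ rr ∈ Icc a b ∧ rl ≤ rr ∧
    Tendsto r (𝓝[<] ξ) (𝓝 rl) ∧ Tendsto r (𝓝[>] ξ) (𝓝 rr)

/-- The rarefaction fan, which takes values decreasing from `b` to `a`. -/
lemma exists_fan {f : ℝ → ℝ} {a b : ℝ} (hab : a ≤ b) (hfc : ContinuousOn f (Icc a b))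
    (hf : StrictConcaveOn ℝ (Icc a b) f) :
    ∃ r H, IsScalarProfile f a b ∅ r H ∧ ∀ ξ, ∀ ρ ∈ Icc a b, f ρ - ξ * ρ ≤ H ξ := by
  have hex : ∀ ξ : ℝ, ∃ ρ ∈ Icc a b, IsMaxOn (fun ρ => f ρ - ξ * ρ) (Icc a b) ρ := fun ξ =>
    isCompact_Icc.exists_isMaxOn (nonempty_Icc.2 hab) (hfc.sub (by fun_prop))
  choose r hr hmax using hex
  have hmax' : ∀ ξ, ∀ ρ ∈ Icc a b, f ρ - ξ * ρ ≤ f (r ξ) - ξ * r ξ := fun ξ ρ hρ => hmax ξ hρ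
  have huniq : ∀ ξ, ∀ y ∈ Icc a b, (∀ ρ ∈ Icc a b, f ρ - ξ * ρ ≤ f y - ξ * y) → y = r ξ := by
    intro ξ y hy hym
    have hs : StrictConcaveOn ℝ (Icc a b) fun ρ => f ρ - ξ * ρ := by
      have h1 : ConvexOn ℝ (Icc a b) fun ρ : ℝ => ξ * ρ :=
        (LinearMap.mul ℝ ℝ ξ).convexOn (convex_Icc a b)
      exact hf.sub_convexOn h1
    exact hs.eq_of_isMaxOn (fun ρ hρ => hym ρ hρ) (hmax ξ) hy (hr ξ)
  -- Compactness and uniqueness of the maximizer: every cluster point of nearby maximizers is again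
  -- a maximizer.
  have hrc : Continuous r := by
    refine continuous_iff_continuousAt.2 fun ξ => ?_
    refine isCompact_Icc.tendsto_nhds_of_unique_mapClusterPt (Eventually.of_forall hr)
      fun y hy hcl => huniq ξ y hy fun ρ hρ => ?_
    obtain ⟨l, hl, hly⟩ := mapClusterPt_iff_ultrafilter.1 hcl
    have hly' : Tendsto r l (𝓝[Icc a b] y) :=
      tendsto_nhdsWithin_iff.2 ⟨hly, Eventually.of_forall hr⟩
    have hid : Tendsto (fun η : ℝ => η) l (𝓝 ξ) := hl
    have h1 : Tendsto (fun η => f (r η) - η * r η) l (𝓝 (f y - ξ * y)) :=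
      ((hfc y hy).tendsto.comp hly').sub (hid.mul hly)
    have h2 : Tendsto (fun η => f ρ - η * ρ) l (𝓝 (f ρ - ξ * ρ)) :=
      tendsto_const_nhds.sub (hid.mul_const ρ)
    exact le_of_tendsto_of_tendsto' h2 h1 fun η => hmax' η ρ hρ
  set H : ℝ → ℝ := fun ξ => f (r ξ) - ξ * r ξ with hH
  -- Comparing the maximizers at `ξ` and `η` in both directions squeezes the first-order remainder
  -- between `0` and `(η - ξ)(r ξ - r η)`.
  have hHd : ∀ ξ, HasDerivAt H (-r ξ) ξ := by
    intro ξ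
    rw [hasDerivAt_iff_isLittleO, Asymptotics.isLittleO_iff]
    intro ε hε
    filter_upwards [Metric.continuousAt_iff'.1 hrc.continuousAt ε hε] with η hη
    have h1 := hmax' ξ (r η) (hr η)
    have h2 := hmax' η (r ξ) (hr ξ)
    rw [Real.dist_eq] at hη
    have h3 : 0 ≤ H η - H ξ - (η - ξ) * -r ξ := by simp only [hH]; linarith
    have h4 : H η - H ξ - (η - ξ) * -r ξ ≤ (η - ξ) * (r ξ - r η) := by simp only [hH]; linarith
    rw [smul_eq_mul, Real.norm_of_nonneg h3]
    refine h4.trans ((le_abs_self _).trans ?_)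
    rw [abs_mul, abs_sub_comm (r ξ), mul_comm, Real.norm_eq_abs]
    exact mul_le_mul_of_nonneg_right hη.le (abs_nonneg _)
  refine ⟨r, H, ⟨countable_empty, hr, ?_, fun ξ _ => hHd ξ, fun ξ => rfl,
    fun ξ _ => hrc.continuousAt, fun ξ => ⟨r ξ, r ξ, hr ξ, hr ξ, le_rfl, ?_, ?_⟩⟩, hmax'⟩
  · exact continuous_iff_continuousAt.2 fun ξ => (hHd ξ).continuousAt
  · exact (hrc.tendsto ξ).mono_left nhdsWithin_le_nhds
  · exact (hrc.tendsto ξ).mono_left nhdsWithin_le_nhds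

/-- The shock from `a` up to `b`, with the Rankine-Hugoniot speed `s`. -/
lemma exists_shock {f : ℝ → ℝ} {a b s : ℝ} (hab : a ≤ b) (hs : f b - f a = s * (b - a)) :
    ∃ r H, IsScalarProfile f a b {s} r H ∧ (∀ ξ < s, r ξ = a) ∧ (∀ ξ ≥ s, r ξ = b) ∧
      (∀ ξ ≤ s, H ξ = f a - ξ * a) ∧ ∀ ξ ≥ s, H ξ = f b - ξ * b := by
  set r : ℝ → ℝ := fun ξ => if ξ < s then a else b with hr
  -- The potentials of the two constant states are affine and cross at the Rankine-Hugoniot speed.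
  set H : ℝ → ℝ := fun ξ => min (f a - ξ * a) (f b - ξ * b) with hH
  have hr1 : ∀ ξ < s, r ξ = a := fun ξ hξ => if_pos hξ
  have hr2 : ∀ ξ ≥ s, r ξ = b := fun ξ hξ => if_neg (not_lt.2 hξ)
  have hH1 : ∀ ξ ≤ s, H ξ = f a - ξ * a := fun ξ hξ => min_eq_left (by nlinarith)
  have hH2 : ∀ ξ ≥ s, H ξ = f b - ξ * b := fun ξ hξ => min_eq_right (by nlinarith)
  have hd : ∀ c ξ : ℝ, HasDerivAt (fun ξ => f c - ξ * c) (-c) ξ := fun c ξ => by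
    simpa using ((hasDerivAt_id ξ).mul_const c).const_sub (f c)
  have ha : a ∈ Icc a b := left_mem_Icc.2 hab
  have hb : b ∈ Icc a b := right_mem_Icc.2 hab
  have el : ∀ ξ < s, r =ᶠ[𝓝 ξ] fun _ => a := fun ξ hξ => by
    filter_upwards [Iio_mem_nhds hξ] with y hy using hr1 y hy
  have er : ∀ ξ > s, r =ᶠ[𝓝 ξ] fun _ => b := fun ξ hξ => by
    filter_upwards [Ioi_mem_nhds hξ] with y hy using hr2 y (le_of_lt hy)
  refine ⟨r, H, ⟨countable_singleton s, ?_, by fun_prop, ?_, ?_, ?_, ?_⟩, hr1, hr2, hH1, hH2⟩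
  · intro ξ
    rcases lt_or_ge ξ s with h | h
    · rw [hr1 ξ h]; exact ha
    · rw [hr2 ξ h]; exact hb
  · intro ξ hξ
    rcases lt_or_gt_of_ne hξ with h | h
    · rw [hr1 ξ h]
      refine (hd a ξ).congr_of_eventuallyEq ?_
      filter_upwards [Iio_mem_nhds h] with y hy using hH1 y (le_of_lt hy)
    · rw [hr2 ξ h.le]
      refine (hd b ξ).congr_of_eventuallyEq ?_
      filter_upwards [Ioi_mem_nhds h] with y hy using hH2 y (le_of_lt hy)
  · intro ξ
    rcases lt_or_ge ξ s with h | h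
    · rw [hr1 ξ h, hH1 ξ h.le]
    · rw [hr2 ξ h, hH2 ξ h]
  · intro ξ hξ
    rcases lt_or_gt_of_ne hξ with h | h
    · exact continuousAt_const.congr (el ξ h).symm
    · exact continuousAt_const.congr (er ξ h).symm
  · intro ξ
    rcases lt_trichotomy ξ s with h | rfl | h
    · have := (tendsto_const_nhds (x := a)).congr' (el ξ h).symm
      exact ⟨a, a, ha, ha, le_rfl, this.mono_left nhdsWithin_le_nhds,
        this.mono_left nhdsWithin_le_nhds⟩
    · refine ⟨a, b, ha, hb, hab, tendsto_const_nhds.congr' ?_, tendsto_const_nhds.congr' ?_⟩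
      · filter_upwards [self_mem_nhdsWithin] with y hy using (hr1 y hy).symm
      · filter_upwards [self_mem_nhdsWithin] with y hy using (hr2 y (le_of_lt hy)).symm
    · have := (tendsto_const_nhds (x := b)).congr' (er ξ h).symm
      exact ⟨b, b, hb, hb, le_rfl, this.mono_left nhdsWithin_le_nhds,
        this.mono_left nhdsWithin_le_nhds⟩

lemma tendsto_div_of_bounded {K : ℝ → ℝ} {k B : ℝ} (h : ∀ᶠ ξ in atBot, |K ξ - ξ * k| ≤ B) :
    Tendsto (fun ξ => K ξ / ξ) atBot (𝓝 k) := by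
  have h1 : Tendsto (fun ξ : ℝ => (K ξ - ξ * k) * ξ⁻¹) atBot (𝓝 0) := by
    refine bdd_le_mul_tendsto_zero' B h tendsto_inv_atBot_zero
  have h2 := h1.add_const k
  rw [zero_add] at h2
  refine h2.congr' ?_
  filter_upwards [eventually_lt_atBot 0] with ξ hξ
  have := hξ.ne
  field_simp
  ring

/-! ### The solutions on the two kinds of roads -/

section Waves

variable {p : ℝ → ℝ} {w : ℝ}

/-- On an incoming road every flux between zero and the demand is attained by a wave of
nonpositive speed. -/
lemma exists_incoming_profile (hp : IsPressureLaw p) (hw : 0 ≤ w) {ρ₀ q : ℝ} (hρ₀ : 0 ≤ ρ₀)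
    (hv₀ : 0 ≤ w - p ρ₀) (hq : 0 ≤ q) (hqd : q ≤ demand p ρ₀ w) :
    ∃ a b C r H, 0 ≤ a ∧ IsScalarProfile (flux p w) a b C r H ∧ 0 ≤ w - p b ∧ H 0 = q ∧
      Tendsto (fun ξ => H ξ / ξ) atBot (𝓝 (-ρ₀)) := by
  -- A fan from `ρ₀` to a smaller density `a` whose flux `q` is the largest on `[a, ρ₀]`; then `H
  -- 0`, the maximum of the flux there, equals `q`.
  have hfan : ∀ a, 0 ≤ a → a ≤ ρ₀ → flux p w a = q → (∀ ρ ∈ Icc a ρ₀, flux p w ρ ≤ q) →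
      ∃ a b C r H, 0 ≤ a ∧ IsScalarProfile (flux p w) a b C r H ∧ 0 ≤ w - p b ∧ H 0 = q ∧
        Tendsto (fun ξ => H ξ / ξ) atBot (𝓝 (-ρ₀)) := by
    intro a ha0 haρ haq hm
    have hsub : Icc a ρ₀ ⊆ Ici 0 := fun x hx => ha0.trans hx.1
    obtain ⟨r, H, hS, hmax⟩ := exists_fan haρ ((hp.continuousOn_flux w).mono hsub)
      ((hp.strictConcaveOn_flux w).subset hsub (convex_Icc a ρ₀))
    refine ⟨a, ρ₀, ∅, r, H, ha0, hS, hv₀, ?_, ?_⟩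
    · refine le_antisymm ?_ ?_
      · rw [hS.eq, zero_mul, sub_zero]; exact hm _ (hS.mem_Icc 0)
      · have := hmax 0 a (left_mem_Icc.2 haρ)
        rwa [zero_mul, sub_zero, haq] at this
    -- Maximality tested at `ρ₀` bounds `H ξ + ξ ρ₀` from below; the bounds `flux ≤ q` and `r ξ ≤
    -- ρ₀` with `ξ < 0` bound it from above.
    · refine tendsto_div_of_bounded (B := max q |flux p w ρ₀|) ?_
      filter_upwards [eventually_lt_atBot 0] with ξ hξ
      have h1 := hmax ξ ρ₀ (right_mem_Icc.2 haρ)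
      have h2 := hm _ (hS.mem_Icc ξ)
      have h3 := hS.eq ξ
      have h4 := (hS.mem_Icc ξ).2
      have h5 := le_max_left q |flux p w ρ₀|
      have h6 := le_max_right q |flux p w ρ₀|
      have h7 := neg_abs_le (flux p w ρ₀)
      rw [abs_le]
      constructor
      · linarith
      · nlinarith
  obtain ⟨hσ0, hσ⟩ := hp.criticalDensity_spec hw
  rcases lt_trichotomy q (flux p w ρ₀) with hlt | heq | hgt
  -- A flux below the initial one: a shock to a denser state `b`, found between `ρ₀` and the density
  -- `R` of zero velocity. Its speed is negative since the flux drops while the density rises.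
  · obtain ⟨R, hR, hpR⟩ := hp.exists_pressure_eq hw
    have hfR : flux p w R = 0 := by rw [flux, hpR, sub_self, mul_zero]
    have hρR : ρ₀ ≤ R := by
      by_contra h
      have := hp.strictMonoOn (show R ∈ Ici 0 from hR) (show ρ₀ ∈ Ici 0 from hρ₀) (not_le.1 h)
      linarith
    obtain ⟨b, hb, hbq⟩ := intermediate_value_Icc' hρR
      ((hp.continuousOn_flux w).mono fun x hx => hρ₀.trans hx.1)
      (show q ∈ Icc (flux p w R) (flux p w ρ₀) from ⟨by rw [hfR]; exact hq, hlt.le⟩)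
    have hbne : ρ₀ ≠ b := by
      rintro rfl; exact absurd hbq hlt.ne'
    have hbρ : 0 < b - ρ₀ := sub_pos.2 (lt_of_le_of_ne hb.1 hbne)
    set s := (flux p w b - flux p w ρ₀) / (b - ρ₀) with hs
    have hs0 : s < 0 := div_neg_of_neg_of_pos (by rw [hbq]; linarith) hbρ
    obtain ⟨r, H, hS, -, -, hH1, hH2⟩ := exists_shock (f := flux p w) (s := s) hb.1
      (by rw [hs]; field_simp)
    have hb0 : 0 ≤ b := hρ₀.trans hb.1
    refine ⟨ρ₀, b, {s}, r, H, hρ₀, hS,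
      hp.velocity_nonneg_of_flux_nonneg hw hb0 (by rw [hbq]; exact hq),
      ?_, ?_⟩
    · rw [hH2 0 hs0.le, zero_mul, sub_zero, hbq]
    · refine tendsto_div_of_bounded (B := |flux p w ρ₀|) ?_
      filter_upwards [eventually_lt_atBot s] with ξ hξ
      rw [hH1 ξ hξ.le]
      refine le_of_eq (congrArg abs ?_)
      ring
  · refine hfan ρ₀ hρ₀ le_rfl heq.symm fun ρ hρ => ?_
    rw [Icc_self, mem_singleton_iff] at hρ
    rw [hρ, heq]
  -- A larger flux is allowed by the demand only if the road is congested; a fan towards the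
  -- critical density then supplies it.
  · have hσρ : criticalDensity p w < ρ₀ := by
      by_contra h
      rw [demand, if_pos (not_lt.1 h)] at hqd
      linarith
    rw [demand, if_neg (not_le.2 hσρ)] at hqd
    obtain ⟨a, ha, haq⟩ := intermediate_value_Icc' hσρ.le
      ((hp.continuousOn_flux w).mono fun x hx => hσ0.trans hx.1)
      (show q ∈ Icc (flux p w ρ₀) (flux p w (criticalDensity p w)) from ⟨hgt.le, hqd⟩)
    refine hfan a (hσ0.trans ha.1) ha.2 haq fun ρ hρ => ?_
    rw [← haq]
    exact hp.flux_antitoneOn hw ha.1 hρ.1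

/-- Behind the initial cars of the outgoing road every flux between zero and the supply is attained
by a wave of nonnegative speed, at most `v₀`. -/
lemma exists_outgoing_profile (hp : IsPressureLaw p) (hw : 0 ≤ w) {v₀ q : ℝ} (hv₀ : 0 ≤ v₀)
    (hq : 0 ≤ q) (hqs : q ≤ supply p (intermediateDensity p w v₀) w) :
    ∃ a b C r H, 0 ≤ a ∧ IsScalarProfile (flux p w) a b C r H ∧ 0 ≤ w - p b ∧ H 0 = q ∧
      H v₀ = 0 := by
  obtain ⟨hρ₀, hfρ, hρle, hρeq⟩ := hp.intermediateDensity_spec w v₀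
  set ρ₀ := intermediateDensity p w v₀
  have hfan : ∀ b, ρ₀ ≤ b → flux p w b = q → (∀ ρ ∈ Icc ρ₀ b, flux p w ρ ≤ q) →
      ∃ a b C r H, 0 ≤ a ∧ IsScalarProfile (flux p w) a b C r H ∧ 0 ≤ w - p b ∧ H 0 = q ∧
        H v₀ = 0 := by
    intro b hb hbq hm
    have hsub : Icc ρ₀ b ⊆ Ici 0 := fun x hx => hρ₀.trans hx.1
    obtain ⟨r, H, hS, hmax⟩ := exists_fan hb ((hp.continuousOn_flux w).mono hsub)
      ((hp.strictConcaveOn_flux w).subset hsub (convex_Icc ρ₀ b))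
    refine ⟨ρ₀, b, ∅, r, H, hρ₀, hS,
      hp.velocity_nonneg_of_flux_nonneg hw (hρ₀.trans hb) (by rw [hbq]; exact hq), ?_, ?_⟩
    · refine le_antisymm ?_ ?_
      · rw [hS.eq, zero_mul, sub_zero]; exact hm _ (hS.mem_Icc 0)
      · have := hmax 0 b (right_mem_Icc.2 hb)
        rwa [zero_mul, sub_zero, hbq] at this
    -- Densities in the fan are at least `ρ₀`, so their velocities are at most `v₀` and `H v₀ ≤ 0`;
    -- the competitor `ρ₀` attains the value `0`.
    · refine le_antisymm ?_ ?_
      · rw [hS.eq, flux]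
        have h1 := (hS.mem_Icc v₀).1
        nlinarith [hρle _ h1]
      · have := hmax v₀ ρ₀ (left_mem_Icc.2 hb)
        rwa [hfρ, mul_comm, sub_self] at this
  obtain ⟨hσ0, hσ⟩ := hp.criticalDensity_spec hw
  rcases lt_trichotomy q (flux p w ρ₀) with hlt | heq | hgt
  · have hρpos : 0 < ρ₀ := by
      refine lt_of_le_of_ne hρ₀ fun h => ?_
      rw [← h, IsPressureLaw.flux_zero] at hlt
      linarith
    have hvρ := hρeq hρpos
    obtain ⟨a, ha, haq⟩ := intermediate_value_Icc hρ₀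
      ((hp.continuousOn_flux w).mono Icc_subset_Ici_self)
      (show q ∈ Icc (flux p w 0) (flux p w ρ₀) from
        ⟨by rw [IsPressureLaw.flux_zero]; exact hq, hlt.le⟩)
    have hane : a ≠ ρ₀ := by
      rintro rfl; exact absurd haq hlt.ne'
    have haρ : 0 < ρ₀ - a := sub_pos.2 (lt_of_le_of_ne ha.2 hane)
    set s := (flux p w ρ₀ - flux p w a) / (ρ₀ - a) with hs
    have hs0 : 0 < s := div_pos (by rw [haq]; linarith) haρ
    -- The lighter state `a` is at least as fast as `v₀`, so `ρ₀ v₀ - flux p w a ≤ v₀ (ρ₀ - a)`: the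
    -- shock stays behind the contact.
    have hsv : s ≤ v₀ := by
      rw [hs, div_le_iff₀ haρ, hfρ, flux]
      have := hp.strictMonoOn.monotoneOn (show a ∈ Ici 0 from ha.1)
        (show ρ₀ ∈ Ici 0 from hρ₀) ha.2
      nlinarith [ha.1]
    obtain ⟨r, H, hS, -, -, hH1, hH2⟩ := exists_shock (f := flux p w) (s := s) ha.2
      (by rw [hs]; field_simp)
    refine ⟨a, ρ₀, {s}, r, H, ha.1, hS, by rw [hvρ]; exact hv₀, ?_, ?_⟩
    · rw [hH1 0 hs0.le, zero_mul, sub_zero, haq]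
    · rw [hH2 v₀ hsv, hfρ, mul_comm, sub_self]
  · refine hfan ρ₀ le_rfl heq.symm fun ρ hρ => ?_
    rw [Icc_self, mem_singleton_iff] at hρ
    rw [hρ, heq]
  · have hρσ : ρ₀ ≤ criticalDensity p w := by
      by_contra h
      rw [supply, if_neg h] at hqs
      linarith
    rw [supply, if_pos hρσ] at hqs
    obtain ⟨b, hb, hbq⟩ := intermediate_value_Icc hρσ
      ((hp.continuousOn_flux w).mono fun x hx => hρ₀.trans hx.1)
      (show q ∈ Icc (flux p w ρ₀) (flux p w (criticalDensity p w)) from ⟨hgt.le, hqs⟩)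
    refine hfan b hb.1 hbq fun ρ hρ => ?_
    rw [← hbq]
    exact hp.flux_monotoneOn hw (hρ₀.trans hρ.1) hρ.2 hb.2

end Waves

/-! ### Profiles and potentials of the elementary waves -/

lemma tendsto_comp_of_nonneg {g r : ℝ → ℝ} {l : Filter ℝ} (hg : ContinuousOn g (Ici 0))
    (hr : ∀ᶠ ξ in l, 0 ≤ r ξ)
    {y : ℝ} (hy : 0 ≤ y) (h : Tendsto r l (𝓝 y)) : Tendsto (fun ξ => g (r ξ)) l (𝓝 (g y)) :=
  (hg y hy).tendsto.comp (tendsto_nhdsWithin_iff.2 ⟨h, hr⟩)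

namespace IsPotential

variable {D C C₁ C₂ : Set ℝ} {U F H U₁ F₁ H₁ U₂ F₂ H₂ : ℝ → ℝ} {v₀ : ℝ}

lemma mul_const (h : IsPotential D C U F H) (w : ℝ) :
    IsPotential D C (fun ξ => U ξ * w) (fun ξ => F ξ * w) (fun ξ => H ξ * w) where
  countable := h.countable
  continuousOn := h.continuousOn.mul continuousOn_const
  hasDerivAt ξ hξ := by
    have := (h.hasDerivAt ξ hξ).mul_const w
    rwa [neg_mul] at this
  eq ξ hξ := by rw [← h.eq ξ hξ]; ring

/-- Agreement of the potentials at `v₀` is the Rankine-Hugoniot condition on the contact ray; the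
densities and markers may jump freely. -/
lemma glue (h₁ : IsPotential D C₁ U₁ F₁ H₁) (h₂ : IsPotential D C₂ U₂ F₂ H₂)
    (hc₁ : Continuous H₁) (hc₂ : Continuous H₂) (hv : H₁ v₀ = H₂ v₀) :
    Continuous (fun ξ => if ξ < v₀ then H₁ ξ else H₂ ξ) ∧
    IsPotential D (C₁ ∪ C₂ ∪ {v₀}) (fun ξ => if ξ < v₀ then U₁ ξ else U₂ ξ)
      (fun ξ => if ξ < v₀ then F₁ ξ else F₂ ξ) (fun ξ => if ξ < v₀ then H₁ ξ else H₂ ξ) := by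
  have hc : Continuous (fun ξ => if ξ < v₀ then H₁ ξ else H₂ ξ) := by
    have h := Continuous.if_le hc₂ hc₁ continuous_const continuous_id
      (fun ξ (hξ : v₀ = ξ) => by rw [← hξ, hv])
    refine h.congr fun ξ => ?_
    simp only [id]
    by_cases hξ : ξ < v₀
    · rw [if_pos hξ, if_neg (not_le.2 hξ)]
    · rw [if_neg hξ, if_pos (not_lt.1 hξ)]
  refine ⟨hc, (h₁.countable.union h₂.countable).union (countable_singleton _), hc.continuousOn,
    ?_, ?_⟩
  · rintro ξ ⟨hξD, hξ⟩
    simp only [mem_union, mem_singleton_iff, not_or] at hξ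
    rcases lt_or_gt_of_ne hξ.2 with h | h
    · rw [if_pos h]
      refine (h₁.hasDerivAt ξ ⟨hξD, hξ.1.1⟩).congr_of_eventuallyEq ?_
      filter_upwards [Iio_mem_nhds h] with y hy using if_pos hy
    · rw [if_neg h.le.not_gt]
      refine (h₂.hasDerivAt ξ ⟨hξD, hξ.1.2⟩).congr_of_eventuallyEq ?_
      filter_upwards [Ioi_mem_nhds h] with y hy using if_neg (le_of_lt hy).not_gt
  · rintro ξ ⟨hξD, hξ⟩
    simp only [mem_union, mem_singleton_iff, not_or] at hξ
    rcases lt_or_gt_of_ne hξ.2 with h | h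
    · simp only [if_pos h]; exact h₁.eq ξ ⟨hξD, hξ.1.1⟩
    · simp only [if_neg h.le.not_gt]; exact h₂.eq ξ ⟨hξD, hξ.1.2⟩

end IsPotential

lemma continuousAt_ite {C₁ C₂ : Set ℝ} {g₁ g₂ : ℝ → ℝ} {v₀ ξ : ℝ}
    (h₁ : ∀ ξ ∉ C₁, ContinuousAt g₁ ξ) (h₂ : ∀ ξ ∉ C₂, ContinuousAt g₂ ξ)
    (hξ : ξ ∉ C₁ ∪ C₂ ∪ {v₀}) : ContinuousAt (fun ξ => if ξ < v₀ then g₁ ξ else g₂ ξ) ξ := by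
  simp only [mem_union, mem_singleton_iff, not_or] at hξ
  rcases lt_or_gt_of_ne hξ.2 with h | h
  · refine (h₁ ξ hξ.1.1).congr ?_
    filter_upwards [Iio_mem_nhds h] with y hy using (if_pos hy).symm
  · refine (h₂ ξ hξ.1.2).congr ?_
    filter_upwards [Ioi_mem_nhds h] with y hy using (if_neg (le_of_lt hy).not_gt).symm

lemma tendsto_flux_of_potential {U F H : ℝ → ℝ} {M : ℝ} (hH : Continuous H)
    (hU : ∀ ξ, |U ξ| ≤ M) (h : ∀ ξ, H ξ = F ξ - ξ * U ξ) : Tendsto F (𝓝 0) (𝓝 (H 0)) := by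
  have h1 : Tendsto (fun ξ => U ξ * ξ) (𝓝 0) (𝓝 0) :=
    bdd_le_mul_tendsto_zero' M (Eventually.of_forall hU) tendsto_id
  have h2 := (hH.tendsto 0).add h1
  rw [add_zero] at h2
  refine h2.congr fun ξ => ?_
  rw [h ξ]; ring

namespace IsScalarProfile

variable {p : ℝ → ℝ} {w a b : ℝ} {C : Set ℝ} {r H : ℝ → ℝ}

lemma isPotential (h : IsScalarProfile (flux p w) a b C r H) (D : Set ℝ) :
    IsPotential D C r (fun ξ => flux p w (r ξ)) H :=
  ⟨h.countable, h.continuous.continuousOn, fun ξ hξ => h.hasDerivAt ξ hξ.2,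
    fun ξ _ => (h.eq ξ).symm⟩

lemma nonneg (h : IsScalarProfile (flux p w) a b C r H) (ha : 0 ≤ a) (ξ : ℝ) : 0 ≤ r ξ :=
  ha.trans (h.mem_Icc ξ).1

lemma velocity_mem (h : IsScalarProfile (flux p w) a b C r H) (ha : 0 ≤ a) (hp : IsPressureLaw p)
    (hb : 0 ≤ w - p b) (ξ : ℝ) : 0 ≤ w - p (r ξ) ∧ w - p (r ξ) ≤ w :=
  ⟨hp.velocity_nonneg_of_le (h.nonneg ha ξ) (h.mem_Icc ξ).2 hb, by
    have := hp.pressure_nonneg (h.nonneg ha ξ)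
    linarith⟩

lemma abs_le (h : IsScalarProfile (flux p w) a b C r H) (ha : 0 ≤ a) (ξ : ℝ) : |r ξ| ≤ b := by
  rw [abs_of_nonneg (h.nonneg ha ξ)]; exact (h.mem_Icc ξ).2

lemma abs_flux_le (h : IsScalarProfile (flux p w) a b C r H) (ha : 0 ≤ a) (hp : IsPressureLaw p)
    (hb : 0 ≤ w - p b) (ξ : ℝ) : |flux p w (r ξ)| ≤ b * w := by
  obtain ⟨h1, h2⟩ := h.velocity_mem ha hp hb ξ
  have h3 := h.nonneg ha ξ
  rw [flux, abs_of_nonneg (mul_nonneg h3 h1)]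
  exact mul_le_mul (h.mem_Icc ξ).2 h2 h1 (h3.trans (h.mem_Icc ξ).2)

lemma continuousAt_flux (h : IsScalarProfile (flux p w) a b C r H) (ha : 0 ≤ a)
    (hp : IsPressureLaw p) {ξ : ℝ} (hξ : ξ ∉ C) : ContinuousAt (fun ξ => flux p w (r ξ)) ξ :=
  tendsto_comp_of_nonneg (hp.continuousOn_flux w) (Eventually.of_forall (h.nonneg ha))
    (h.nonneg ha ξ) (h.continuousAt ξ hξ)

lemma isAdmissibleAt (h : IsScalarProfile (flux p w) a b C r H) (ha : 0 ≤ a)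
    (hp : IsPressureLaw p) {U : RoadState} {ξ : ℝ} (hρ : ∀ᶠ y in 𝓝 ξ, U.ρ y 1 = r y)
    (hw : ∀ᶠ y in 𝓝 ξ, U.w y 1 = w) : IsAdmissibleAt p U ξ := by
  obtain ⟨rl, rr, hrl, hrr, hle, hl, hr⟩ := h.sided ξ
  refine ⟨rl, rr, w, w, hl.congr' ?_, hr.congr' ?_, tendsto_const_nhds.congr' ?_,
    tendsto_const_nhds.congr' ?_, ?_⟩
  · filter_upwards [nhdsWithin_le_nhds hρ] with y hy using hy.symm
  · filter_upwards [nhdsWithin_le_nhds hρ] with y hy using hy.symm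
  · filter_upwards [nhdsWithin_le_nhds hw] with y hy using hy.symm
  · filter_upwards [nhdsWithin_le_nhds hw] with y hy using hy.symm
  · have := hp.strictMonoOn.monotoneOn (show rl ∈ Ici 0 from ha.trans hrl.1)
      (show rr ∈ Ici 0 from ha.trans hrr.1) hle
    linarith

end IsScalarProfile

lemma rayIntegral_zero_congr {φ ψ : ℝ → ℝ → ℝ} (h : ∀ t, 0 ≤ t → φ 0 t = ψ 0 t) :
    rayIntegral φ 0 = rayIntegral ψ 0 := by
  refine setIntegral_congr_fun measurableSet_Ioi fun t ht => ?_
  simp only [zero_mul]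
  exact h t (le_of_lt ht)

/-! ### Existence of a network solution -/

/-- The state with density profile `r` and marker profile `m`. -/
def profileState (r m : ℝ → ℝ) : RoadState := ⟨fun x t => r (x / t), fun x t => m (x / t)⟩

section Incoming

variable {p : ℝ → ℝ} {w a b : ℝ} {C : Set ℝ} {r H : ℝ → ℝ}

lemma isRiemannState_incoming (h : IsScalarProfile (flux p w) a b C r H) (ha : 0 ≤ a)
    (hp : IsPressureLaw p) (hb : 0 ≤ w - p b) :
    IsRiemannState (Iio 0) (fun _ _ => p) (profileState r fun _ => w) where
  density_nonneg x _ t _ := h.nonneg ha _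
  velocity_nonneg x _ t _ := (h.velocity_mem ha hp hb _).1
  bounded := ⟨max b |w|, fun x _ t _ => ⟨(h.abs_le ha _).trans (le_max_left _ _), le_max_right _ _⟩⟩
  selfSimilar x _ t _ := by simp [profileState]

lemma isProfile_incoming (h : IsScalarProfile (flux p w) a b C r H) (ha : 0 ≤ a)
    (hp : IsPressureLaw p) (hb : 0 ≤ w - p b) (k : ℝ) :
    IsProfile (Iio 0) C (max (b * |k|) (b * w * |k|)) (fun x t => r (x / t) * k)
      (fun x t => r (x / t) * (w - p (r (x / t))) * k) (fun ξ => r ξ * k)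
      (fun ξ => flux p w (r ξ) * k) where
  countable := h.countable
  density x _ t _ := rfl
  flux x _ t _ := rfl
  continuousAt_density ξ hξ := (h.continuousAt ξ hξ.2).mul_const k
  continuousAt_flux ξ hξ := (h.continuousAt_flux ha hp hξ.2).mul_const k
  bound_density ξ _ := by
    rw [abs_mul]
    exact (mul_le_mul_of_nonneg_right (h.abs_le ha ξ) (abs_nonneg k)).trans (le_max_left _ _)
  bound_flux ξ _ := by
    rw [abs_mul]
    exact (mul_le_mul_of_nonneg_right (h.abs_flux_le ha hp hb ξ) (abs_nonneg k)).trans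
      (le_max_right _ _)
  bound_nonneg := by
    have : 0 ≤ b := (h.nonneg ha 0).trans (h.mem_Icc 0).2
    positivity

lemma weakForm_incoming (h : IsScalarProfile (flux p w) a b C r H) (ha : 0 ≤ a)
    (hp : IsPressureLaw p) (hb : 0 ≤ w - p b) {ρ₀ : ℝ}
    (hlim : Tendsto (fun ξ => H ξ / ξ) atBot (𝓝 (-ρ₀))) (k : ℝ) {φ : ℝ → ℝ → ℝ}
    (hφ : IsTestFunction φ) :
    weakForm (Iio 0) (fun x t => r (x / t) * k) (fun x t => r (x / t) * (w - p (r (x / t))) * k)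
      (ρ₀ * k) φ = H 0 * k * rayIntegral φ 0 := by
  refine (isProfile_incoming h ha hp hb k).weakForm_eq_of_incoming
    ((h.isPotential _).mul_const k) ?_
    (((h.continuous.mul continuous_const).tendsto 0).mono_left nhdsWithin_le_nhds) hφ
  have := hlim.mul_const k
  rw [neg_mul] at this
  exact this.congr fun ξ => by ring

end Incoming

section Outgoing

variable {P : ℝ → ℝ} {w₁ w₂ ρ₂ v₀ a b : ℝ} {C : Set ℝ} {r H : ℝ → ℝ}

lemma isProfile_outgoing (h : IsScalarProfile (flux P w₁) a b C r H) (ha : 0 ≤ a)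
    (hP : IsPressureLaw P) (hb : 0 ≤ w₁ - P b) (k₁ k₂ : ℝ) :
    IsProfile (Ioi 0) (C ∪ ∅ ∪ {v₀})
      (max (max (b * |k₁|) (b * w₁ * |k₁|)) (max |ρ₂ * k₂| |ρ₂ * v₀ * k₂|))
      (fun x t => if x / t < v₀ then r (x / t) * k₁ else ρ₂ * k₂)
      (fun x t => if x / t < v₀ then flux P w₁ (r (x / t)) * k₁ else ρ₂ * v₀ * k₂)
      (fun ξ => if ξ < v₀ then r ξ * k₁ else ρ₂ * k₂)
      (fun ξ => if ξ < v₀ then flux P w₁ (r ξ) * k₁ else ρ₂ * v₀ * k₂) where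
  countable := (h.countable.union countable_empty).union (countable_singleton _)
  density x _ t _ := rfl
  flux x _ t _ := rfl
  continuousAt_density ξ hξ := continuousAt_ite (C₂ := ∅)
    (fun ξ hξ => (h.continuousAt ξ hξ).mul_const k₁) (fun ξ _ => continuousAt_const) hξ.2
  continuousAt_flux ξ hξ := continuousAt_ite (C₂ := ∅)
    (fun ξ hξ => (h.continuousAt_flux ha hP hξ).mul_const k₁) (fun ξ _ => continuousAt_const) hξ.2
  bound_density ξ _ := by
    split_ifs
    · rw [abs_mul]
      exact (mul_le_mul_of_nonneg_right (h.abs_le ha ξ) (abs_nonneg k₁)).trans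
        ((le_max_left _ _).trans (le_max_left _ _))
    · exact (le_max_left _ _).trans (le_max_right _ _)
  bound_flux ξ _ := by
    split_ifs
    · rw [abs_mul]
      exact (mul_le_mul_of_nonneg_right (h.abs_flux_le ha hP hb ξ) (abs_nonneg k₁)).trans
        ((le_max_right _ _).trans (le_max_left _ _))
    · exact (le_max_right _ _).trans (le_max_right _ _)
  bound_nonneg := by
    have : 0 ≤ b := (h.nonneg ha 0).trans (h.mem_Icc 0).2
    positivity

lemma isPotential_constant (D : Set ℝ) (ρ₂ v₀ : ℝ) :
    IsPotential D ∅ (fun _ => ρ₂) (fun _ => ρ₂ * v₀) (fun ξ => ρ₂ * (v₀ - ξ)) where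
  countable := countable_empty
  continuousOn := by fun_prop
  hasDerivAt ξ _ := by
    simpa using ((hasDerivAt_id ξ).const_sub v₀).const_mul ρ₂
  eq ξ _ := by ring

lemma weakForm_outgoing (h : IsScalarProfile (flux P w₁) a b C r H) (ha : 0 ≤ a)
    (hP : IsPressureLaw P) (hb : 0 ≤ w₁ - P b) (hv₀ : 0 ≤ v₀) (hHv : H v₀ = 0)
    (k₁ k₂ : ℝ) {φ : ℝ → ℝ → ℝ} (hφ : IsTestFunction φ) :
    weakForm (Ioi 0) (fun x t => if x / t < v₀ then r (x / t) * k₁ else ρ₂ * k₂)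
      (fun x t => if x / t < v₀ then flux P w₁ (r (x / t)) * k₁ else ρ₂ * v₀ * k₂)
      (ρ₂ * k₂) φ = -(H 0 * k₁ * rayIntegral φ 0) := by
  have hglue := ((h.isPotential (Ioi 0)).mul_const k₁).glue
    ((isPotential_constant (Ioi 0) ρ₂ v₀).mul_const k₂) (v₀ := v₀)
    (h.continuous.mul continuous_const) (by fun_prop) (by simp [hHv])
  -- For `v₀ = 0` the triangle is empty, and both sides vanish because `H v₀ = 0`.
  have h0 : (if (0 : ℝ) < v₀ then H 0 * k₁ else ρ₂ * (v₀ - 0) * k₂) = H 0 * k₁ := by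
    rcases hv₀.eq_or_lt with rfl | hpos
    · simp [hHv]
    · rw [if_pos hpos]
  refine (isProfile_outgoing h ha hP hb k₁ k₂).weakForm_eq_of_outgoing hglue.2 ?_ ?_ hφ
  · have h1 : Tendsto (fun ξ : ℝ => ρ₂ * v₀ * k₂ * ξ⁻¹ - ρ₂ * k₂) atTop (𝓝 (-(ρ₂ * k₂))) := by
      simpa using (tendsto_inv_atTop_zero.const_mul (ρ₂ * v₀ * k₂)).sub_const (ρ₂ * k₂)
    refine h1.congr' ?_
    filter_upwards [eventually_ge_atTop v₀, eventually_gt_atTop 0] with ξ hξ hξ0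
    rw [if_neg (not_lt.2 hξ)]
    field_simp
  · have := (hglue.1.tendsto 0).mono_left (nhdsWithin_le_nhds (s := Ioi 0))
    rwa [h0] at this

end Outgoing

/-- Each incoming road, and the triangle, receives the single wave realizing its share of a maximal
flux; the constant initial state is glued on ahead of the contact. All test functions share the ray
integral at `0`, so conservation at the junction is the equality of total fluxes of `ρ` and of `ρ
w`. -/
theorem exists_isNetworkSolution {n : ℕ} (J : MergeJunction n) {P : ℝ → ℝ}
    (hP : IsPressureLaw P) (hPa : IsApproxHomogenizedPressure J.pOut J.β J.wIn P)
    (hpIn : ∀ i, IsPressureLaw (J.pIn i)) (hρIn : ∀ i, 0 ≤ J.ρIn i) (hwIn : ∀ i, 0 < J.wIn i)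
    (hvIn : ∀ i, 0 ≤ J.wIn i - J.pIn i (J.ρIn i)) (hρOut : 0 ≤ J.ρOut) (hvOut : 0 ≤ J.vOut)
    (hβ : ∀ i, 0 ≤ J.β i) (hβsum : ∑ i, J.β i = 1) :
    ∃ Uin Uout, IsNetworkSolution J P Uin Uout := by
  set wbar := meanMarker J.β J.wIn with hwbar
  have hwb : 0 ≤ wbar := (meanMarker_pos hβ hβsum hwIn).le
  obtain ⟨hr0, hrf, -, -⟩ := hP.intermediateDensity_spec wbar J.vOut
  obtain ⟨q, hq⟩ := exists_isMaximalFlux (P := P) hβsum hβ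
    (fun i => (hpIn i).demand_nonneg (hwIn i).le (hρIn i) (hvIn i))
    (hP.supply_nonneg hwb (by rw [hrf]; exact mul_nonneg hr0 hvOut))
  have hin := fun i => exists_incoming_profile (hpIn i) (hwIn i).le (hρIn i) (hvIn i)
    (hq.1.demand_bound i).1 (hq.1.demand_bound i).2
  choose a b C r H ha hS hb hH0 hHlim using hin
  obtain ⟨a', b', C', r', H', ha', hS', hb', hH0', hHv'⟩ := exists_outgoing_profile hP hwb hvOut
    hq.1.supply_bound.1 hq.1.supply_bound.2
  set R : ℝ → ℝ := fun ξ => if ξ < J.vOut then r' ξ else J.ρOut with hR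
  set W : ℝ → ℝ := fun ξ => if ξ < J.vOut then wbar else J.wOut with hW
  have hvelOut : ∀ x t, 0 < t → (profileState R W).v (J.pressureOut P) x t =
      if x / t < J.vOut then wbar - P (r' (x / t)) else J.vOut := by
    intro x t ht
    have hiff : x < t * J.vOut ↔ x / t < J.vOut := by rw [div_lt_iff₀ ht, mul_comm]
    simp only [RoadState.v, profileState, MergeJunction.pressureOut, hiff, hR, hW]
    split_ifs
    · rfl
    · rfl
  have hfluxOut : ∀ x t, 0 < t → R (x / t) * (profileState R W).v (J.pressureOut P) x t =
      if x / t < J.vOut then flux P wbar (r' (x / t)) else J.ρOut * J.vOut := by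
    intro x t ht
    rw [hvelOut x t ht]
    simp only [hR]
    split_ifs <;> rfl
  refine ⟨fun i => profileState (r i) fun _ => J.wIn i, profileState R W, hPa,
    fun i => isRiemannState_incoming (hS i) (ha i) (hpIn i) (hb i), ⟨?_, ?_, ?_, ?_⟩, ?_, ?_, ?_,
    ?_, ?_, q, hq, ?_, ?_⟩
  · intro x _ t _
    simp only [profileState, hR]
    split_ifs
    · exact hS'.nonneg ha' _
    · exact hρOut
  · intro x _ t ht
    rw [hvelOut x t ht]
    split_ifs
    · exact (hS'.velocity_mem ha' hP hb' _).1
    · exact hvOut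
  · refine ⟨max (max b' |J.ρOut|) (max |wbar| |J.wOut|), fun x _ t _ => ⟨?_, ?_⟩⟩
    · simp only [profileState, hR]
      split_ifs
      · exact (hS'.abs_le ha' _).trans ((le_max_left _ _).trans (le_max_left _ _))
      · exact (le_max_right _ _).trans (le_max_left _ _)
    · simp only [profileState, hW]
      split_ifs
      · exact (le_max_left _ _).trans (le_max_right _ _)
      · exact (le_max_right _ _).trans (le_max_right _ _)
  · intro x _ t _
    simp [profileState]
  · intro φin φout hφin hφout hφ
    have hA : ∀ i, rayIntegral (φin i) 0 = rayIntegral φout 0 := fun i =>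
      rayIntegral_zero_congr (hφ i)
    have hwf : ∀ {D : Set ℝ} {u u' f f' : ℝ → ℝ → ℝ} {u₀ u₀' : ℝ} {φ : ℝ → ℝ → ℝ},
        (∀ x t, 0 < t → u x t = u' x t) → (∀ x t, 0 < t → f x t = f' x t) → u₀ = u₀' →
        weakForm D u f u₀ φ = weakForm D u' f' u₀' φ := by
      rintro D u u' f f' u₀ _ φ hu hf rfl
      rw [weakForm, weakForm]
      congr 1
      refine setIntegral_congr_fun measurableSet_Ioi fun t ht => ?_
      simp only [hu _ t ht, hf _ t ht]
    constructor
    · have h1 : ∀ i, weakForm (Iio 0) (profileState (r i) fun _ => J.wIn i).ρ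
          (fun x t => (profileState (r i) fun _ => J.wIn i).ρ x t *
            (profileState (r i) fun _ => J.wIn i).v (J.pressureIn i) x t) (J.ρIn i) (φin i) =
          q i * rayIntegral φout 0 := by
        intro i
        have := weakForm_incoming (hS i) (ha i) (hpIn i) (hb i) (hHlim i) 1 (hφin i)
        rw [hA i, hH0 i, mul_one (q i)] at this
        rw [← this]
        exact hwf (fun x t _ => (mul_one _).symm) (fun x t _ => (mul_one _).symm)
          (mul_one _).symm
      have h2 := weakForm_outgoing (ρ₂ := J.ρOut) hS' ha' hP hb' hvOut hHv' 1 1 hφout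
      rw [hH0', mul_one (∑ i, q i)] at h2
      rw [Finset.sum_congr rfl fun i _ => h1 i, ← Finset.sum_mul]
      refine (congrArg _ (Eq.trans (hwf (fun x t _ => ?_) (fun x t ht => ?_) ?_) h2)).trans ?_
      · simp only [profileState, hR, mul_one]
      · simp only [mul_one]
        exact hfluxOut x t ht
      · rw [mul_one]
      · ring
    · have h1 : ∀ i, weakForm (Iio 0)
          (fun x t => (profileState (r i) fun _ => J.wIn i).ρ x t *
            (profileState (r i) fun _ => J.wIn i).w x t)
          (fun x t => (profileState (r i) fun _ => J.wIn i).ρ x t *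
            (profileState (r i) fun _ => J.wIn i).v (J.pressureIn i) x t *
            (profileState (r i) fun _ => J.wIn i).w x t) (J.ρIn i * J.wIn i) (φin i) =
          q i * J.wIn i * rayIntegral φout 0 := by
        intro i
        have := weakForm_incoming (hS i) (ha i) (hpIn i) (hb i) (hHlim i) (J.wIn i)
          (hφin i)
        rw [hA i, hH0 i] at this
        exact this
      have h2 := weakForm_outgoing (ρ₂ := J.ρOut) hS' ha' hP hb' hvOut hHv' wbar J.wOut hφout
      rw [hH0'] at h2
      -- The mixture rule is exactly what gives the outgoing flow the averaged marker.
      have hqw : ∑ i, q i * J.wIn i = (∑ i, q i) * wbar := by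
        rw [hwbar, meanMarker, Finset.mul_sum]
        refine Finset.sum_congr rfl fun i _ => ?_
        rw [hq.1.eq_sum_mul hβsum i]
        ring
      rw [Finset.sum_congr rfl fun i _ => h1 i, ← Finset.sum_mul, hqw]
      refine (congrArg _ (Eq.trans (hwf (fun x t _ => ?_) (fun x t ht => ?_) rfl) h2)).trans ?_
      · simp only [profileState, hR, hW]
        split_ifs <;> rfl
      · have := hfluxOut x t ht
        change R (x / t) * (profileState R W).v (J.pressureOut P) x t * W (x / t) = _
        rw [this]
        simp only [hW]
        split_ifs <;> rfl
      · ring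
  · intro i ξ _
    exact (hS i).isAdmissibleAt (ha i) (hpIn i)
      (Eventually.of_forall fun y => by simp [profileState]) (Eventually.of_forall fun y => rfl)
  · intro ξ _ hξ
    refine hS'.isAdmissibleAt ha' hP ?_ ?_
    · filter_upwards [Iio_mem_nhds hξ] with y hy
      simp only [profileState, hR, div_one]
      exact if_pos hy
    · filter_upwards [Iio_mem_nhds hξ] with y hy
      simp only [profileState, hW, div_one]
      exact if_pos hy
  · intro ξ _ hξ
    have e1 : ∀ᶠ y in 𝓝 ξ, J.ρOut = (profileState R W).ρ y 1 := by
      filter_upwards [Ioi_mem_nhds hξ] with y hy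
      simp only [profileState, hR, div_one]
      exact (if_neg (le_of_lt hy).not_gt).symm
    have e2 : ∀ᶠ y in 𝓝 ξ, J.wOut = (profileState R W).w y 1 := by
      filter_upwards [Ioi_mem_nhds hξ] with y hy
      simp only [profileState, hW, div_one]
      exact (if_neg (le_of_lt hy).not_gt).symm
    have t1 := (tendsto_const_nhds (x := J.ρOut)).congr' e1
    have t2 := (tendsto_const_nhds (x := J.wOut)).congr' e2
    exact ⟨_, _, _, _, t1.mono_left nhdsWithin_le_nhds, t1.mono_left nhdsWithin_le_nhds,
      t2.mono_left nhdsWithin_le_nhds, t2.mono_left nhdsWithin_le_nhds, le_rfl⟩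
  · intro x t ht _ hx
    simp only [profileState, hW]
    exact if_pos (by rwa [div_lt_iff₀ ht, mul_comm])
  · intro i
    have := tendsto_flux_of_potential (hS i).continuous ((hS i).abs_le (ha i)) (hS i).eq
    rw [hH0 i] at this
    refine (this.mono_left nhdsWithin_le_nhds).congr fun x => ?_
    simp [profileState, RoadState.v, MergeJunction.pressureIn, flux]
  · have hglue := (hS'.isPotential (Ioi 0)).glue (isPotential_constant (Ioi 0) J.ρOut J.vOut)
      (v₀ := J.vOut) hS'.continuous (by fun_prop) (by simp [hHv'])
    have h0 : (if (0 : ℝ) < J.vOut then H' 0 else J.ρOut * (J.vOut - 0)) = ∑ i, q i := by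
      rw [← hH0']
      rcases hvOut.eq_or_lt with h | hpos
      · rw [← h] at hHv' ⊢
        simp [hHv']
      · rw [if_pos hpos]
    have := tendsto_flux_of_potential (U := R) (M := max b' |J.ρOut|) hglue.1 (fun ξ => by
        simp only [hR]
        split_ifs
        · exact (hS'.abs_le ha' _).trans (le_max_left _ _)
        · exact le_max_right _ _)
      (F := fun ξ => if ξ < J.vOut then flux P wbar (r' ξ) else J.ρOut * J.vOut) (fun ξ => by
        simp only [hR]
        split_ifs
        · exact hS'.eq ξ
        · ring)
    rw [h0] at this
    refine (this.mono_left nhdsWithin_le_nhds).congr fun x => ?_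
    have := hfluxOut x 1 one_pos
    rw [div_one] at this
    rw [← this]
    simp [profileState]

/-! ### Potentials of network solutions -/

lemma weakForm_zero (D : Set ℝ) (u f : ℝ → ℝ → ℝ) (u₀ : ℝ) :
    weakForm D u f u₀ (fun _ _ => 0) = 0 := by
  simp [weakForm]

lemma isTestFunction_zero : IsTestFunction (fun _ _ => 0) := by
  constructor
  · exact contDiff_const
  · exact HasCompactSupport.zero

namespace IsWeakNetworkSolution

variable {n : ℕ} {J : MergeJunction n} {P : ℝ → ℝ} {Uin : Fin n → RoadState} {Uout : RoadState}
  {φ : ℝ → ℝ → ℝ}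

/-- A test function vanishing at the junction may be completed by zero on all other roads, which
isolates the equation on road `i`. -/
lemma incoming (h : IsWeakNetworkSolution J P Uin Uout) (i : Fin n) (hφ : IsTestFunction φ)
    (h0 : ∀ t, 0 ≤ t → φ 0 t = 0) :
    weakForm (Iio 0) (Uin i).ρ (fun x t => (Uin i).ρ x t * (Uin i).v (J.pressureIn i) x t)
      (J.ρIn i) φ = 0 ∧
    weakForm (Iio 0) (fun x t => (Uin i).ρ x t * (Uin i).w x t)
      (fun x t => (Uin i).ρ x t * (Uin i).v (J.pressureIn i) x t * (Uin i).w x t)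
      (J.ρIn i * J.wIn i) φ = 0 := by
  have key := h (fun k => if k = i then φ else fun _ _ => 0) (fun _ _ => 0)
    (fun k => by
      split_ifs
      · exact hφ
      · exact isTestFunction_zero) isTestFunction_zero
    (fun k t ht => by
      split_ifs
      · exact h0 t ht
      · rfl)
  rw [weakForm_zero, weakForm_zero, add_zero, add_zero] at key
  rw [Finset.sum_eq_single i, Finset.sum_eq_single i] at key
  · simpa using key
  all_goals first
    | (intro k _ hk; rw [if_neg hk, weakForm_zero])
    | (intro hk; exact absurd (Finset.mem_univ i) hk)

lemma outgoing (h : IsWeakNetworkSolution J P Uin Uout) (hφ : IsTestFunction φ)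
    (h0 : ∀ t, 0 ≤ t → φ 0 t = 0) :
    weakForm (Ioi 0) Uout.ρ (fun x t => Uout.ρ x t * Uout.v (J.pressureOut P) x t) J.ρOut φ = 0 ∧
    weakForm (Ioi 0) (fun x t => Uout.ρ x t * Uout.w x t)
      (fun x t => Uout.ρ x t * Uout.v (J.pressureOut P) x t * Uout.w x t)
      (J.ρOut * J.wOut) φ = 0 := by
  have key := h (fun _ _ _ => 0) φ (fun _ => isTestFunction_zero) hφ (fun _ t ht => (h0 t ht).symm)
  simpa [weakForm_zero] using key

end IsWeakNetworkSolution

/-- The conserved quantities of a self-similar state with one-sided limits have regular profiles. -/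
lemma exists_isProfile {D S : Set ℝ} (hSc : (D \ S).Countable) {U : RoadState}
    {p : ℝ → ℝ → ℝ → ℝ} {V : ℝ → ℝ} {M : ℝ}
    (hself : ∀ x ∈ D, ∀ t > 0, U.ρ x t = U.ρ (x / t) 1 ∧ U.w x t = U.w (x / t) 1)
    (hV : ∀ x ∈ D, ∀ t > 0, U.v p x t = V (x / t)) (hne : D.Nonempty)
    (hb : ∀ ξ ∈ D, |U.ρ ξ 1| ≤ M ∧ |U.w ξ 1| ≤ M ∧ |V ξ| ≤ M)
    (hρ : HasSidedLimits (fun ξ => U.ρ ξ 1) S) (hw : HasSidedLimits (fun ξ => U.w ξ 1) S)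
    (hVs : HasSidedLimits V S) :
    ∃ C M', IsProfile D C M' U.ρ (fun x t => U.ρ x t * U.v p x t) (fun ξ => U.ρ ξ 1)
        (fun ξ => U.ρ ξ 1 * V ξ) ∧
      IsProfile D C M' (fun x t => U.ρ x t * U.w x t) (fun x t => U.ρ x t * U.v p x t * U.w x t)
        (fun ξ => U.ρ ξ 1 * U.w ξ 1) (fun ξ => U.ρ ξ 1 * V ξ * U.w ξ 1) := by
  obtain ⟨c, hc⟩ := hne
  have hM : 0 ≤ M := (abs_nonneg _).trans (hb c hc).1
  have hM' : 0 ≤ max M (max (M * M) (M * M * M)) := hM.trans (le_max_left _ _)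
  -- The exceptional set collects the countably many jumps and the points where no one-sided limits
  -- are assumed.
  set C := ({ξ ∈ S | ¬ContinuousAt (fun ξ => U.ρ ξ 1) ξ} ∪
    {ξ ∈ S | ¬ContinuousAt (fun ξ => U.w ξ 1) ξ}
    ∪ {ξ ∈ S | ¬ContinuousAt V ξ}) ∪ D \ S with hC
  have hCc : C.Countable :=
    ((hρ.countable_not_continuousAt.union hw.countable_not_continuousAt).union
      hVs.countable_not_continuousAt).union hSc
  have hcont : ∀ ξ ∈ D \ C, ContinuousAt (fun ξ => U.ρ ξ 1) ξ ∧
      ContinuousAt (fun ξ => U.w ξ 1) ξ ∧ ContinuousAt V ξ := by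
    rintro ξ ⟨hξD, hξC⟩
    simp only [hC, mem_union, mem_ofPred_eq, Set.mem_sdiff, not_or, not_and, not_not] at hξC
    have hS := hξC.2 hξD
    exact ⟨hξC.1.1.1 hS, hξC.1.1.2 hS, hξC.1.2 hS⟩
  have hmul : ∀ {x y A B : ℝ}, |x| ≤ A → |y| ≤ B → 0 ≤ A → |x * y| ≤ A * B := by
    intro x y A B hx hy hA
    rw [abs_mul]
    exact mul_le_mul hx hy (abs_nonneg _) hA
  have m1 : M * M ≤ max M (max (M * M) (M * M * M)) :=
    (le_max_left _ _).trans (le_max_right _ _)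
  have m2 : M * M * M ≤ max M (max (M * M) (M * M * M)) :=
    (le_max_right _ _).trans (le_max_right _ _)
  refine ⟨C, max M (max (M * M) (M * M * M)),
    ⟨hCc, fun x hx t ht => (hself x hx t ht).1, fun x hx t ht => ?_, fun ξ hξ => (hcont ξ hξ).1,
      fun ξ hξ => (hcont ξ hξ).1.mul (hcont ξ hξ).2.2, fun ξ hξ => ?_, fun ξ hξ => ?_, hM'⟩,
    ⟨hCc, fun x hx t ht => ?_, fun x hx t ht => ?_,
      fun ξ hξ => (hcont ξ hξ).1.mul (hcont ξ hξ).2.1,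
      fun ξ hξ => ((hcont ξ hξ).1.mul (hcont ξ hξ).2.2).mul (hcont ξ hξ).2.1,
      fun ξ hξ => ?_, fun ξ hξ => ?_, hM'⟩⟩
  · rw [hV x hx t ht, (hself x hx t ht).1]
  · exact (hb ξ hξ).1.trans (le_max_left _ _)
  · exact (hmul (hb ξ hξ).1 (hb ξ hξ).2.2 hM).trans m1
  · rw [(hself x hx t ht).1, (hself x hx t ht).2]
  · rw [hV x hx t ht, (hself x hx t ht).1, (hself x hx t ht).2]
  · exact (hmul (hb ξ hξ).1 (hb ξ hξ).2.1 hM).trans m1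
  · exact (hmul (hmul (hb ξ hξ).1 (hb ξ hξ).2.2 hM) (hb ξ hξ).2.1 (mul_nonneg hM hM)).trans m2

/-- One-sided limits of the density, the marker and the velocity at an admissible ray. -/
lemma IsAdmissibleAt.exists_limits {p : ℝ → ℝ} {U : RoadState} {ξ : ℝ} (h : IsAdmissibleAt p U ξ)
    (hp : IsPressureLaw p) {D : Set ℝ} (hD : D ∈ 𝓝 ξ) {V : ℝ → ℝ} {M : ℝ}
    (hV : ∀ y ∈ D, V y = U.w y 1 - p (U.ρ y 1)) (hρ : ∀ y ∈ D, 0 ≤ U.ρ y 1 ∧ U.ρ y 1 ≤ M)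
    (hVb : ∀ y ∈ D, 0 ≤ V y ∧ V y ≤ M) :
    ∃ ρl ρr wl wr vl vr, Tendsto (fun y => U.ρ y 1) (𝓝[<] ξ) (𝓝 ρl) ∧
      Tendsto (fun y => U.ρ y 1) (𝓝[>] ξ) (𝓝 ρr) ∧
      Tendsto (fun y => U.w y 1) (𝓝[<] ξ) (𝓝 wl) ∧ Tendsto (fun y => U.w y 1) (𝓝[>] ξ) (𝓝 wr) ∧
      Tendsto V (𝓝[<] ξ) (𝓝 vl) ∧ Tendsto V (𝓝[>] ξ) (𝓝 vr) ∧
      vl = wl - p ρl ∧ vr = wr - p ρr ∧ vr ≤ vl ∧ (0 ≤ ρl ∧ ρl ≤ M) ∧ (0 ≤ ρr ∧ ρr ≤ M) ∧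
      (0 ≤ vl ∧ vl ≤ M) ∧ (0 ≤ vr ∧ vr ≤ M) := by
  obtain ⟨ρl, ρr, wl, wr, h1, h2, h3, h4, h5⟩ := h
  have hl : D ∈ 𝓝[<] ξ := nhdsWithin_le_nhds hD
  have hr : D ∈ 𝓝[>] ξ := nhdsWithin_le_nhds hD
  have hρl : 0 ≤ ρl ∧ ρl ≤ M :=
    isClosed_Icc.mem_of_tendsto h1 (mem_of_superset hl fun y hy => hρ y hy)
  have hρr : 0 ≤ ρr ∧ ρr ≤ M :=
    isClosed_Icc.mem_of_tendsto h2 (mem_of_superset hr fun y hy => hρ y hy)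
  have hvl : Tendsto V (𝓝[<] ξ) (𝓝 (wl - p ρl)) := by
    refine (h3.sub (tendsto_comp_of_nonneg hp.continuousOn
      (mem_of_superset hl fun y hy => (hρ y hy).1) hρl.1 h1)).congr' ?_
    filter_upwards [hl] with y hy using (hV y hy).symm
  have hvr : Tendsto V (𝓝[>] ξ) (𝓝 (wr - p ρr)) := by
    refine (h4.sub (tendsto_comp_of_nonneg hp.continuousOn
      (mem_of_superset hr fun y hy => (hρ y hy).1) hρr.1 h2)).congr' ?_
    filter_upwards [hr] with y hy using (hV y hy).symm
  exact ⟨ρl, ρr, wl, wr, _, _, h1, h2, h3, h4, hvl, hvr, rfl, rfl, h5, hρl, hρr,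
    isClosed_Icc.mem_of_tendsto hvl (mem_of_superset hl fun y hy => hVb y hy),
    isClosed_Icc.mem_of_tendsto hvr (mem_of_superset hr fun y hy => hVb y hy)⟩

/-- The flux at the junction is the value of the density potential. -/
lemma IsPotential.apply_zero_eq {D C s : Set ℝ} {U F N : ℝ → ℝ} {M q : ℝ}
    (hN : IsPotential D C U F N) (hNc : Continuous N) (hs : IsOpen s) (h0 : 0 ∈ closure s)
    (hsD : s ⊆ D) (hb : ∀ ξ ∈ s, |U ξ| ≤ M) (hq : Tendsto F (𝓝[s] 0) (𝓝 q)) : N 0 = q := by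
  refine IsPotential.eq_of_tendsto hs (ξ := 0) (f := N) (g := fun ξ => F ξ - ξ * U ξ) h0
    ((hNc.tendsto 0).mono_left nhdsWithin_le_nhds) ?_ hN.countable ?_
  · have h1 : Tendsto (fun ξ : ℝ => U ξ * ξ) (𝓝[s] 0) (𝓝 0) := by
      refine bdd_le_mul_tendsto_zero' M ?_ (tendsto_id.mono_left nhdsWithin_le_nhds)
      filter_upwards [self_mem_nhdsWithin] with ξ hξ using hb ξ hξ
    have h2 := hq.sub h1
    rw [sub_zero] at h2
    exact h2.congr fun ξ => by rw [mul_comm ξ]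
  · filter_upwards [self_mem_nhdsWithin] with ξ hξ hξC
    exact (hN.eq ξ ⟨hsD hξ, hξC⟩).symm

/-- The potential of the density on an incoming road: either the road is empty, or the potential
belongs to an entropy solution of the scalar conservation law for the initial marker. -/
lemma IsNetworkSolution.exists_potential_incoming {n : ℕ} {J : MergeJunction n} {P : ℝ → ℝ}
    {Uin : Fin n → RoadState} {Uout : RoadState} (h : IsNetworkSolution J P Uin Uout) (i : Fin n)
    (hp : IsPressureLaw (J.pIn i)) {q : ℝ}
    (hq : Tendsto (fun x => (Uin i).ρ x 1 * (Uin i).v (J.pressureIn i) x 1) (𝓝[<] 0) (𝓝 q)) :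
    ∃ C N M, Continuous N ∧
      IsPotential (Iio 0) C (fun ξ => (Uin i).ρ ξ 1)
        (fun ξ => (Uin i).ρ ξ 1 * (Uin i).v (J.pressureIn i) ξ 1) N ∧
      (∀ ξ ∈ Iio 0 \ C, (Uin i).ρ ξ 1 * (Uin i).w ξ 1 = (Uin i).ρ ξ 1 * J.wIn i) ∧
      N 0 = q ∧ Tendsto (fun ξ => N ξ / ξ) atBot (𝓝 (-J.ρIn i)) ∧
      (J.ρIn i = 0 → ∀ ξ < 0, N ξ = 0) ∧
      (0 < J.ρIn i → IsEntropyPotential (flux (J.pIn i) (J.wIn i)) M (Iio 0) N) := by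
  have hst := h.state_in i
  obtain ⟨M, hM⟩ := hst.bounded
  set U := Uin i with hU
  set V : ℝ → ℝ := fun ξ => U.v (J.pressureIn i) ξ 1 with hVdef
  set w := J.wIn i with hw
  set ρ₀ := J.ρIn i with hρ₀def
  have hρb : ∀ ξ ∈ Iio (0 : ℝ), 0 ≤ U.ρ ξ 1 ∧ U.ρ ξ 1 ≤ M := fun ξ hξ =>
    ⟨hst.density_nonneg ξ hξ 1 one_pos, (le_abs_self _).trans (hM ξ hξ 1 one_pos).1⟩
  have hVb : ∀ ξ ∈ Iio (0 : ℝ), 0 ≤ V ξ ∧ V ξ ≤ M := fun ξ hξ => by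
    refine ⟨hst.velocity_nonneg ξ hξ 1 one_pos, ?_⟩
    have h1 := hp.pressure_nonneg (hρb ξ hξ).1
    have h2 := (le_abs_self _).trans (hM ξ hξ 1 one_pos).2
    have h3 : V ξ = U.w ξ 1 - J.pIn i (U.ρ ξ 1) := rfl
    linarith
  have hlim := fun ξ (hξ : ξ < 0) => (h.admissible_in i ξ hξ).exists_limits hp
    (Iio_mem_nhds hξ) (V := V) (fun y _ => rfl) hρb hVb
  choose! ρl ρr wl wr vl vr tρl tρr twl twr tvl tvr evl evr hent bρl bρr bvl bvr using hlim
  obtain ⟨C, M', hp1, hp2⟩ := exists_isProfile (D := Iio 0) (S := Iio 0) (by simp)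
    (U := U) (p := J.pressureIn i) (V := V) (M := M) hst.selfSimilar
    (fun x hx t ht => by
      simp only [hVdef, RoadState.v, MergeJunction.pressureIn]
      rw [(hst.selfSimilar x hx t ht).1, (hst.selfSimilar x hx t ht).2]) nonempty_Iio
    (fun ξ hξ => ⟨(hM ξ hξ 1 one_pos).1, (hM ξ hξ 1 one_pos).2, by
      rw [abs_of_nonneg (hVb ξ hξ).1]; exact (hVb ξ hξ).2⟩)
    (fun ξ hξ => ⟨⟨_, tρl ξ hξ⟩, ⟨_, tρr ξ hξ⟩⟩) (fun ξ hξ => ⟨⟨_, twl ξ hξ⟩, ⟨_, twr ξ hξ⟩⟩)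
    (fun ξ hξ => ⟨⟨_, tvl ξ hξ⟩, ⟨_, tvr ξ hξ⟩⟩)
  have hD : IsRoadDomain (Iio 0) := Or.inr rfl
  have hw1 := fun φ hφ h0 => (h.weak.incoming i (φ := φ) hφ h0).1
  have hw2 := fun φ hφ h0 => (h.weak.incoming i (φ := φ) hφ h0).2
  obtain ⟨N, hNc, hN⟩ := hp1.exists_isPotential hD hw1
  obtain ⟨K, hKc, hK⟩ := hp2.exists_isPotential hD hw2
  have hNlim := hp1.tendsto_potential_div_atBot hN hNc hw1
  have hKlim := hp2.tendsto_potential_div_atBot hK hKc hw2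
  have li1 := hp1.locallyIntegrableOn isOpen_Iio
  have li2 := hp2.locallyIntegrableOn isOpen_Iio
  have Nr : ∀ ξ < 0, N ξ = ρr ξ * (vr ξ - ξ) := fun ξ hξ => by
    rw [hN.eq_right isOpen_Iio hξ (tρr ξ hξ) ((tρr ξ hξ).mul (tvr ξ hξ))]; ring
  have Nl : ∀ ξ < 0, N ξ = ρl ξ * (vl ξ - ξ) := fun ξ hξ => by
    rw [hN.eq_left isOpen_Iio hξ (tρl ξ hξ) ((tρl ξ hξ).mul (tvl ξ hξ))]; ring
  have dNr : ∀ ξ < 0, HasDerivWithinAt N (-ρr ξ) (Ici ξ) ξ := fun ξ hξ =>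
    hN.hasDerivWithinAt_right isOpen_Iio li1 hξ (tρr ξ hξ)
  have dNl : ∀ ξ < 0, HasDerivWithinAt N (-ρl ξ) (Iic ξ) ξ := fun ξ hξ =>
    hN.hasDerivWithinAt_left isOpen_Iio li1 hξ (tρl ξ hξ)
  have Kr : ∀ ξ < 0, K ξ = ρr ξ * wr ξ * (vr ξ - ξ) := fun ξ hξ => by
    rw [hK.eq_right isOpen_Iio hξ ((tρr ξ hξ).mul (twr ξ hξ))
      (((tρr ξ hξ).mul (tvr ξ hξ)).mul (twr ξ hξ))]
    ring
  have Kl : ∀ ξ < 0, K ξ = ρl ξ * wl ξ * (vl ξ - ξ) := fun ξ hξ => by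
    rw [hK.eq_left isOpen_Iio hξ ((tρl ξ hξ).mul (twl ξ hξ))
      (((tρl ξ hξ).mul (tvl ξ hξ)).mul (twl ξ hξ))]
    ring
  have dKr : ∀ ξ < 0, HasDerivWithinAt K (-(ρr ξ * wr ξ)) (Ici ξ) ξ := fun ξ hξ =>
    hK.hasDerivWithinAt_right isOpen_Iio li2 hξ ((tρr ξ hξ).mul (twr ξ hξ))
  have hM0 : 0 ≤ M := (hρb (-1) (by simp)).1.trans (hρb (-1) (by simp)).2
  -- The excess `ρ (m - w)` of the marker density, with `m` the marker of the solution, is carried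
  -- by the same velocity and is zero initially.
  have hKN : ∀ ξ < 0, K ξ - w * N ξ = 0 := by
    refine eq_zero_of_transported_incoming (κ := fun ξ => ρr ξ * (wr ξ - w)) (v := vr) hM0
      (hKc.sub (continuous_const.mul hNc)).continuousOn (fun ξ hξ => ?_) (fun ξ hξ => ?_) bvr ?_
    · exact ((dKr ξ hξ).sub ((dNr ξ hξ).const_mul w)).congr_deriv (by ring)
    · rw [Kr ξ hξ, Nr ξ hξ]; ring
    · have := hKlim.sub (hNlim.const_mul w)
      rw [show -(ρ₀ * w) - w * -ρ₀ = 0 by ring] at this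
      exact this.congr fun ξ => by ring
  refine ⟨C, N, M, hNc, hN, ?_, ?_, hNlim, ?_, ?_⟩
  · rintro ξ ⟨hξ, hξC⟩
    have e1 := hN.eq ξ ⟨hξ, hξC⟩
    have e2 := hK.eq ξ ⟨hξ, hξC⟩
    have e3 := hKN ξ hξ
    rw [← e1, ← e2] at e3
    have hpos : V ξ - ξ ≠ 0 := by
      have := (hVb ξ hξ).1
      have hξ' : ξ < 0 := hξ
      exact (by linarith : 0 < V ξ - ξ).ne'
    have e4 : (U.ρ ξ 1 * U.w ξ 1 - U.ρ ξ 1 * w) * (V ξ - ξ) = 0 := by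
      rw [← e3]; ring
    exact sub_eq_zero.1 ((mul_eq_zero.1 e4).resolve_right hpos)
  · exact hN.apply_zero_eq hNc isOpen_Iio (by simp) subset_rfl
      (fun ξ hξ => (hM ξ hξ 1 one_pos).1) hq
  · intro hz
    refine eq_zero_of_transported_incoming (v := vr) hM0 hNc.continuousOn dNr Nr bvr ?_
    rwa [show J.ρIn i = 0 from hz, neg_zero] at hNlim
  -- A positive initial density keeps `N` positive, so neither trace is a vacuum and both carry the
  -- marker `w`. Only then does the order of the velocities translate into an order of the
  -- densities, which is why the empty road is treated apart.
  · intro hpos ξ hξ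
    have hξ' : ξ < 0 := hξ
    have hNpos : 0 < N ξ := lt_of_lt_of_le (mul_pos hpos (by linarith)) (le_potential_incoming
      hNc.continuousOn dNr Nr (fun ξ hξ => (bvr ξ hξ).1) (fun ξ hξ => (bρr ξ hξ).1) hNlim ξ hξ)
    have mark : ∀ {ρ m v : ℝ}, N ξ = ρ * (v - ξ) → K ξ = ρ * m * (v - ξ) → m = w := by
      intro ρ m v h1 h2
      have h3 := hKN ξ hξ
      have h4 : (m - w) * N ξ = 0 := by
        rw [← h3, h2, h1]; ring
      exact sub_eq_zero.1 ((mul_eq_zero.1 h4).resolve_right hNpos.ne')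
    have ml := mark (Nl ξ hξ) (Kl ξ hξ)
    have mr := mark (Nr ξ hξ) (Kr ξ hξ)
    have e1 := evl ξ hξ
    have e2 := evr ξ hξ
    rw [ml] at e1
    rw [mr] at e2
    refine ⟨ρl ξ, ρr ξ, (bρl ξ hξ).1, ?_, (bρr ξ hξ).2, dNl ξ hξ, dNr ξ hξ, ?_, ?_⟩
    · refine (hp.strictMonoOn.le_iff_le (bρl ξ hξ).1 (bρr ξ hξ).1).1 ?_
      have := hent ξ hξ
      linarith
    · rw [Nl ξ hξ, e1, flux]; ring
    · rw [Nr ξ hξ, e2, flux]; ring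

/-! ### The constant state ahead of the initial cars -/

lemma add_slope_mul_le_of_concaveOn {f : ℝ → ℝ} {S : Set ℝ} (hf : ConcaveOn ℝ S f) {a b r : ℝ}
    (ha : a ∈ S) (hb : b ∈ S) (hab : a < b) (har : a ≤ r) (hrb : r ≤ b) :
    f a + slope f a b * (r - a) ≤ f r := by
  have hba : 0 < b - a := sub_pos.2 hab
  have h := hf.2 ha hb (show 0 ≤ (b - r) / (b - a) from div_nonneg (by linarith) hba.le)
    (show 0 ≤ (r - a) / (b - a) from div_nonneg (by linarith) hba.le) (by field_simp; ring)
  simp only [smul_eq_mul] at h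
  rw [show (b - r) / (b - a) * a + (r - a) / (b - a) * b = r by field_simp; ring] at h
  refine le_trans (le_of_eq ?_) h
  rw [slope_def_field]
  field_simp
  ring

lemma le_add_mul_of_concaveOn {f : ℝ → ℝ} {S : Set ℝ} (hf : ConcaveOn ℝ S f)
    {a r c : ℝ} (ha : a ∈ S) (hr : r ∈ S) (hd : HasDerivAt f c a) :
    f r ≤ f a + c * (r - a) := by
  rcases lt_trichotomy r a with h | rfl | h
  · have := hf.le_slope_of_hasDerivAt hr ha h hd
    rw [slope_def_field, le_div_iff₀ (sub_pos.2 h)] at this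
    linarith
  · simp
  · have := hf.slope_le_of_hasDerivAt ha hr h hd
    rw [slope_def_field, div_le_iff₀ (sub_pos.2 h)] at this
    linarith

namespace IsPressureLaw

variable {p N K ρ m : ℝ → ℝ} {w r₀ M : ℝ}

lemma hasDerivAt_flux (hp : IsPressureLaw p) (w : ℝ) {r : ℝ} (hr : 0 < r) :
    ∃ c, HasDerivAt (flux p w) c r := by
  have h1 := (hp.differentiableOn.differentiableAt (Ioi_mem_nhds hr)).hasDerivAt
  exact ⟨_, (hasDerivAt_id r).mul (h1.const_sub w)⟩

/-- Ahead of the initial cars, the potentials are those of the initial state as long as the density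
potential is negative. -/
lemma potential_ahead_of_neg (hp : IsPressureLaw p) (hr₀ : 0 < r₀) {a : ℝ} (ha₀ : 0 ≤ a)
    (ha : w - p r₀ ≤ a) (hNc : Continuous N) (hKc : Continuous K)
    (hρ : ∀ ξ > a, 0 ≤ ρ ξ ∧ ρ ξ ≤ M) (hv : ∀ ξ > a, 0 ≤ m ξ - p (ρ ξ))
    (hN : ∀ ξ > a, N ξ = ρ ξ * (m ξ - p (ρ ξ) - ξ))
    (hK : ∀ ξ > a, K ξ = ρ ξ * m ξ * (m ξ - p (ρ ξ) - ξ))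
    (dN : ∀ ξ > a, HasDerivWithinAt N (-ρ ξ) (Ici ξ) ξ)
    (dK : ∀ ξ > a, HasDerivWithinAt K (-(ρ ξ * m ξ)) (Ici ξ) ξ)
    (hNlim : Tendsto (fun ξ => N ξ / ξ) atTop (𝓝 (-r₀)))
    (hKlim : Tendsto (fun ξ => K ξ / ξ) atTop (𝓝 (-(r₀ * w))))
    (hneg : ∀ ξ > a, N ξ < 0) :
    ∀ ξ > a, N ξ = r₀ * (w - p r₀ - ξ) ∧ K ξ = w * N ξ := by
  -- Negativity of `N` places the velocity below the ray speed, as the transport lemma on outgoing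
  -- roads requires.
  have hslow : ∀ ξ > a, m ξ - p (ρ ξ) ≤ ξ := by
    intro ξ hξ
    have h1 := hneg ξ hξ
    rw [hN ξ hξ] at h1
    by_contra h
    exact absurd h1 (not_lt.2 (mul_nonneg (hρ ξ hξ).1 (by linarith)))
  have hKN : ∀ ξ > a, K ξ - w * N ξ = 0 := by
    refine eq_zero_of_transported_outgoing (κ := fun ξ => ρ ξ * (m ξ - w))
      (v := fun ξ => m ξ - p (ρ ξ)) ha₀ (hKc.sub (continuous_const.mul hNc)).continuousOn
      (fun ξ hξ => ?_) (fun ξ hξ => ?_) (fun ξ hξ => ⟨hv ξ hξ, hslow ξ hξ⟩) ?_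
    · exact ((dK ξ hξ).sub ((dN ξ hξ).const_mul w)).congr_deriv (by ring)
    · rw [hK ξ hξ, hN ξ hξ]; ring
    · have := hKlim.sub (hNlim.const_mul w)
      rw [show -(r₀ * w) - w * -r₀ = 0 by ring] at this
      exact this.congr fun ξ => by ring
  have hm : ∀ ξ > a, m ξ = w := by
    intro ξ hξ
    have h4 : (m ξ - w) * N ξ = 0 := by
      rw [← hKN ξ hξ, hK ξ hξ, hN ξ hξ]; ring
    exact sub_eq_zero.1 ((mul_eq_zero.1 h4).resolve_right (hneg ξ hξ).ne)
  obtain ⟨c, hc⟩ := hp.hasDerivAt_flux w hr₀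
  have hconc := hp.concaveOn_flux w
  have hsuper : ∀ r, 0 ≤ r → flux p w r ≤ flux p w r₀ + c * (r - r₀) := fun r hr =>
    le_add_mul_of_concaveOn hconc hr₀.le hr hc
  -- The tangent at `r₀`, evaluated at the vacuum, shows that the characteristic speed does not
  -- exceed the velocity `w - p r₀`.
  have hca : c ≤ a := by
    have h := hsuper 0 le_rfl
    rw [flux_zero, flux] at h
    have h1 : r₀ * c ≤ r₀ * (w - p r₀) := by linarith
    exact (le_of_mul_le_mul_left h1 hr₀).trans ha
  have hf : ∀ r, 0 ≤ r → r ≤ r₀ → a * (r - r₀) ≤ flux p w r - flux p w r₀ := by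
    intro r hr hrr
    have h1 := hp.strictMonoOn.monotoneOn hr hr₀.le hrr
    simp only [flux]
    nlinarith
  -- Chords of `f` from `r₀` to `R` lie below the graph on `[r₀, M]`; the `r₀ + 1` keeps the chord
  -- nondegenerate.
  set R := max M (r₀ + 1) with hR
  have hrR : r₀ < R := (lt_add_one r₀).trans_le (le_max_right _ _)
  have hchord : ∀ r, r₀ ≤ r → r ≤ M →
      flux p w r₀ + min c (slope (flux p w) r₀ R) * (r - r₀) ≤ flux p w r := by
    intro r hr hrM
    have h1 := add_slope_mul_le_of_concaveOn hconc hr₀.le (hr₀.trans hrR).le hrR hr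
      (hrM.trans (le_max_left _ _))
    have h2 := mul_le_mul_of_nonneg_right (min_le_right c (slope (flux p w) r₀ R))
      (sub_nonneg.2 hr)
    linarith
  have key := potential_eq_of_ahead hca (min_le_left _ _) hNc.continuousOn dN
    (fun ξ hξ => by rw [hN ξ hξ, hm ξ hξ, flux]; ring) hρ hf hsuper hchord hNlim
  intro ξ hξ
  refine ⟨?_, sub_eq_zero.1 (hKN ξ hξ)⟩
  rw [key ξ hξ, flux]
  ring

/-- Ahead of the initial cars the potentials are those of the initial state. -/
lemma potential_ahead (hp : IsPressureLaw p) (hr₀ : 0 < r₀) (hv₀ : 0 ≤ w - p r₀)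
    (hNc : Continuous N) (hKc : Continuous K)
    (hρ : ∀ ξ > w - p r₀, 0 ≤ ρ ξ ∧ ρ ξ ≤ M) (hv : ∀ ξ > w - p r₀, 0 ≤ m ξ - p (ρ ξ))
    (hN : ∀ ξ > w - p r₀, N ξ = ρ ξ * (m ξ - p (ρ ξ) - ξ))
    (hK : ∀ ξ > w - p r₀, K ξ = ρ ξ * m ξ * (m ξ - p (ρ ξ) - ξ))
    (dN : ∀ ξ > w - p r₀, HasDerivWithinAt N (-ρ ξ) (Ici ξ) ξ)
    (dK : ∀ ξ > w - p r₀, HasDerivWithinAt K (-(ρ ξ * m ξ)) (Ici ξ) ξ)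
    (hNlim : Tendsto (fun ξ => N ξ / ξ) atTop (𝓝 (-r₀)))
    (hKlim : Tendsto (fun ξ => K ξ / ξ) atTop (𝓝 (-(r₀ * w)))) :
    ∀ ξ > w - p r₀, N ξ = r₀ * (w - p r₀ - ξ) ∧ K ξ = w * N ξ := by
  set v₀ := w - p r₀ with hv₀def
  have step : ∀ a ≥ v₀, (∀ ξ > a, N ξ < 0) → ∀ ξ > a, N ξ = r₀ * (v₀ - ξ) ∧ K ξ = w * N ξ := by
    intro a ha hneg
    have hup : ∀ {ξ}, ξ > a → ξ > v₀ := fun h => lt_of_le_of_lt ha h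
    exact hp.potential_ahead_of_neg hr₀ (hv₀.trans ha) ha hNc hKc (fun ξ h => hρ ξ (hup h))
      (fun ξ h => hv ξ (hup h)) (fun ξ h => hN ξ (hup h)) (fun ξ h => hK ξ (hup h))
      (fun ξ h => dN ξ (hup h)) (fun ξ h => dK ξ (hup h)) hNlim hKlim hneg
  have hanti : ∀ {x y}, v₀ < x → x ≤ y → N y ≤ N x := fun {x y} hx hxy =>
    le_of_rightDeriv_nonpos hxy (fun z hz => dN z (hx.trans_le hz.1)) hNc.continuousOn
      (fun z hz => neg_nonpos.2 (hρ z (hx.trans_le hz.1)).1)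
  refine step v₀ le_rfl fun b hb => ?_
  by_contra hNb
  rw [not_lt] at hNb
  have hb' : v₀ < b := hb
  -- If `N b ≥ 0`, then `N` reaches this half value at some `a ≥ b` and stays negative afterwards.
  -- The formula then holds beyond `a`, hence at `a` by continuity, and makes `a` the midpoint of
  -- `v₀` and `b`, contradicting `a ≥ b`.
  set y := r₀ * (v₀ - b) / 2 with hy
  have hy0 : y < 0 := by
    have : r₀ * (v₀ - b) < 0 := mul_neg_of_pos_of_neg hr₀ (by linarith)
    rw [hy]; linarith
  have hNbot : Tendsto N atTop atBot := by
    refine (hNlim.neg_mul_atTop (neg_lt_zero.2 hr₀) tendsto_id).congr' ?_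
    filter_upwards [eventually_gt_atTop 0] with ξ hξ
    rw [id, div_mul_cancel₀ _ hξ.ne']
  obtain ⟨d, hdN, hbd⟩ := ((hNbot.eventually (eventually_le_atBot y)).and
    (eventually_ge_atTop b)).exists
  obtain ⟨a, ha, hNa⟩ := intermediate_value_Icc' hbd hNc.continuousOn
    (show y ∈ Icc (N d) (N b) from ⟨hdN, hy0.le.trans hNb⟩)
  have hva : v₀ < a := hb'.trans_le ha.1
  have hform := step a hva.le fun ξ hξ => (hanti hva (le_of_lt hξ)).trans_lt (hNa ▸ hy0)
  have hNa' : N a = r₀ * (v₀ - a) := by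
    refine tendsto_nhds_unique ((hNc.tendsto a).mono_left (nhdsWithin_le_nhds (s := Ioi a)))
      (Tendsto.congr' (f₁ := fun ξ => r₀ * (v₀ - ξ)) ?_ ?_)
    · filter_upwards [self_mem_nhdsWithin] with ξ hξ using (hform ξ hξ).1.symm
    · exact (Continuous.tendsto (by fun_prop) a).mono_left nhdsWithin_le_nhds
  rw [hNa, hy] at hNa'
  have h1 : r₀ * (v₀ - b) = r₀ * (2 * (v₀ - a)) := by linarith
  have h2 := mul_left_cancel₀ hr₀.ne' h1
  have := ha.1
  linarith

end IsPressureLaw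

/-! ### The outgoing road -/

/-- The potential of the density on the outgoing road belongs to an entropy solution of a scalar
conservation law behind the initial cars, and to the initial state ahead of them. -/
lemma IsNetworkSolution.exists_potential_outgoing {n : ℕ} {J : MergeJunction n} {P : ℝ → ℝ}
    {Uin : Fin n → RoadState} {Uout : RoadState} (h : IsNetworkSolution J P Uin Uout)
    (hp : IsPressureLaw J.pOut) (hP : IsPressureLaw P) (hρOut : 0 < J.ρOut) (hvOut : 0 ≤ J.vOut)
    {q : ℝ}
    (hq : Tendsto (fun x => Uout.ρ x 1 * Uout.v (J.pressureOut P) x 1) (𝓝[>] 0) (𝓝 q)) :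
    ∃ C N M, Continuous N ∧
      IsPotential (Ioi 0) C (fun ξ => Uout.ρ ξ 1)
        (fun ξ => Uout.ρ ξ 1 * Uout.v (J.pressureOut P) ξ 1) N ∧ N 0 = q ∧ N J.vOut = 0 ∧
      IsEntropyPotential (flux P (meanMarker J.β J.wIn)) M (Ioo 0 J.vOut) N ∧
      ∀ ξ ∈ Ioi J.vOut \ C, Uout.ρ ξ 1 = J.ρOut ∧ Uout.ρ ξ 1 * Uout.w ξ 1 = J.ρOut * J.wOut := by
  have hst := h.state_out
  obtain ⟨M, hM⟩ := hst.bounded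
  set U := Uout with hU
  set V : ℝ → ℝ := fun ξ => U.v (J.pressureOut P) ξ 1 with hVdef
  set v₀ := J.vOut with hv₀
  set wbar := meanMarker J.β J.wIn with hwbar
  have Vlow : ∀ ξ < v₀, V ξ = U.w ξ 1 - P (U.ρ ξ 1) := fun ξ hξ => by
    simp only [hVdef, RoadState.v, MergeJunction.pressureOut, one_mul]
    rw [if_pos hξ]
  have Vhigh : ∀ ξ ≥ v₀, V ξ = U.w ξ 1 - J.pOut (U.ρ ξ 1) := fun ξ hξ => by
    simp only [hVdef, RoadState.v, MergeJunction.pressureOut, one_mul]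
    rw [if_neg (not_lt.2 hξ)]
  have hρb : ∀ ξ ∈ Ioi (0 : ℝ), 0 ≤ U.ρ ξ 1 ∧ U.ρ ξ 1 ≤ M := fun ξ hξ =>
    ⟨hst.density_nonneg ξ hξ 1 one_pos, (le_abs_self _).trans (hM ξ hξ 1 one_pos).1⟩
  have hVb : ∀ ξ ∈ Ioi (0 : ℝ), 0 ≤ V ξ ∧ V ξ ≤ M := fun ξ hξ => by
    refine ⟨hst.velocity_nonneg ξ hξ 1 one_pos, ?_⟩
    have h2 := (le_abs_self _).trans (hM ξ hξ 1 one_pos).2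
    rcases lt_or_ge ξ v₀ with hξv | hξv
    · have h1 := hP.pressure_nonneg (hρb ξ hξ).1
      rw [Vlow ξ hξv]
      linarith
    · have h1 := hp.pressure_nonneg (hρb ξ hξ).1
      rw [Vhigh ξ hξv]
      linarith
  have hlow := fun ξ (hξ : 0 < ξ ∧ ξ < v₀) => (h.admissible_triangle ξ hξ.1 hξ.2).exists_limits hP
    (Ioo_mem_nhds hξ.1 hξ.2) (V := V) (fun y hy => Vlow y hy.2) (fun y hy => hρb y hy.1)
    (fun y hy => hVb y hy.1)
  have hhigh := fun ξ (hξ : v₀ < ξ) => (h.admissible_ahead ξ (hvOut.trans_lt hξ)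
    hξ).exists_limits hp (Ioi_mem_nhds hξ) (V := V) (fun y hy => Vhigh y (le_of_lt hy))
    (fun y hy => hρb y (hvOut.trans_lt hy)) (fun y hy => hVb y (hvOut.trans_lt hy))
  choose! ρl ρr wl wr vl vr tρl tρr twl twr tvl tvr evl evr hent bρl bρr bvl bvr using hlow
  choose! ρl' ρr' wl' wr' vl' vr' tρl' tρr' twl' twr' tvl' tvr' evl' evr' hent' bρl' bρr' bvl' bvr'
    using hhigh
  have hside : ∀ {g gl gr gl' gr' : ℝ → ℝ},
      (∀ ξ, 0 < ξ ∧ ξ < v₀ → Tendsto g (𝓝[<] ξ) (𝓝 (gl ξ))) →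
      (∀ ξ, 0 < ξ ∧ ξ < v₀ → Tendsto g (𝓝[>] ξ) (𝓝 (gr ξ))) →
      (∀ ξ, v₀ < ξ → Tendsto g (𝓝[<] ξ) (𝓝 (gl' ξ))) →
      (∀ ξ, v₀ < ξ → Tendsto g (𝓝[>] ξ) (𝓝 (gr' ξ))) → HasSidedLimits g (Ioi 0 \ {v₀}) := by
    rintro g gl gr gl' gr' h1 h2 h3 h4 ξ ⟨hξ0, hξv⟩
    rcases lt_or_gt_of_ne hξv with hlt | hgt
    · exact ⟨⟨_, h1 ξ ⟨hξ0, hlt⟩⟩, ⟨_, h2 ξ ⟨hξ0, hlt⟩⟩⟩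
    · exact ⟨⟨_, h3 ξ hgt⟩, ⟨_, h4 ξ hgt⟩⟩
  -- The contact ray is left out because admissibility is not imposed there; the potential is
  -- continuous across it all the same.
  obtain ⟨C, M', hp1, hp2⟩ := exists_isProfile (D := Ioi 0) (S := Ioi 0 \ {v₀})
    ((countable_singleton v₀).mono (by rw [sdiff_sdiff_right_self]; exact inter_subset_right))
    (U := U) (p := J.pressureOut P) (V := V) (M := M) hst.selfSimilar
    (fun x hx t ht => by
      have hiff : x < t * J.vOut ↔ x / t < 1 * J.vOut := by rw [one_mul, div_lt_iff₀' ht]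
      simp only [hVdef, RoadState.v, MergeJunction.pressureOut, hiff]
      rw [(hst.selfSimilar x hx t ht).1, (hst.selfSimilar x hx t ht).2]) nonempty_Ioi
    (fun ξ hξ => ⟨(hM ξ hξ 1 one_pos).1, (hM ξ hξ 1 one_pos).2, by
      rw [abs_of_nonneg (hVb ξ hξ).1]; exact (hVb ξ hξ).2⟩)
    (hside tρl tρr tρl' tρr') (hside twl twr twl' twr') (hside tvl tvr tvl' tvr')
  have hD : IsRoadDomain (Ioi 0) := Or.inl rfl
  have hw1 := fun φ hφ h0 => (h.weak.outgoing (φ := φ) hφ h0).1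
  have hw2 := fun φ hφ h0 => (h.weak.outgoing (φ := φ) hφ h0).2
  obtain ⟨N, hNc, hN⟩ := hp1.exists_isPotential hD hw1
  obtain ⟨K, hKc, hK⟩ := hp2.exists_isPotential hD hw2
  have hNlim := hp1.tendsto_potential_div_atTop hN hNc hw1
  have hKlim := hp2.tendsto_potential_div_atTop hK hKc hw2
  have li1 := hp1.locallyIntegrableOn isOpen_Ioi
  have li2 := hp2.locallyIntegrableOn isOpen_Ioi
  have hpos : ∀ {ξ}, ξ > v₀ → ξ ∈ Ioi (0 : ℝ) := fun hξ => hvOut.trans_lt hξ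
  have hahead : ∀ ξ > v₀, N ξ = J.ρOut * (v₀ - ξ) ∧ K ξ = J.wOut * N ξ := by
    refine hp.potential_ahead (ρ := ρr') (m := wr') (M := M) hρOut hvOut hNc hKc bρr'
      (fun ξ hξ => ?_) (fun ξ hξ => ?_) (fun ξ hξ => ?_) (fun ξ hξ => ?_) (fun ξ hξ => ?_)
      hNlim hKlim
    · rw [← evr' ξ hξ]; exact (bvr' ξ hξ).1
    · rw [hN.eq_right isOpen_Ioi (hpos hξ) (tρr' ξ hξ) ((tρr' ξ hξ).mul (tvr' ξ hξ)), evr' ξ hξ]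
      ring
    · rw [hK.eq_right isOpen_Ioi (hpos hξ) ((tρr' ξ hξ).mul (twr' ξ hξ))
        (((tρr' ξ hξ).mul (tvr' ξ hξ)).mul (twr' ξ hξ)), evr' ξ hξ]
      ring
    · exact hN.hasDerivWithinAt_right isOpen_Ioi li1 (hpos hξ) (tρr' ξ hξ)
    · exact hK.hasDerivWithinAt_right isOpen_Ioi li2 (hpos hξ) ((tρr' ξ hξ).mul (twr' ξ hξ))
  refine ⟨C, N, M, hNc, hN, ?_, ?_, ?_, ?_⟩
  · exact hN.apply_zero_eq hNc isOpen_Ioi (by simp) subset_rfl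
      (fun ξ hξ => (hM ξ hξ 1 one_pos).1) hq
  -- The explicit potential ahead fixes the value on the contact ray, the second boundary value for
  -- the triangle.
  · refine tendsto_nhds_unique ((hNc.tendsto v₀).mono_left (nhdsWithin_le_nhds (s := Ioi v₀)))
      (Tendsto.congr' (f₁ := fun ξ => J.ρOut * (v₀ - ξ)) ?_ ?_)
    · filter_upwards [self_mem_nhdsWithin] with ξ hξ using (hahead ξ hξ).1.symm
    · refine ((Continuous.tendsto' (by fun_prop) v₀ 0 (by ring))).mono_left nhdsWithin_le_nhds
  · intro ξ hξ
    have hmark : ∀ y ∈ Ioo 0 v₀, U.w y 1 = wbar := fun y hy =>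
      h.marker y 1 one_pos hy.1 (by rw [one_mul]; exact hy.2)
    have hnear : Ioo 0 v₀ ∈ 𝓝 ξ := Ioo_mem_nhds hξ.1 hξ.2
    have ewl : wl ξ = wbar := tendsto_nhds_unique (twl ξ hξ) (tendsto_const_nhds.congr' (by
      filter_upwards [nhdsWithin_le_nhds hnear] with y hy using (hmark y hy).symm))
    have ewr : wr ξ = wbar := tendsto_nhds_unique (twr ξ hξ) (tendsto_const_nhds.congr' (by
      filter_upwards [nhdsWithin_le_nhds hnear] with y hy using (hmark y hy).symm))
    have e1 := evl ξ hξ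
    have e2 := evr ξ hξ
    rw [ewl] at e1
    rw [ewr] at e2
    refine ⟨ρl ξ, ρr ξ, (bρl ξ hξ).1, ?_, (bρr ξ hξ).2,
      hN.hasDerivWithinAt_left isOpen_Ioi li1 hξ.1 (tρl ξ hξ),
      hN.hasDerivWithinAt_right isOpen_Ioi li1 hξ.1 (tρr ξ hξ), ?_, ?_⟩
    · refine (hP.strictMonoOn.le_iff_le (bρl ξ hξ).1 (bρr ξ hξ).1).1 ?_
      have := hent ξ hξ
      linarith
    · rw [hN.eq_left isOpen_Ioi hξ.1 (tρl ξ hξ) ((tρl ξ hξ).mul (tvl ξ hξ)), e1, flux]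
    · rw [hN.eq_right isOpen_Ioi hξ.1 (tρr ξ hξ) ((tρr ξ hξ).mul (tvr ξ hξ)), e2, flux]
  · rintro ξ ⟨hξ, hξC⟩
    have hξ0 : ξ ∈ Ioi 0 \ C := ⟨hpos hξ, hξC⟩
    have hnear := Ioi_mem_nhds (show v₀ < ξ from hξ)
    have dN : HasDerivAt N (-J.ρOut) ξ := by
      refine (((hasDerivAt_id ξ).const_sub v₀).const_mul J.ρOut).congr_deriv (by ring)
        |>.congr_of_eventuallyEq ?_
      filter_upwards [hnear] with y hy using (hahead y hy).1
    have dK : HasDerivAt K (J.wOut * -J.ρOut) ξ := by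
      refine (dN.const_mul J.wOut).congr_of_eventuallyEq ?_
      filter_upwards [hnear] with y hy using (hahead y hy).2
    have e1 := (hN.hasDerivAt ξ hξ0).unique dN
    have e2 := (hK.hasDerivAt ξ hξ0).unique dK
    exact ⟨by linarith, by linarith⟩

/-! ### Uniqueness of network solutions -/

lemma IsEntropyPotential.mono {f H : ℝ → ℝ} {M M' : ℝ} {S : Set ℝ}
    (h : IsEntropyPotential f M S H) (hM : M ≤ M') : IsEntropyPotential f M' S H := by
  intro ξ hξ
  obtain ⟨l, r, h1, h2, h3, h4⟩ := h ξ hξ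
  exact ⟨l, r, h1, h2, h3.trans hM, h4⟩

lemma IsEntropyPotential.congr {f g H : ℝ → ℝ} {M : ℝ} {S : Set ℝ}
    (h : IsEntropyPotential f M S H) (hfg : ∀ ρ, 0 ≤ ρ → f ρ = g ρ) :
    IsEntropyPotential g M S H := by
  intro ξ hξ
  obtain ⟨l, r, h1, h2, h3, h4, h5, h6, h7⟩ := h ξ hξ
  rw [hfg l h1] at h6
  rw [hfg r (h1.trans h2)] at h7
  exact ⟨l, r, h1, h2, h3, h4, h5, h6, h7⟩

lemma IsPotential.density_unique {D C₁ C₂ s : Set ℝ} {U₁ U₂ F₁ F₂ H₁ H₂ : ℝ → ℝ}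
    (h₁ : IsPotential D C₁ U₁ F₁ H₁) (h₂ : IsPotential D C₂ U₂ F₂ H₂) (hs : IsOpen s)
    (hsD : s ⊆ D) (h : ∀ ξ ∈ s, H₁ ξ = H₂ ξ) : ∀ ξ ∈ s \ (C₁ ∪ C₂), U₁ ξ = U₂ ξ := by
  rintro ξ ⟨hξ, hξC⟩
  rw [mem_union, not_or] at hξC
  have d1 := h₁.hasDerivAt ξ ⟨hsD hξ, hξC.1⟩
  have d2 := (h₂.hasDerivAt ξ ⟨hsD hξ, hξC.2⟩).congr_of_eventuallyEq
    (mem_of_superset (hs.mem_nhds hξ) h)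
  exact neg_injective (d1.unique d2)

/-- At a fixed time, countably many exceptional rays meet the road in a null set. -/
lemma agreeOn_of_countable {D C : Set ℝ} (hD : IsRoadDomain D) (hC : C.Countable)
    {U V : RoadState} {p p' : ℝ → ℝ → ℝ → ℝ} (hU : IsRiemannState D p U)
    (hV : IsRiemannState D p' V)
    (h : ∀ ξ ∈ D \ C, U.ρ ξ 1 = V.ρ ξ 1 ∧ U.ρ ξ 1 * U.w ξ 1 = V.ρ ξ 1 * V.w ξ 1) :
    AgreeOn D U V := by
  intro t ht
  have hinj : Function.Injective fun x : ℝ => x / t :=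
    fun x y hxy => (div_left_inj' ht.ne').1 hxy
  have hnull : ∀ᵐ x ∂(volume.restrict D), x ∉ (fun x : ℝ => x / t) ⁻¹' C :=
    ae_restrict_of_ae (compl_mem_ae_iff.2 ((hC.preimage hinj).measure_zero volume))
  filter_upwards [hnull, ae_restrict_mem hD.isOpen.measurableSet] with x hx hxD
  have h1 := hU.selfSimilar x hxD t ht
  have h2 := hV.selfSimilar x hxD t ht
  rw [h1.1, h1.2, h2.1, h2.2]
  exact h (x / t) ⟨(hD.div_mem_iff x t ht).2 hxD, hx⟩

namespace IsNetworkSolution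

variable {n : ℕ} {J : MergeJunction n} {P P' : ℝ → ℝ} {Uin Uin' : Fin n → RoadState}
  {Uout Uout' : RoadState}

/-- Both potentials have the same value at `0` and the same growth at `-∞`, so comparison in both
directions identifies them; on an initially empty road both are zero. -/
lemma agreeOn_incoming (h : IsNetworkSolution J P Uin Uout)
    (h' : IsNetworkSolution J P' Uin' Uout') (i : Fin n) (hp : IsPressureLaw (J.pIn i))
    (hρ : 0 ≤ J.ρIn i) {q : ℝ}
    (hq : Tendsto (fun x => (Uin i).ρ x 1 * (Uin i).v (J.pressureIn i) x 1) (𝓝[<] 0) (𝓝 q))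
    (hq' : Tendsto (fun x => (Uin' i).ρ x 1 * (Uin' i).v (J.pressureIn i) x 1) (𝓝[<] 0) (𝓝 q)) :
    AgreeOn (Iio 0) (Uin i) (Uin' i) := by
  obtain ⟨C₁, N₁, M₁, hc₁, hN₁, hm₁, h0₁, hl₁, hz₁, he₁⟩ := h.exists_potential_incoming i hp hq
  obtain ⟨C₂, N₂, M₂, hc₂, hN₂, hm₂, h0₂, hl₂, hz₂, he₂⟩ := h'.exists_potential_incoming i hp hq'
  have hNN : ∀ ξ ∈ Iio (0 : ℝ), N₁ ξ = N₂ ξ := by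
    intro ξ hξ
    rcases hρ.eq_or_lt with hz | hpos
    · rw [hz₁ hz.symm ξ hξ, hz₂ hz.symm ξ hξ]
    · have e₁ := (he₁ hpos).mono (le_max_left M₁ M₂)
      have e₂ := (he₂ hpos).mono (le_max_right M₁ M₂)
      have h00 := h0₁.trans h0₂.symm
      have hf := hp.concaveOn_flux (J.wIn i)
      have hfc := hp.continuousOn_flux (J.wIn i)
      exact le_antisymm (IsEntropyPotential.le_on_Iio hf hfc hc₁.continuousOn hc₂.continuousOn e₁ e₂
        h00 hl₁ hl₂ ξ hξ) (IsEntropyPotential.le_on_Iio hf hfc hc₂.continuousOn hc₁.continuousOn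
        e₂ e₁ h00.symm hl₂ hl₁ ξ hξ)
  refine agreeOn_of_countable (Or.inr rfl) (hN₁.countable.union hN₂.countable) (h.state_in i)
    (h'.state_in i) fun ξ hξ => ?_
  have hρρ := hN₁.density_unique hN₂ isOpen_Iio subset_rfl hNN ξ hξ
  obtain ⟨hξ0, hξC⟩ := hξ
  rw [mem_union, not_or] at hξC
  refine ⟨hρρ, ?_⟩
  rw [hm₁ ξ ⟨hξ0, hξC.1⟩, hm₂ ξ ⟨hξ0, hξC.2⟩]
  exact congrArg (· * J.wIn i) hρρ

/-- In the triangle the potentials share the boundary values `q` at `0` and `0` at the contact;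
ahead of it both states are the initial one. -/
lemma agreeOn_outgoing (h : IsNetworkSolution J P Uin Uout)
    (h' : IsNetworkSolution J P' Uin' Uout') (hp : IsPressureLaw J.pOut) (hP : IsPressureLaw P)
    (hP' : IsPressureLaw P') (hPP : ∀ ρ, 0 ≤ ρ → P' ρ = P ρ) (hρOut : 0 < J.ρOut)
    (hvOut : 0 ≤ J.vOut) {q : ℝ}
    (hq : Tendsto (fun x => Uout.ρ x 1 * Uout.v (J.pressureOut P) x 1) (𝓝[>] 0) (𝓝 q))
    (hq' : Tendsto (fun x => Uout'.ρ x 1 * Uout'.v (J.pressureOut P') x 1) (𝓝[>] 0) (𝓝 q)) :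
    AgreeOn (Ioi 0) Uout Uout' := by
  obtain ⟨C₁, N₁, M₁, hc₁, hN₁, h0₁, hv₁, he₁, ha₁⟩ :=
    h.exists_potential_outgoing hp hP hρOut hvOut hq
  obtain ⟨C₂, N₂, M₂, hc₂, hN₂, h0₂, hv₂, he₂, ha₂⟩ :=
    h'.exists_potential_outgoing hp hP' hρOut hvOut hq'
  have hNN : EqOn N₁ N₂ (Icc 0 J.vOut) :=
    IsEntropyPotential.eqOn_Icc (hP.concaveOn_flux _) hc₁.continuousOn hc₂.continuousOn
      (he₁.mono (le_max_left M₁ M₂))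
      ((he₂.congr fun ρ hρ => flux_congr hPP hρ).mono (le_max_right M₁ M₂))
      (h0₁.trans h0₂.symm) (hv₁.trans hv₂.symm)
  refine agreeOn_of_countable (Or.inl rfl)
    ((hN₁.countable.union hN₂.countable).union (countable_singleton J.vOut)) h.state_out
    h'.state_out fun ξ ⟨hξ, hξC⟩ => ?_
  rw [mem_union, mem_singleton_iff, not_or] at hξC
  rcases lt_or_gt_of_ne hξC.2 with hlt | hgt
  · have hρρ := hN₁.density_unique hN₂ (isOpen_Ioo (a := 0) (b := J.vOut)) Ioo_subset_Ioi_self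
      (fun y hy => hNN (Ioo_subset_Icc_self hy)) ξ ⟨⟨hξ, hlt⟩, hξC.1⟩
    refine ⟨hρρ, ?_⟩
    rw [h.marker ξ 1 one_pos hξ (by rwa [one_mul]), h'.marker ξ 1 one_pos hξ (by rwa [one_mul])]
    exact congrArg (· * meanMarker J.β J.wIn) hρρ
  · rw [mem_union, not_or] at hξC
    have e₁ := ha₁ ξ ⟨hgt, hξC.1.1⟩
    have e₂ := ha₂ ξ ⟨hgt, hξC.1.2⟩
    exact ⟨e₁.1.trans e₂.1.symm, e₁.2.trans e₂.2.symm⟩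

end IsNetworkSolution

end ARZ

end

theorem lemma1 {n : ℕ} (J : ARZ.MergeJunction n) (c γ : ℝ) (hc : 0 < c) (hγ : 1 ≤ γ)
    (hpOut : ∀ ρ, 0 ≤ ρ → J.pOut ρ = c * ρ ^ γ)
    (hpIn : ∀ i, ARZ.IsPressureLaw (J.pIn i))
    (hρIn : ∀ i, 0 ≤ J.ρIn i) (hwIn : ∀ i, 0 < J.wIn i)
    (hvIn : ∀ i, 0 ≤ J.wIn i - J.pIn i (J.ρIn i))
    (hρOut : 0 < J.ρOut) (hvOut : 0 ≤ J.vOut)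
    (hβ : ∀ i, 0 ≤ J.β i) (hβsum : ∑ i, J.β i = 1) :
    (∀ P : ℝ → ℝ, ARZ.IsApproxHomogenizedPressure J.pOut J.β J.wIn P ↔
      ∀ ρ, 0 ≤ ρ → P ρ =
        c * (∑ i, J.β i * J.wIn i * (∑ l, J.β l / (J.wIn l) ^ (1 / γ)) ^ γ) * ρ ^ γ) ∧
    (∃ (Uin : Fin n → ARZ.RoadState) (Uout : ARZ.RoadState),
      ARZ.IsNetworkSolution J
        (fun ρ => c * (∑ i, J.β i * J.wIn i * (∑ l, J.β l / (J.wIn l) ^ (1 / γ)) ^ γ) * ρ ^ γ)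
        Uin Uout ∧
      ∀ (P' : ℝ → ℝ) (Uin' : Fin n → ARZ.RoadState) (Uout' : ARZ.RoadState),
        ARZ.IsNetworkSolution J P' Uin' Uout' →
          (∀ i, ARZ.AgreeOn (Iio 0) (Uin' i) (Uin i)) ∧ ARZ.AgreeOn (Ioi 0) Uout' Uout) := by
  have hc₁ := ARZ.approxCoeff_pos hc hβ hβsum hwIn (γ := γ)
  have hiff := ARZ.isApproxHomogenizedPressure_iff hc hγ hpOut hβ hβsum hwIn
  have hp := ARZ.isPressureLaw_of_eq_rpow hc hγ hpOut
  have hP := ARZ.isPressureLaw_of_eq_rpow (p := fun ρ => ARZ.approxCoeff J.β J.wIn c γ * ρ ^ γ)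
    hc₁ hγ fun _ _ => rfl
  refine ⟨hiff, ?_⟩
  obtain ⟨Uin, Uout, h⟩ := ARZ.exists_isNetworkSolution J hP ((hiff _).2 fun _ _ => rfl) hpIn hρIn
    hwIn hvIn hρOut.le hvOut hβ hβsum
  refine ⟨Uin, Uout, h, fun P' Uin' Uout' h' => ?_⟩
  have hPP := (hiff P').1 h'.pressure
  have hP' := ARZ.isPressureLaw_of_eq_rpow hc₁ hγ hPP
  obtain ⟨q, hq, hqi, hqo⟩ := h.junction_flux
  obtain ⟨q', hq', hqi', hqo'⟩ := h'.junction_flux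
  have hwb := (ARZ.meanMarker_pos hβ hβsum hwIn).le
  -- Both solutions have the same junction fluxes, so the road-by-road uniqueness statements apply.
  obtain rfl := (hq.congr hP' hPP hwb).unique hβsum hq'
  exact ⟨fun i => h'.agreeOn_incoming h i (hpIn i) (hρIn i) (hqi' i) (hqi i),
    h'.agreeOn_outgoing h hp hP' hP (fun ρ hρ => (hPP ρ hρ).symm) hρOut hvOut hqo' hqo⟩
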